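/- \textbf{Setting.} An \emph{mm-space} is a complete separable metric space $X$ of diameter at most $1$ with a Borel probability measure $\mu_X$ of full support; $\chi$ is the set of mm-spaces up to measure-preserving isometry. Let $M_\infty$ be the compact space (product topology) of matrices $(d_{ij})_{i,j\ge 1}$ with $0\le d_{ij}\le 1$, $d_{ij}=d_{ji}$, $d_{ii}=0$. For an mm-space $X$ let $\tau(X)\in\mathcal P(M_\infty)$ be the law of $(d_X(x_i,x_j))_{i,j}$, where $x_1,x_2,\dots$ are independent $\mu_X$-random points, and let $\overline\chi$ be the closure of $\tau(\chi)$ in $\mathcal P(M_\infty)$ for the weak topology; $\chi$ is identified with $\tau(\chi)\subset\overline\chi$. A \emph{qmm-space} $(X,\mu,d^*)$ is a standard Borel probability space with a Borel map $d^*:X\times X\to\mathcal P[0,1]$ such that $d^*(x,x)=\delta_0$, $d^*(x,y)=d^*(y,x)$, and for $\mu^3$-almost every $(a,b,c)$ independent random lengths with laws $d^*(a,b)$, $d^*(b,c)$, $d^*(a,c)$ almost surely satisfy the triangle inequalities. Its sampling measure $\tau(X)\in\mathcal P(M_\infty)$ is the law of the random matrix obtained by choosing independent $\mu$-random points $x_1,x_2,\dots$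 and then, independently for all $i<j$, entries $d_{ij}=d_{ji}$ with law $d^*(x_i,x_j)$ (and $d_{ii}=0$). Let $Y$ be a compact metric space and $0<\kappa<1$. For $\nu\in\mathcal P(Y)$ let $diam(\nu,\kappa)$ be the infimum of the diameters of the Borel sets $Y_0\subset Y$ with $\nu(Y_0)\ge 1-\kappa$. For an mm-space $X$, $Lip_1(X,Y)$ is the set of $1$-Lipschitz maps $X\to Y$; for a qmm-space $(X,\mu,d^*)$, $Lip_1(X,Y)$ is the set of measurable maps $f:X\to Y$ with $d_Y(f(x_1),f(x_2))\le\,\downarrow\! d^*(x_1,x_2)$ for $\mu\times\mu$-almost all $(x_1,x_2)$, where $\downarrow\!\nu$ is the infimum of the support of $\nu\in\mathcal P[0,1]$. In both cases $$ObsDiam_Y(X,\kappa)=\sup_{f\in Lip_1(X,Y)} diam(f_*\mu_X,\kappa).$$ \textbf{Theorem.} For every compact metric space $Y$, the functions $ObsDiam_Y(\cdot,\kappa)$, $0<\kappa<1$, extend from $\chi$ to $\overline\chi$ through qmm-spaces in an essentially upper semicontinuous way. That is, every $\zeta\in\overline\chi$ equals $\tau(X)$ for some qmm-space $X$, $\tau(X)\in\overline\chi$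 for every qmm-space $X$, and there is a function $(\zeta,\kappa)\mapsto ObsDiam_Y(\zeta,\kappa)$ on $\overline\chi\times(0,1)$ such that \begin{enumerate} \item $ObsDiam_Y(\tau(X),\kappa)=ObsDiam_Y(X,\kappa)$ for every mm-space $X$ and $0<\kappa<1$; \item $ObsDiam_Y(\tau(X),\kappa)=ObsDiam_Y(X,\kappa)$ for every qmm-space $X$ and $0<\kappa<1$; \item if $\zeta_n\to\zeta$ weakly in $\overline\chi$ and $0<\kappa'<\kappa<1$, then $$\limsup_{n\to\infty} ObsDiam_Y(\zeta_n,\kappa)\le ObsDiam_Y(\zeta,\kappa').$$ \end{enumerate} -/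

import Mathlib

open MeasureTheory ProbabilityTheory Filter Topology
open scoped ENNReal unitInterval

noncomputable section

/-- The compact space `M_∞` of infinite symmetric matrices with entries in `[0,1]` and zero
diagonal, with the product topology and its Borel σ-algebra. -/
abbrev DistMatrix : Type :=
  {d : ℕ → ℕ → I // (∀ i j, d i j = d j i) ∧ ∀ i, d i i = 0}

/-- An mm-space: a complete separable metric space of diameter at most one with a Borel
probability measure of full support. (Every such space has a copy in `Type`.) -/
structure MMSpace where
  carrier : Type
  [metricSpace : MetricSpace carrier]
  [completeSpace : CompleteSpace carrier]
  [separableSpace : TopologicalSpace.SeparableSpace carrier]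
  [measurableSpace : MeasurableSpace carrier]
  [borelSpace : BorelSpace carrier]
  dist_le_one : ∀ x y : carrier, dist x y ≤ 1
  μ : Measure carrier
  [isProbabilityMeasure : IsProbabilityMeasure μ]
  [fullSupport : μ.IsOpenPosMeasure]

attribute [instance] MMSpace.metricSpace MMSpace.completeSpace MMSpace.separableSpace
  MMSpace.measurableSpace MMSpace.borelSpace MMSpace.isProbabilityMeasure MMSpace.fullSupport

/-- A quantum metric measure space: a standard Borel probability space with a measurable
`P[0,1]`-valued (that is, Markov kernel) distance. -/
structure QMMSpace where
  carrier : Type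
  [measurableSpace : MeasurableSpace carrier]
  [standardBorelSpace : StandardBorelSpace carrier]
  μ : Measure carrier
  [isProbabilityMeasure : IsProbabilityMeasure μ]
  dStar : Kernel (carrier × carrier) I
  [isMarkovKernel : IsMarkovKernel dStar]
  dStar_self : ∀ x, dStar (x, x) = Measure.dirac 0
  dStar_comm : ∀ x y, dStar (x, y) = dStar (y, x)
  /-- For almost all triples `(a, b, c)`, independent random lengths `l(a,b)`, `l(b,c)`, `l(a,c)`
  almost surely satisfy the triangle inequalities. -/
  triangle : ∀ᵐ p ∂(μ.prod (μ.prod μ)),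
    ∀ᵐ l ∂((dStar (p.1, p.2.1)).prod ((dStar (p.2.1, p.2.2)).prod (dStar (p.1, p.2.2)))),
      (l.2.2 : ℝ) ≤ l.1 + l.2.1 ∧ (l.1 : ℝ) ≤ l.2.1 + l.2.2 ∧ (l.2.1 : ℝ) ≤ l.1 + l.2.2

attribute [instance] QMMSpace.measurableSpace QMMSpace.standardBorelSpace
  QMMSpace.isProbabilityMeasure QMMSpace.isMarkovKernel

namespace MMSpace

/-- The matrix of mutual distances of a sequence of points. -/
def distMatrix (X : MMSpace) (x : ℕ → X.carrier) : DistMatrix :=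
  ⟨fun i j => ⟨dist (x i) (x j), dist_nonneg, X.dist_le_one _ _⟩,
    fun _ _ => Subtype.ext (dist_comm _ _), fun _ => Subtype.ext (dist_self _)⟩

theorem measurable_distMatrix (X : MMSpace) : Measurable X.distMatrix := by
  have : SecondCountableTopology X.carrier := UniformSpace.secondCountable_of_separable _
  refine Measurable.subtype_mk ?_
  refine measurable_pi_lambda _ fun i => measurable_pi_lambda _ fun j => ?_
  refine Measurable.subtype_mk ?_
  exact (measurable_pi_apply i).dist (measurable_pi_apply j)

/-- The sampling measure `τ(X)` on `M_∞`: the law of the distance matrix of a sequence of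
independent `μ`-random points. -/
def sampling (X : MMSpace) : ProbabilityMeasure DistMatrix :=
  ⟨(Measure.infinitePi fun _ : ℕ => X.μ).map X.distMatrix,
    Measure.isProbabilityMeasure_map X.measurable_distMatrix.aemeasurable⟩

end MMSpace

/-- The compactification `χ̄`: the weak closure of the sampling measures of all mm-spaces. -/
def ChiBar : Set (ProbabilityMeasure DistMatrix) :=
  closure (Set.range MMSpace.sampling)

/-- The symmetric matrix with zero diagonal whose entry at `i < j` is `ω (i, j)`. -/
def symmMatrix (ω : ℕ × ℕ → I) : DistMatrix :=
  ⟨fun i j => if i = j then 0 else ω (min i j, max i j),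
    fun i j => by simp only [eq_comm, min_comm, max_comm], fun i => by simp⟩

theorem measurable_symmMatrix : Measurable symmMatrix := by
  refine Measurable.subtype_mk ?_
  refine measurable_pi_lambda _ fun i => measurable_pi_lambda _ fun j => ?_
  by_cases h : i = j
  · simp [h]
  · simpa [h] using measurable_pi_apply _

namespace QMMSpace

/-- For a sequence of points `x`, the law on `M_∞` of the random matrix whose entries at the
positions `i < j` are independent with laws `d*(x i, x j)`. -/
def matrixLaw (X : QMMSpace) (x : ℕ → X.carrier) : Measure DistMatrix :=
  (Measure.infinitePi fun p : ℕ × ℕ => X.dStar (x p.1, x p.2)).map symmMatrix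

instance (X : QMMSpace) (x : ℕ → X.carrier) : IsProbabilityMeasure (X.matrixLaw x) :=
  Measure.isProbabilityMeasure_map measurable_symmMatrix.aemeasurable

theorem measurable_matrixLaw (X : QMMSpace) : Measurable X.matrixLaw := by
  refine (Measure.measurable_map _ measurable_symmMatrix).comp ?_
  refine Measurable.measure_of_isPiSystem_of_isProbabilityMeasure
    (generateFrom_squareCylinders (α := fun _ : ℕ × ℕ => I)).symm
    (isPiSystem_squareCylinders (fun _ => MeasurableSpace.isPiSystem_measurableSet)
      (fun _ => MeasurableSet.univ (α := I))) ?_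
  rintro _ ⟨s, t, ht, rfl⟩
  have h : ∀ x : ℕ → X.carrier,
      (Measure.infinitePi fun p : ℕ × ℕ => X.dStar (x p.1, x p.2)) ((s : Set (ℕ × ℕ)).pi t) =
        ∏ p ∈ s, X.dStar (x p.1, x p.2) (t p) := fun x =>
    Measure.infinitePi_pi _ fun p _ => ht p (Set.mem_univ p)
  simp only [h]
  refine Finset.measurable_prod _ fun p _ => ?_
  refine (X.dStar.measurable_coe (ht p (Set.mem_univ p))).comp ?_
  exact (measurable_pi_apply p.1).prodMk (measurable_pi_apply p.2)

/-- The sampling measure `τ(X)` on `M_∞`: the barycenter (mixture) of the laws `matrixLaw x`,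
where `x` is a sequence of independent `μ`-random points. -/
def sampling (X : QMMSpace) : ProbabilityMeasure DistMatrix :=
  ⟨(Measure.infinitePi fun _ : ℕ => X.μ).bind X.matrixLaw,
    isProbabilityMeasure_bind X.measurable_matrixLaw.aemeasurable
      (Eventually.of_forall fun _ => inferInstance)⟩

end QMMSpace

/-- The infimum `↓ν` of the support of a probability measure on `[0,1]`. -/
def lowerEnd (ν : Measure I) : ℝ :=
  sInf ((fun t : I => (t : ℝ)) '' ν.support)

/-- The `1`-Lipschitz maps from a qmm-space to a metric space. -/
def QMMSpace.Lip1 (X : QMMSpace) (Y : Type*) [MetricSpace Y] [MeasurableSpace Y] :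
    Set (X.carrier → Y) :=
  {f | Measurable f ∧ ∀ᵐ p ∂(X.μ.prod X.μ), dist (f p.1) (f p.2) ≤ lowerEnd (X.dStar p)}

/-- The partial diameter `diam(ν, κ)`: the infimum of the diameters of the measurable sets of
`ν`-measure at least `1 - κ`. -/
def partialDiam {Y : Type*} [MetricSpace Y] [MeasurableSpace Y] (ν : Measure Y) (κ : ℝ) : ℝ≥0∞ :=
  ⨅ (A : Set Y) (_ : MeasurableSet A ∧ ENNReal.ofReal (1 - κ) ≤ ν A), Metric.ediam A

/-- The observational diameter `ObsDiam_Y(X, κ)` of an mm-space. -/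
def MMSpace.obsDiam (X : MMSpace) (Y : Type*) [MetricSpace Y] [MeasurableSpace Y] (κ : ℝ) : ℝ≥0∞ :=
  ⨆ (f : X.carrier → Y) (_ : LipschitzWith 1 f), partialDiam (X.μ.map f) κ

/-- The observational diameter `ObsDiam_Y(X, κ)` of a qmm-space. -/
def QMMSpace.obsDiam (X : QMMSpace) (Y : Type*) [MetricSpace Y] [MeasurableSpace Y] (κ : ℝ) :
    ℝ≥0∞ :=
  ⨆ (f : X.carrier → Y) (_ : f ∈ X.Lip1 Y), partialDiam (X.μ.map f) κ

end

/-!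
Exchangeability, dissociation (disjoint subsamples are independent) and the triangle inequality are
closed conditions, hence hold on `χ̄`. Conversely, let `ζ` satisfy them. The finite uniform
mm-spaces on the first `n` points of a `ζ`-random matrix have sampling laws whose mean converges to
`ζ` and whose fluctuations vanish by dissociation, so `ζ ∈ χ̄`. Moreover, given the submatrix on the
odd indices, the rows of distances from the even indices to the odd ones are independent, and given
these rows the even entries are independent: a typical odd submatrix, frozen, exhibits `ζ` as a
mixture of product laws, directed by the rows as random points of a qmm-space. Multiplying that
space by an interval makes room for `d*(x, x) = δ₀`. So `χ̄` is the set of sampling laws of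
qmm-spaces.

For the observational diameter, let `X n → X` and let `f n` be `1`-Lipschitz on `X n` with laws
converging to `ν`. Samples of `X n` can be labelled, by `f n`, in a contracting way with label
statistics close to `ν`. This is a closed condition on the distance matrix, so it passes to `X`.
There are only `exp (O(N))` labellings of `N` points by a finite net of `Y`, while a fixed
labelling whose label distances exceed `↓d*` substantially at a positive proportion of the pairs is
contracting only with probability `exp (-c N^2)`. Hence samples of `X` carry labellings with small
mean excess over the random lengths, and the limits of their empirical measures are couplings of `μ`
and `ν` without excess. A random map with the conditional laws of such a coupling, drawn
independently on many small cells of `X`, is `1`-Lipschitz and has law close to `ν`. Finally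
`diam (·, κ)` is weakly lower semicontinuous, and upper semicontinuous up to increasing `κ`.
-/

open scoped BoundedContinuousFunction

noncomputable section

/-! ### Random distance matrices -/

section ProductMeasures

theorem comap_pi_le_iSup {Ω ι κ α : Type*} [MeasurableSpace α] (X : ι → Ω → α) (f : κ → ι) :
    MeasurableSpace.comap (fun ω k => X (f k) ω) MeasurableSpace.pi ≤
      ⨆ i ∈ Set.range f, MeasurableSpace.comap (X i) inferInstance := by
  rw [MeasurableSpace.pi, MeasurableSpace.comap_iSup]
  refine iSup_le fun k => ?_
  rw [MeasurableSpace.comap_comp]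
  exact le_iSup₂_of_le (f k) ⟨k, rfl⟩ le_rfl

theorem indepFun_comp_of_disjoint_range {Ω ι κ κ' α : Type*} [MeasurableSpace Ω]
    [MeasurableSpace α] {P : Measure Ω} {X : ι → Ω → α} (hX : iIndepFun X P)
    (hXm : ∀ i, Measurable (X i)) {f : κ → ι} {g : κ' → ι}
    (hfg : Disjoint (Set.range f) (Set.range g)) :
    IndepFun (fun ω k => X (f k) ω) (fun ω k => X (g k) ω) P := by
  have h := indep_iSup_of_disjoint (fun i => (hXm i).comap_le) hX.iIndep hfg
  exact indep_of_indep_of_le_left (indep_of_indep_of_le_right h (comap_pi_le_iSup X g))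
    (comap_pi_le_iSup X f)

theorem indepFun_map {Ω Ω' β γ : Type*} [MeasurableSpace Ω] [MeasurableSpace Ω']
    [MeasurableSpace β] [MeasurableSpace γ] {P : Measure Ω} {T : Ω → Ω'} (hT : Measurable T)
    {f : Ω' → β} {g : Ω' → γ} (hf : Measurable f) (hg : Measurable g)
    (h : IndepFun (f ∘ T) (g ∘ T) P) : IndepFun f g (P.map T) := by
  refine indepFun_iff_measure_inter_preimage_eq_mul.2 fun s t hs ht => ?_
  rw [Measure.map_apply hT (hf hs), Measure.map_apply hT (hg ht),
    Measure.map_apply hT ((hf hs).inter (hg ht))]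
  exact h.measure_inter_preimage_eq_mul s t hs ht

variable {ι : Type*} {α : ι → Type*} [∀ i, MeasurableSpace (α i)] (P : ∀ i, Measure (α i))
  [∀ i, IsProbabilityMeasure (P i)]

theorem infinitePi_map_eval_triple {i j k : ι} (hij : i ≠ j) (hik : i ≠ k) (hjk : j ≠ k) :
    (Measure.infinitePi P).map (fun ω => (ω i, ω j, ω k)) = (P i).prod ((P j).prod (P k)) := by
  have h : IndepFun (fun ω => ω i) (fun ω => (ω j, ω k)) (Measure.infinitePi P) :=
    ((iIndepFun_infinitePi (P := P) (X := fun _ ω => ω) fun _ => by fun_prop).indepFun_prodMk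
      (fun _ => by fun_prop) j k i hij.symm hik.symm).symm
  rw [(indepFun_iff_map_prod_eq_prod_map_map (measurable_pi_apply i).aemeasurable
    (by fun_prop)).1 h, Measure.infinitePi_map_eval_prod hjk, Measure.infinitePi_map_eval]

end ProductMeasures

namespace DistMatrix

@[fun_prop] theorem continuous_entry (i j : ℕ) : Continuous fun d : DistMatrix => d.1 i j :=
  (continuous_apply j).comp ((continuous_apply i).comp continuous_subtype_val)

@[fun_prop] theorem measurable_entry (i j : ℕ) : Measurable fun d : DistMatrix => d.1 i j :=
  (measurable_pi_apply j).comp ((measurable_pi_apply i).comp measurable_subtype_coe)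

/-- The matrix `(i, j) ↦ d (φ i) (φ j)` of the subsequence `φ`. -/
def reindex (φ : ℕ → ℕ) (d : DistMatrix) : DistMatrix :=
  ⟨fun i j => d.1 (φ i) (φ j), fun _ _ => d.2.1 _ _, fun _ => d.2.2 _⟩

@[simp] theorem reindex_apply (φ : ℕ → ℕ) (d : DistMatrix) (i j : ℕ) :
    (reindex φ d).1 i j = d.1 (φ i) (φ j) := rfl

@[fun_prop] theorem continuous_reindex (φ : ℕ → ℕ) : Continuous (reindex φ) :=
  Continuous.subtype_mk (continuous_pi fun _ => continuous_pi fun _ => continuous_entry _ _) _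

@[fun_prop] theorem measurable_reindex (φ : ℕ → ℕ) : Measurable (reindex φ) :=
  Measurable.subtype_mk <|
    measurable_pi_lambda _ fun _ => measurable_pi_lambda _ fun _ => measurable_entry _ _

/-- The positions above the diagonal of a matrix. -/
abbrev Upper : Type := {p : ℕ × ℕ // p.1 < p.2}

/-- The position above the diagonal of the unordered pair `{i, j}`. -/
def Upper.ofNe {i j : ℕ} (h : i ≠ j) : Upper := ⟨(min i j, max i j), min_lt_max.2 h⟩

theorem Upper.ofNe_of_lt {i j : ℕ} (h : i < j) : ofNe h.ne = ⟨(i, j), h⟩ := by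
  simp [ofNe, h.le]

theorem Upper.ofNe_comm {i j : ℕ} (h : i ≠ j) : ofNe h = ofNe h.symm := by
  simp [ofNe, min_comm, max_comm]

theorem Upper.ofNe_eq_ofNe_iff {i j k l : ℕ} (h : i ≠ j) (h' : k ≠ l) :
    ofNe h = ofNe h' ↔ (i = k ∧ j = l) ∨ (i = l ∧ j = k) := by
  simp only [ofNe, Subtype.mk.injEq, Prod.mk.injEq]
  omega

/-- The position of the pair of the `φ`-images of the indices of a position. -/
def Upper.map {φ : ℕ → ℕ} (hφ : φ.Injective) (p : Upper) : Upper := ofNe (hφ.ne p.2.ne)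

theorem Upper.map_ofNe {φ : ℕ → ℕ} (hφ : φ.Injective) {i j : ℕ} (h : i ≠ j) :
    map hφ (ofNe h) = ofNe (hφ.ne h) := by
  rcases lt_or_gt_of_ne h with hij | hij
  · rw [ofNe_of_lt hij, map]
  · rw [ofNe_comm h, ofNe_of_lt hij, map, ofNe_comm]

theorem Upper.map_injective {φ : ℕ → ℕ} (hφ : φ.Injective) : (map hφ).Injective := by
  rintro ⟨⟨i, j⟩, hij⟩ ⟨⟨k, l⟩, hkl⟩ h
  rw [map, map, ofNe_eq_ofNe_iff, hφ.eq_iff, hφ.eq_iff, hφ.eq_iff, hφ.eq_iff] at h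
  simp only [Subtype.mk.injEq, Prod.mk.injEq]
  simp only at h hij hkl
  omega

theorem Upper.disjoint_range_map {φ ψ : ℕ → ℕ} (hφ : φ.Injective) (hψ : ψ.Injective)
    (h : Disjoint (Set.range φ) (Set.range ψ)) :
    Disjoint (Set.range (map hφ)) (Set.range (map hψ)) := by
  refine Set.disjoint_range_iff.2 fun p q hpq => ?_
  have hne := Set.disjoint_range_iff.1 h
  rcases (ofNe_eq_ofNe_iff _ _).1 hpq with ⟨h, -⟩ | ⟨h, -⟩ <;> exact hne _ _ h

/-- A distance matrix is the same as an arbitrary family of entries above the diagonal. -/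
def upperEquiv : DistMatrix ≃ᵐ (Upper → I) where
  toFun d p := d.1 p.1.1 p.1.2
  invFun ω := ⟨fun i j => if h : i = j then 0 else ω (Upper.ofNe h),
    fun i j => by simp only [Upper.ofNe, eq_comm, min_comm, max_comm], fun i => by simp⟩
  left_inv d := by
    refine Subtype.ext <| funext₂ fun i j => ?_
    rcases lt_trichotomy i j with h | rfl | h
    · simp [Upper.ofNe, h.ne, h.le]
    · simp [d.2.2]
    · simp [Upper.ofNe, h.ne', h.le, d.2.1 i j]
  right_inv ω := funext fun ⟨⟨i, j⟩, h⟩ => by simp [h.ne, Upper.ofNe_of_lt h]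
  measurable_toFun := measurable_pi_lambda _ fun _ => measurable_entry _ _
  measurable_invFun := Measurable.subtype_mk <| measurable_pi_lambda _ fun i =>
    measurable_pi_lambda _ fun j => by
      by_cases h : i = j
      · simp [h]
      · simpa [h] using measurable_pi_apply _

theorem upperEquiv_apply (d : DistMatrix) (p : Upper) : upperEquiv d p = d.1 p.1.1 p.1.2 := rfl

theorem upperEquiv_symm_apply (ω : Upper → I) {i j : ℕ} (h : i ≠ j) :
    (upperEquiv.symm ω).1 i j = ω (Upper.ofNe h) :=
  dif_neg h

theorem reindex_upperEquiv_symm {φ : ℕ → ℕ} (hφ : φ.Injective) (ω : Upper → I) :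
    reindex φ (upperEquiv.symm ω) = upperEquiv.symm fun p => ω (Upper.map hφ p) := by
  refine Subtype.ext <| funext₂ fun i j => ?_
  rcases eq_or_ne i j with rfl | h
  · exact ((reindex φ _).2.2 i).trans ((upperEquiv.symm _).2.2 i).symm
  · rw [reindex_apply, upperEquiv_symm_apply _ (hφ.ne h), upperEquiv_symm_apply _ h,
      Upper.map_ofNe hφ h]

end DistMatrix

open DistMatrix

/-- The properties shared by the laws of the distance matrices of random samples: exchangeability,
independence of the matrices of disjoint subsamples, and the triangle inequality. -/
structure IsSamplingLaw (ζ : Measure DistMatrix) : Prop where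
  exchangeable {φ : ℕ → ℕ} : φ.Injective → MeasurePreserving (reindex φ) ζ ζ
  dissociated {φ ψ : ℕ → ℕ} : φ.Injective → ψ.Injective → Disjoint (Set.range φ) (Set.range ψ) →
    IndepFun (reindex φ) (reindex ψ) ζ
  triangle : ∀ᵐ d ∂ζ, ∀ i j k, (d.1 i k : ℝ) ≤ d.1 i j + d.1 j k

theorem isSamplingLaw_iff {ζ : Measure DistMatrix} :
    IsSamplingLaw ζ ↔ (∀ φ : ℕ → ℕ, φ.Injective → MeasurePreserving (reindex φ) ζ ζ) ∧
      (∀ φ ψ : ℕ → ℕ, φ.Injective → ψ.Injective → Disjoint (Set.range φ) (Set.range ψ) →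
        IndepFun (reindex φ) (reindex ψ) ζ) ∧
      ∀ᵐ d ∂ζ, ∀ i j k, (d.1 i k : ℝ) ≤ d.1 i j + d.1 j k :=
  ⟨fun h => ⟨fun _ => h.exchangeable, fun _ _ => h.dissociated, h.triangle⟩,
    fun ⟨h₁, h₂, h₃⟩ => ⟨fun {φ} => h₁ φ, fun {φ ψ} => h₂ φ ψ, h₃⟩⟩

namespace QMMSpace

variable (X : QMMSpace)

theorem dStar_ofNe (x : ℕ → X.carrier) {i j : ℕ} (h : i ≠ j) :
    X.dStar (x (Upper.ofNe h).1.1, x (Upper.ofNe h).1.2) = X.dStar (x i, x j) := by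
  rcases lt_or_gt_of_ne h with hij | hij
  · rw [Upper.ofNe_of_lt hij]
  · rw [Upper.ofNe_comm h, Upper.ofNe_of_lt hij, X.dStar_comm]

theorem matrixLaw_map_upperEquiv (x : ℕ → X.carrier) :
    (X.matrixLaw x).map upperEquiv =
      Measure.infinitePi fun p : Upper => X.dStar (x p.1.1, x p.1.2) := by
  have h : upperEquiv ∘ symmMatrix = fun ω (p : Upper) => ω p.1 := by
    funext ω p
    simp [upperEquiv_apply, symmMatrix, p.2.ne, p.2.le]
  rw [matrixLaw, Measure.map_map upperEquiv.measurable measurable_symmMatrix, h]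
  exact Measure.map_infinitePi_infinitePi_of_inj
    (P := fun p : ℕ × ℕ => X.dStar (x p.1, x p.2)) Subtype.val_injective

theorem matrixLaw_eq_map_symm (x : ℕ → X.carrier) :
    X.matrixLaw x =
      (Measure.infinitePi fun p : Upper => X.dStar (x p.1.1, x p.1.2)).map upperEquiv.symm := by
  rw [← matrixLaw_map_upperEquiv, MeasurableEquiv.map_symm_map]

theorem measurable_matrixLaw_apply {S : Set DistMatrix} (hS : MeasurableSet S) :
    Measurable fun x => X.matrixLaw x S :=
  (Measure.measurable_coe hS).comp X.measurable_matrixLaw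

theorem sampling_apply {S : Set DistMatrix} (hS : MeasurableSet S) :
    (X.sampling : Measure DistMatrix) S =
      ∫⁻ x, X.matrixLaw x S ∂(Measure.infinitePi fun _ : ℕ => X.μ) :=
  Measure.bind_apply hS X.measurable_matrixLaw.aemeasurable

theorem ae_sampling {p : DistMatrix → Prop} (hp : MeasurableSet {d | p d})
    (h : ∀ᵐ x ∂(Measure.infinitePi fun _ : ℕ => X.μ), ∀ᵐ d ∂X.matrixLaw x, p d) :
    ∀ᵐ d ∂(X.sampling : Measure DistMatrix), p d := by
  change (X.sampling : Measure DistMatrix) {d | p d}ᶜ = 0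
  rwa [sampling_apply _ hp.compl, lintegral_eq_zero_iff (X.measurable_matrixLaw_apply hp.compl)]

section Reindex

variable {φ ψ : ℕ → ℕ}

theorem matrixLaw_map_reindex (hφ : φ.Injective) (x : ℕ → X.carrier) :
    (X.matrixLaw x).map (reindex φ) = X.matrixLaw fun i => x (φ i) := by
  have h : reindex φ ∘ upperEquiv.symm =
      upperEquiv.symm ∘ fun (ω : Upper → I) p => ω (Upper.map hφ p) :=
    funext (reindex_upperEquiv_symm hφ)
  rw [matrixLaw_eq_map_symm, matrixLaw_eq_map_symm, Measure.map_map (by fun_prop) (by fun_prop), h,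
    ← Measure.map_map (by fun_prop) (by fun_prop),
    Measure.map_infinitePi_infinitePi_of_inj (P := fun p : Upper => X.dStar (x p.1.1, x p.1.2))
      (Upper.map_injective hφ)]
  congr! 3 with p
  exact X.dStar_ofNe x _

theorem indepFun_reindex_matrixLaw (hφ : φ.Injective) (hψ : ψ.Injective)
    (h : Disjoint (Set.range φ) (Set.range ψ)) (x : ℕ → X.carrier) :
    IndepFun (reindex φ) (reindex ψ) (X.matrixLaw x) := by
  have hind : IndepFun (fun (ω : Upper → I) p => ω (Upper.map hφ p))
      (fun ω p => ω (Upper.map hψ p))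
      (Measure.infinitePi fun p : Upper => X.dStar (x p.1.1, x p.1.2)) :=
    indepFun_comp_of_disjoint_range (iIndepFun_infinitePi
      (P := fun p : Upper => X.dStar (x p.1.1, x p.1.2)) (X := fun _ ω => ω) fun _ => by fun_prop)
      (fun _ => by fun_prop) (Upper.disjoint_range_map hφ hψ h)
  have hcomp := hind.comp upperEquiv.symm.measurable upperEquiv.symm.measurable
  rw [matrixLaw_eq_map_symm]
  refine indepFun_map (by fun_prop) (by fun_prop) (by fun_prop) ?_
  convert! hcomp using 1
  all_goals ext1 ω
  · exact reindex_upperEquiv_symm hφ ω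
  · exact reindex_upperEquiv_symm hψ ω

theorem measurePreserving_reindex (hφ : φ.Injective) :
    MeasurePreserving (reindex φ) (X.sampling : Measure DistMatrix) X.sampling where
  measurable := measurable_reindex φ
  map_eq := by
    ext S hS
    have h : ∀ x, X.matrixLaw x (reindex φ ⁻¹' S) = X.matrixLaw (fun i => x (φ i)) S := fun x => by
      rw [← X.matrixLaw_map_reindex hφ, Measure.map_apply (measurable_reindex φ) hS]
    have hν := Measure.map_infinitePi_infinitePi_of_inj (P := fun _ : ℕ => X.μ) hφ
    rw [Measure.map_apply (measurable_reindex φ) hS, sampling_apply _ (measurable_reindex φ hS),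
      sampling_apply _ hS, lintegral_congr h]
    conv_rhs => rw [← hν]
    rw [lintegral_map (X.measurable_matrixLaw_apply hS) (by fun_prop)]

theorem indepFun_reindex_sampling (hφ : φ.Injective) (hψ : ψ.Injective)
    (hφψ : Disjoint (Set.range φ) (Set.range ψ)) :
    IndepFun (reindex φ) (reindex ψ) (X.sampling : Measure DistMatrix) := by
  refine (indepFun_iff_measure_inter_preimage_eq_mul).2 fun S T hS hT => ?_
  have hind : IndepFun (fun x => X.matrixLaw x (reindex φ ⁻¹' S))
      (fun x => X.matrixLaw x (reindex ψ ⁻¹' T)) (Measure.infinitePi fun _ : ℕ => X.μ) := by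
    have h := (indepFun_comp_of_disjoint_range (iIndepFun_infinitePi (P := fun _ : ℕ => X.μ)
      (X := fun _ ω => ω) fun _ => by fun_prop) (fun _ => by fun_prop) hφψ).comp
      (X.measurable_matrixLaw_apply hS) (X.measurable_matrixLaw_apply hT)
    convert! h using 1
    all_goals ext1 x
    · rw [← Measure.map_apply (measurable_reindex φ) hS, X.matrixLaw_map_reindex hφ]; rfl
    · rw [← Measure.map_apply (measurable_reindex ψ) hT, X.matrixLaw_map_reindex hψ]; rfl
  rw [sampling_apply _ ((measurable_reindex φ hS).inter (measurable_reindex ψ hT)),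
    sampling_apply _ (measurable_reindex φ hS), sampling_apply _ (measurable_reindex ψ hT),
    ← lintegral_mul_eq_lintegral_mul_lintegral_of_indepFun
      (X.measurable_matrixLaw_apply (measurable_reindex φ hS))
      (X.measurable_matrixLaw_apply (measurable_reindex ψ hT)) hind]
  exact lintegral_congr fun x =>
    (X.indepFun_reindex_matrixLaw hφ hψ hφψ x).measure_inter_preimage_eq_mul _ _ hS hT

end Reindex

theorem ae_matrixLaw_triangle {x : ℕ → X.carrier} {i j k : ℕ} (hij : i ≠ j) (hik : i ≠ k)
    (hjk : j ≠ k)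
    (hx : ∀ᵐ l ∂(X.dStar (x i, x j)).prod ((X.dStar (x j, x k)).prod (X.dStar (x i, x k))),
      (l.2.2 : ℝ) ≤ l.1 + l.2.1) :
    ∀ᵐ d ∂X.matrixLaw x, (d.1 i k : ℝ) ≤ d.1 i j + d.1 j k := by
  have hne : Upper.ofNe hij ≠ Upper.ofNe hjk ∧ Upper.ofNe hij ≠ Upper.ofNe hik ∧
      Upper.ofNe hjk ≠ Upper.ofNe hik := by
    simp only [ne_eq, Upper.ofNe_eq_ofNe_iff]
    omega
  rw [matrixLaw_eq_map_symm]
  rw [← X.dStar_ofNe x hij, ← X.dStar_ofNe x hjk, ← X.dStar_ofNe x hik,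
    ← infinitePi_map_eval_triple (fun p : Upper => X.dStar (x p.1.1, x p.1.2))
      hne.1 hne.2.1 hne.2.2] at hx
  rw [upperEquiv.symm.measurableEmbedding.ae_map_iff]
  filter_upwards [ae_of_ae_map (by fun_prop) hx] with ω hω
  rwa [upperEquiv_symm_apply ω hij, upperEquiv_symm_apply ω hik, upperEquiv_symm_apply ω hjk]

theorem ae_sampling_triangle :
    ∀ᵐ d ∂(X.sampling : Measure DistMatrix), ∀ i j k, (d.1 i k : ℝ) ≤ d.1 i j + d.1 j k := by
  refine ae_all_iff.2 fun i => ae_all_iff.2 fun j => ae_all_iff.2 fun k => ?_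
  rcases eq_or_ne i j with rfl | hij
  · exact ae_of_all _ fun d => by simp [d.2.2]
  rcases eq_or_ne j k with rfl | hjk
  · exact ae_of_all _ fun d => by simp [d.2.2]
  rcases eq_or_ne i k with rfl | hik
  · exact ae_of_all _ fun d => by simpa [d.2.2] using add_nonneg (d.1 i j).2.1 (d.1 j i).2.1
  have hmeas : MeasurableSet {d : DistMatrix | (d.1 i k : ℝ) ≤ d.1 i j + d.1 j k} :=
    measurableSet_le (measurable_entry i k).subtype_val
      ((measurable_entry i j).subtype_val.add (measurable_entry j k).subtype_val)
  refine X.ae_sampling hmeas ?_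
  have htri := X.triangle
  rw [← infinitePi_map_eval_triple (fun _ : ℕ => X.μ) hij hik hjk] at htri
  filter_upwards [ae_of_ae_map (by fun_prop) htri] with x hx
  exact X.ae_matrixLaw_triangle hij hik hjk (hx.mono fun l hl => hl.1)

theorem isSamplingLaw_sampling : IsSamplingLaw (X.sampling : Measure DistMatrix) where
  exchangeable := X.measurePreserving_reindex
  dissociated := X.indepFun_reindex_sampling
  triangle := X.ae_sampling_triangle

end QMMSpace

theorem lowerEnd_dirac (t : I) : lowerEnd (Measure.dirac t) = t := by
  have h : (Measure.dirac t).support = {t} := by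
    refine (Measure.support_subset_of_isClosed isClosed_singleton ?_).antisymm ?_
    · exact (mem_ae_dirac_iff (measurableSet_singleton t)).2 rfl
    · rintro _ rfl
      refine (Measure.mem_support_iff_forall _).2 fun U hU => ?_
      rw [Measure.dirac_apply_of_mem (mem_of_mem_nhds hU)]
      exact one_pos
  simp [lowerEnd, h]

theorem ae_lowerEnd_le (ν : Measure I) : ∀ᵐ t : I ∂ν, lowerEnd ν ≤ t := by
  filter_upwards [Measure.support_mem_ae (μ := ν)] with t ht
  exact csInf_le ⟨0, by rintro _ ⟨s, _, rfl⟩; exact s.2.1⟩ ⟨t, ht, rfl⟩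

theorem le_lowerEnd {ν : Measure I} (hν : ν ≠ 0) {r : ℝ} (h : ∀ᵐ t : I ∂ν, r ≤ t) :
    r ≤ lowerEnd ν := by
  have hclosed : IsClosed {t : I | r ≤ t} := isClosed_le continuous_const continuous_subtype_val
  obtain ⟨t, ht⟩ := Measure.nonempty_support hν
  refine le_csInf ⟨t, t, ht, rfl⟩ ?_
  rintro _ ⟨s, hs, rfl⟩
  exact Measure.support_subset_of_isClosed hclosed h hs

section LipschitzVersion

variable {α Y : Type*} [PseudoMetricSpace α] [MeasurableSpace α]
  {μ : Measure α} [μ.IsOpenPosMeasure] {f : α → Y}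

theorem lipschitzOnWith_of_ae_dist_le [PseudoMetricSpace Y] {A : Set α}
    (hA : ∀ x ∈ A, ∀ᵐ y ∂μ, dist (f x) (f y) ≤ dist x y) : LipschitzOnWith 1 f A := by
  refine LipschitzOnWith.of_dist_le_mul fun x hx x' hx' => ?_
  rw [NNReal.coe_one, one_mul]
  refine le_of_forall_pos_le_add fun ε hε => ?_
  have hpos : 0 < μ (Metric.ball x (ε / 2)) := Metric.measure_ball_pos μ x (by positivity)
  obtain ⟨y, hy, hxy, hxy'⟩ := ((frequently_ae_mem_iff.2 hpos.ne').and_eventually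
    ((hA x hx).and (hA x' hx'))).exists
  rw [Metric.mem_ball'] at hy
  calc dist (f x) (f x') ≤ dist (f x) (f y) + dist (f x') (f y) := dist_triangle_right _ _ _
    _ ≤ dist x y + dist x' y := add_le_add hxy hxy'
    _ ≤ dist x y + (dist x x' + dist x y) := by grw [dist_triangle_left x' y x]
    _ ≤ dist x x' + ε := by linarith

theorem exists_lipschitzWith_ae_eq [SFinite μ] [MetricSpace Y] [CompleteSpace Y]
    (h : ∀ᵐ p ∂(μ.prod μ), dist (f p.1) (f p.2) ≤ dist p.1 p.2) :
    ∃ g : α → Y, LipschitzWith 1 g ∧ f =ᵐ[μ] g := by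
  have hae := Measure.ae_ae_of_ae_prod h
  set A : Set α := {x | ∀ᵐ y ∂μ, dist (f x) (f y) ≤ dist x y}
  have hA : Dense A := Measure.dense_of_ae hae
  have hlip : LipschitzWith 1 (A.domRestrict f) :=
    lipschitzOnWith_iff_restrict.1 (lipschitzOnWith_of_ae_dist_le fun _ hx => hx)
  refine ⟨hA.extend (A.domRestrict f), hA.lipschitzWith_extend hlip, ?_⟩
  filter_upwards [hae] with x hx
  exact (hA.extend_eq hlip.continuous ⟨x, hx⟩).symm

end LipschitzVersion

namespace MMSpace

variable (X : MMSpace)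

instance : SecondCountableTopology X.carrier := UniformSpace.secondCountable_of_separable _

/-- The distance of an mm-space with values in the unit interval. -/
def unitDist (p : X.carrier × X.carrier) : I := ⟨dist p.1 p.2, dist_nonneg, X.dist_le_one _ _⟩

theorem measurable_unitDist : Measurable X.unitDist :=
  Measurable.subtype_mk (measurable_fst.dist measurable_snd)

/-- An mm-space regarded as a qmm-space whose random distances are deterministic. -/
abbrev toQMM : QMMSpace where
  carrier := X.carrier
  μ := X.μ
  dStar := Kernel.deterministic X.unitDist X.measurable_unitDist
  dStar_self x := by
    rw [Kernel.deterministic_apply]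
    congr 1
    exact Subtype.ext (dist_self x)
  dStar_comm x y := by
    rw [Kernel.deterministic_apply, Kernel.deterministic_apply]
    congr 1
    exact Subtype.ext (dist_comm x y)
  triangle := ae_of_all _ fun ⟨a, b, c⟩ => by
    have hclosed : IsClosed {l : I × I × I | (l.2.2 : ℝ) ≤ l.1 + l.2.1 ∧
        (l.1 : ℝ) ≤ l.2.1 + l.2.2 ∧ (l.2.1 : ℝ) ≤ l.1 + l.2.2} := by
      refine IsClosed.and ?_ (IsClosed.and ?_ ?_) <;> exact isClosed_le (by fun_prop) (by fun_prop)
    simp only [Kernel.deterministic_apply, Measure.dirac_prod_dirac]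
    rw [ae_dirac_iff hclosed.measurableSet]
    simp only [unitDist]
    exact ⟨dist_triangle a b c, by linarith [dist_triangle_right a b c],
      by linarith [dist_triangle_left b c a]⟩

theorem toQMM_dStar (p : X.carrier × X.carrier) :
    X.toQMM.dStar p = Measure.dirac (X.unitDist p) :=
  Kernel.deterministic_apply X.measurable_unitDist p

theorem toQMM_matrixLaw (x : ℕ → X.carrier) :
    X.toQMM.matrixLaw x = Measure.dirac (X.distMatrix x) := by
  have h : upperEquiv.symm (fun p => X.unitDist (x p.1.1, x p.1.2)) = X.distMatrix x :=
    upperEquiv.symm_apply_eq.2 rfl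
  rw [QMMSpace.matrixLaw_eq_map_symm, ← h, ← Measure.map_dirac' (by fun_prop),
    ← Measure.infinitePi_dirac]
  exact congrArg (fun P : Upper → Measure I => (Measure.infinitePi P).map upperEquiv.symm)
    (funext fun p => X.toQMM_dStar _)

theorem toQMM_sampling : X.toQMM.sampling = X.sampling := by
  refine Subtype.ext ?_
  change (Measure.infinitePi fun _ : ℕ => X.μ).bind X.toQMM.matrixLaw =
    (Measure.infinitePi fun _ : ℕ => X.μ).map X.distMatrix
  rw [funext X.toQMM_matrixLaw]
  exact Measure.bind_dirac_eq_map _ X.measurable_distMatrix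

theorem lowerEnd_toQMM_dStar (p : X.carrier × X.carrier) :
    lowerEnd (X.toQMM.dStar p) = dist p.1 p.2 := by
  rw [toQMM_dStar, lowerEnd_dirac, unitDist]

theorem toQMM_obsDiam (Y : Type*) [MetricSpace Y] [CompleteSpace Y] [MeasurableSpace Y]
    [BorelSpace Y] (κ : ℝ) : X.toQMM.obsDiam Y κ = X.obsDiam Y κ := by
  refine le_antisymm (iSup₂_le fun f hf => ?_) (iSup₂_le fun f hf => ?_)
  · obtain ⟨g, hg, hfg⟩ := exists_lipschitzWith_ae_eq
      (hf.2.mono fun p hp => hp.trans_eq (X.lowerEnd_toQMM_dStar p))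
    have hmap : X.toQMM.μ.map f = X.μ.map g := Measure.map_congr hfg
    exact hmap ▸ le_iSup₂_of_le g hg le_rfl
  · have hf' : f ∈ X.toQMM.Lip1 Y := ⟨hf.continuous.measurable, ae_of_all _ fun p => by
      simpa [X.lowerEnd_toQMM_dStar p] using hf.dist_le_mul p.1 p.2⟩
    exact le_iSup₂_of_le (f := fun f (_ : f ∈ X.toQMM.Lip1 Y) =>
      partialDiam (X.toQMM.μ.map f) κ) f hf' le_rfl

end MMSpace

theorem mem_closure_of_forall_finset {Ω : Type*} [MeasurableSpace Ω] [TopologicalSpace Ω]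
    [OpensMeasurableSpace Ω] {S : Set (ProbabilityMeasure Ω)} {ζ : ProbabilityMeasure Ω}
    (h : ∀ (F : Finset (Ω →ᵇ ℝ)) (ε : ℝ), 0 < ε →
      ∃ ζ' ∈ S, ∀ f ∈ F, |∫ ω, f ω ∂(ζ' : Measure Ω) - ∫ ω, f ω ∂(ζ : Measure Ω)| ≤ ε) :
    ζ ∈ closure S := by
  classical
  choose! z hzS hz using fun (F : Finset (Ω →ᵇ ℝ)) (m : ℕ) =>
    h F (1 / ((m : ℝ) + 1)) Nat.one_div_pos_of_nat
  refine mem_closure_of_tendsto (b := (atTop : Filter (Finset (Ω →ᵇ ℝ) × ℕ)))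
    (f := fun p => z p.1 p.2) ?_ (Eventually.of_forall fun p => hzS p.1 p.2)
  refine ProbabilityMeasure.tendsto_iff_forall_integral_tendsto.2 fun f => ?_
  have hsmall : Tendsto (fun p : Finset (Ω →ᵇ ℝ) × ℕ => 1 / ((p.2 : ℝ) + 1)) atTop (𝓝 0) := by
    rw [← prod_atTop_atTop_eq]
    exact tendsto_one_div_add_atTop_nhds_zero_nat.comp tendsto_snd
  refine tendsto_iff_dist_tendsto_zero.2 <|
    squeeze_zero' (Eventually.of_forall fun _ => dist_nonneg) ?_ hsmall
  filter_upwards [eventually_ge_atTop (({f} : Finset (Ω →ᵇ ℝ)), 0)] with p hp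
  exact hz p.1 p.2 f (hp.1 (Finset.mem_singleton_self f))

section Topology

instance : SecondCountableTopology DistMatrix :=
  TopologicalSpace.Subtype.secondCountableTopology _

instance : TopologicalSpace.MetrizableSpace DistMatrix :=
  Topology.IsEmbedding.subtypeVal.metrizableSpace

instance : HasOuterApproxClosed DistMatrix := by
  let := TopologicalSpace.pseudoMetrizableSpacePseudoMetric DistMatrix
  infer_instance

instance : CompactSpace DistMatrix := by
  refine isCompact_iff_compactSpace.1 (IsClosed.isCompact (IsClosed.and ?_ ?_))
  · simp only [Set.ofPred_forall]
    exact isClosed_iInter fun i => isClosed_iInter fun j =>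
      isClosed_eq (by fun_prop) (by fun_prop)
  · simp only [Set.ofPred_forall]
    exact isClosed_iInter fun i => isClosed_eq (by fun_prop) continuous_const

theorem DistMatrix.iInf_principal_le_uniformity :
    ⨅ k : ℕ, 𝓟 {p : DistMatrix × DistMatrix | ∀ i < k, ∀ j < k, p.1.1 i j = p.2.1 i j} ≤
      uniformity DistMatrix := by
  simp only [uniformity_subtype, Pi.uniformity, comap_iInf, comap_comap, le_iInf_iff]
  intro i j
  refine iInf_le_of_le (max i j + 1) ?_
  rw [← tendsto_iff_comap]
  refine (tendsto_principal.2 ?_).mono_right refl_le_uniformity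
  intro p hp
  simp [hp i (by simp) j (by simp)]

theorem DistMatrix.exists_block_abs_sub_lt {f : DistMatrix → ℝ} (hf : Continuous f) {ε : ℝ}
    (hε : 0 < ε) :
    ∃ k : ℕ, ∀ d e : DistMatrix, (∀ i < k, ∀ j < k, d.1 i j = e.1 i j) → |f d - f e| < ε := by
  have huc := CompactSpace.uniformContinuous_of_continuous hf
  have hmem := iInf_principal_le_uniformity (huc (Metric.dist_mem_uniformity hε))
  have hanti : Antitone fun k : ℕ => 𝓟
      {p : DistMatrix × DistMatrix | ∀ i < k, ∀ j < k, p.1.1 i j = p.2.1 i j} :=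
    fun k l hkl => principal_mono.2 fun p hp i hi j hj => hp i (hi.trans_le hkl) j (hj.trans_le hkl)
  obtain ⟨k, hk⟩ := (mem_iInf_of_directed hanti.directed_ge _).1 hmem
  exact ⟨k, fun d e hde => hk (show (d, e) ∈ _ from hde)⟩

end Topology

section Closed

theorem continuous_triangleDefect (i j k : ℕ) :
    Continuous fun d : DistMatrix => max ((d.1 i k : ℝ) - d.1 i j - d.1 j k) 0 := by
  have h (i j : ℕ) := continuous_subtype_val.comp (continuous_entry i j)
  exact (((h i k).sub (h i j)).sub (h j k)).max continuous_const

theorem integral_triangleDefect_eq_zero_iff {ζ : Measure DistMatrix} [IsFiniteMeasure ζ]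
    {i j k : ℕ} : ∫ d, max ((d.1 i k : ℝ) - d.1 i j - d.1 j k) 0 ∂ζ = 0 ↔
      ∀ᵐ d ∂ζ, (d.1 i k : ℝ) ≤ d.1 i j + d.1 j k := by
  rw [integral_eq_zero_iff_of_nonneg
    (f := fun d : DistMatrix => max ((d.1 i k : ℝ) - d.1 i j - d.1 j k) 0)
    (fun d => le_max_right _ _) ((continuous_triangleDefect i j k).integrable_of_hasCompactSupport
      (HasCompactSupport.of_compactSpace _))]
  refine eventually_congr (Eventually.of_forall fun d => ?_)
  rw [Pi.zero_apply, max_eq_right_iff]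
  constructor <;> intro h <;> linarith

theorem isClosed_setOf_map_reindex_eq (φ : ℕ → ℕ) :
    IsClosed {ζ : ProbabilityMeasure DistMatrix |
      MeasurePreserving (reindex φ) (ζ : Measure DistMatrix) ζ} := by
  convert! isClosed_eq (ProbabilityMeasure.continuous_map (continuous_reindex φ)) continuous_id
    using 3 with ζ
  exact ⟨fun h => Subtype.ext h.map_eq, fun h => ⟨measurable_reindex φ, congrArg Subtype.val h⟩⟩

theorem isClosed_setOf_indepFun_reindex (φ ψ : ℕ → ℕ) :
    IsClosed {ζ : ProbabilityMeasure DistMatrix |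
      IndepFun (reindex φ) (reindex ψ) (ζ : Measure DistMatrix)} := by
  have hmap (χ : ℕ → ℕ) := ProbabilityMeasure.continuous_map (continuous_reindex χ)
  convert! isClosed_eq
    (ProbabilityMeasure.continuous_map ((continuous_reindex φ).prodMk (continuous_reindex ψ)))
    (ProbabilityMeasure.continuous_prod.comp ((hmap φ).prodMk (hmap ψ))) using 3 with ζ
  rw [indepFun_iff_map_prod_eq_prod_map_map (by fun_prop) (by fun_prop)]
  exact ⟨fun h => Subtype.ext h, fun h => congrArg Subtype.val h⟩

theorem isClosed_setOf_ae_triangle (i j k : ℕ) :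
    IsClosed {ζ : ProbabilityMeasure DistMatrix |
      ∀ᵐ d ∂(ζ : Measure DistMatrix), (d.1 i k : ℝ) ≤ d.1 i j + d.1 j k} := by
  simp only [← integral_triangleDefect_eq_zero_iff]
  exact isClosed_eq (ProbabilityMeasure.continuous_integral_continuousMap
    (⟨_, continuous_triangleDefect i j k⟩ : C(DistMatrix, ℝ))) continuous_const

theorem isClosed_isSamplingLaw :
    IsClosed {ζ : ProbabilityMeasure DistMatrix | IsSamplingLaw (ζ : Measure DistMatrix)} := by
  simp only [isSamplingLaw_iff, ae_all_iff, Set.ofPred_and, Set.ofPred_forall]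
  refine IsClosed.inter ?_ (IsClosed.inter ?_ ?_)
  · exact isClosed_iInter fun φ => isClosed_iInter fun _ => isClosed_setOf_map_reindex_eq φ
  · exact isClosed_iInter fun φ => isClosed_iInter fun ψ => isClosed_iInter fun _ =>
      isClosed_iInter fun _ => isClosed_iInter fun _ => isClosed_setOf_indepFun_reindex φ ψ
  · exact isClosed_iInter fun i => isClosed_iInter fun j => isClosed_iInter fun k =>
      isClosed_setOf_ae_triangle i j k

end Closed

theorem isSamplingLaw_of_mem_chiBar {ζ : ProbabilityMeasure DistMatrix} (h : ζ ∈ ChiBar) :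
    IsSamplingLaw (ζ : Measure DistMatrix) := by
  refine isClosed_isSamplingLaw.closure_subset_iff.2 ?_ h
  rintro _ ⟨X, rfl⟩
  rw [← X.toQMM_sampling]
  exact X.toQMM.isSamplingLaw_sampling

/-! ### Sampling laws as limits of finite spaces -/

section PseudoMetric

variable {ι : Type} [PseudoMetricSpace ι] [CompleteSpace ι] [TopologicalSpace.SeparableSpace ι]
  [MeasurableSpace ι] [OpensMeasurableSpace ι] (hι : ∀ x y : ι, dist x y ≤ 1) (μ : Measure ι)
  [IsProbabilityMeasure μ] [μ.IsOpenPosMeasure]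

instance : MeasurableSpace (SeparationQuotient ι) := borel _

instance : BorelSpace (SeparationQuotient ι) := ⟨rfl⟩

/-- The mm-space of the points of a pseudometric measure space, where points at distance zero are
identified. -/
abbrev MMSpace.ofPseudoMetric : MMSpace where
  carrier := SeparationQuotient ι
  separableSpace := SeparationQuotient.surjective_mk.denseRange.separableSpace
    SeparationQuotient.continuous_mk
  dist_le_one := SeparationQuotient.surjective_mk.forall₂.2 hι
  μ := μ.map SeparationQuotient.mk
  isProbabilityMeasure :=
    Measure.isProbabilityMeasure_map SeparationQuotient.continuous_mk.measurable.aemeasurable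
  fullSupport := SeparationQuotient.continuous_mk.isOpenPosMeasure_map
    SeparationQuotient.surjective_mk

theorem MMSpace.sampling_ofPseudoMetric :
    ((ofPseudoMetric hι μ).sampling : Measure DistMatrix) =
      (Measure.infinitePi fun _ : ℕ => μ).map fun x =>
        (ofPseudoMetric hι μ).distMatrix fun i => SeparationQuotient.mk (x i) := by
  have hmk : Measurable (SeparationQuotient.mk : ι → _) :=
    SeparationQuotient.continuous_mk.measurable
  change (Measure.infinitePi fun _ : ℕ => μ.map SeparationQuotient.mk).map _ = _
  rw [← Measure.infinitePi_map_pi (fun _ : ℕ => μ) (f := fun _ => SeparationQuotient.mk)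
    fun _ => hmk, Measure.map_map (ofPseudoMetric hι μ).measurable_distMatrix (by fun_prop)]
  rfl

end PseudoMetric

section Subsampling

@[fun_prop] theorem measurable_reindex_uncurry :
    Measurable fun p : (ℕ → ℕ) × DistMatrix => reindex p.1 p.2 := by
  refine Measurable.subtype_mk (measurable_pi_lambda _ fun i => measurable_pi_lambda _ fun j => ?_)
  have h : Measurable fun q : (ℕ × ℕ) × DistMatrix => q.2.1 q.1.1 q.1.2 :=
    measurable_from_prod_countable_right fun a => measurable_entry a.1 a.2
  exact h.comp (f := fun p : (ℕ → ℕ) × DistMatrix => ((p.1 i, p.1 j), p.2)) (by fun_prop)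

@[fun_prop] theorem measurable_reindex_left (d : DistMatrix) : Measurable fun w => reindex w d :=
  measurable_reindex_uncurry.comp (measurable_id.prodMk measurable_const)

/-- The uniform probability measure on `{0, …, n}`. -/
def uniformIndex (n : ℕ) : Measure ℕ := (uniformOn (Set.univ : Set (Fin (n + 1)))).map Fin.val

instance (n : ℕ) : IsProbabilityMeasure (uniformOn (Set.univ : Set (Fin (n + 1)))) :=
  isProbabilityMeasure_uniformOn Set.finite_univ Set.univ_nonempty

instance (n : ℕ) : IsProbabilityMeasure (uniformIndex n) :=
  Measure.isProbabilityMeasure_map (measurable_of_countable _).aemeasurable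

theorem uniformOn_univ_fin_singleton (n : ℕ) (i : Fin (n + 1)) :
    uniformOn Set.univ {i} = ((n : ℝ≥0∞) + 1)⁻¹ := by
  rw [uniformOn_univ]
  simp

theorem uniformIndex_singleton_le (n m : ℕ) : uniformIndex n {m} ≤ ((n : ℝ≥0∞) + 1)⁻¹ := by
  rw [uniformIndex, Measure.map_apply (measurable_of_countable _) (measurableSet_singleton m)]
  rcases (Set.subsingleton_singleton (a := m)).preimage Fin.val_injective
    |>.eq_empty_or_singleton with h | ⟨i, h⟩
  · rw [h, measure_empty]
    exact zero_le
  · rw [h, uniformOn_univ_fin_singleton]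

/-- The law of an independent sample of uniform indices in `{0, …, n}`. -/
def uniformIndices (n : ℕ) : Measure (ℕ → ℕ) := Measure.infinitePi fun _ => uniformIndex n

instance (n : ℕ) : IsProbabilityMeasure (uniformIndices n) :=
  inferInstanceAs (IsProbabilityMeasure (Measure.infinitePi _))

/-- The set of indices `0, …, n`, on which `d` defines a pseudometric. -/
def IndexSpace (d : DistMatrix) (_ : ∀ i j k, (d.1 i k : ℝ) ≤ d.1 i j + d.1 j k) (n : ℕ) : Type :=
  Fin (n + 1)

theorem exists_mmSpace_of_triangle {d : DistMatrix}
    (hd : ∀ i j k, (d.1 i k : ℝ) ≤ d.1 i j + d.1 j k) (n : ℕ) :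
    ∃ X : MMSpace, (X.sampling : Measure DistMatrix) =
      (uniformIndices n).map fun w => reindex w d := by
  let : PseudoMetricSpace (IndexSpace d hd n) :=
    { dist i j := (d.1 (Fin.val i) (Fin.val j) : ℝ)
      dist_self i := by simp [d.2.2]
      dist_comm i j := by rw [d.2.1]
      dist_triangle i j k := hd _ _ _ }
  have : Finite (IndexSpace d hd n) := inferInstanceAs (Finite (Fin (n + 1)))
  let : MeasurableSpace (IndexSpace d hd n) := ⊤
  have : OpensMeasurableSpace (IndexSpace d hd n) := ⟨le_top⟩
  let μ : Measure (IndexSpace d hd n) := uniformOn (Set.univ : Set (Fin (n + 1)))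
  have : IsProbabilityMeasure μ :=
    inferInstanceAs (IsProbabilityMeasure (uniformOn (Set.univ : Set (Fin (n + 1)))))
  have : μ.IsOpenPosMeasure := ⟨fun U _ ⟨i, hi⟩ => ne_of_gt <| by
    refine lt_of_lt_of_le ?_ (measure_mono (Set.singleton_subset_iff.2 hi))
    exact (uniformOn_univ_fin_singleton n i).symm ▸ by simp⟩
  refine ⟨MMSpace.ofPseudoMetric (ι := IndexSpace d hd n) (fun i j => (d.1 _ _).2.2) μ, ?_⟩
  rw [MMSpace.sampling_ofPseudoMetric, uniformIndices]
  simp only [uniformIndex]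
  rw [← Measure.infinitePi_map_pi (fun _ : ℕ => uniformOn (Set.univ : Set (Fin (n + 1))))
    (f := fun _ => Fin.val) fun _ => measurable_of_countable _,
    Measure.map_map (by fun_prop) (by fun_prop)]
  rfl

end Subsampling

section Birthday

variable {α : Type*} [MeasurableSpace α] {P : Measure α} [IsProbabilityMeasure P] {c : ℝ≥0∞}

theorem infinitePi_setOf_eq_le [MeasurableEq α] (hP : ∀ a, P {a} ≤ c) {i j : ℕ} (hij : i ≠ j) :
    Measure.infinitePi (fun _ : ℕ => P) {w | w i = w j} ≤ c := by
  have hdiag : MeasurableSet {q : α × α | q.1 = q.2} :=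
    measurableSet_eq_fun measurable_fst measurable_snd
  have hmap := Measure.infinitePi_map_eval_prod (P := fun _ : ℕ => P) hij
  calc Measure.infinitePi (fun _ : ℕ => P) {w | w i = w j}
      = (P.prod P) {q | q.1 = q.2} := by
        rw [← hmap, Measure.map_apply (by fun_prop) hdiag]
        rfl
    _ = ∫⁻ a, P {b | a = b} ∂P := Measure.prod_apply hdiag
    _ ≤ ∫⁻ _, c ∂P := lintegral_mono fun a => (measure_mono fun b hb => Eq.symm hb).trans (hP a)
    _ = c := by simp

theorem infinitePi_setOf_not_injOn_le [MeasurableEq α] (hP : ∀ a, P {a} ≤ c) (k : ℕ) :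
    Measure.infinitePi (fun _ : ℕ => P) {w | ¬ Set.InjOn w (Set.Iio k)} ≤ k ^ 2 * c := by
  have hsub : {w : ℕ → α | ¬ Set.InjOn w (Set.Iio k)} ⊆
      ⋃ p ∈ (Finset.range k).offDiag, {w | w p.1 = w p.2} := fun w hw => by
    simp only [Set.InjOn, Set.mem_ofPred_eq, not_forall] at hw
    obtain ⟨i, hi, j, hj, hij, hne⟩ := hw
    simp only [Set.mem_iUnion]
    exact ⟨(i, j), Finset.mem_offDiag.2 ⟨Finset.mem_range.2 hi, Finset.mem_range.2 hj, hne⟩, hij⟩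
  calc Measure.infinitePi (fun _ : ℕ => P) {w | ¬ Set.InjOn w (Set.Iio k)}
      ≤ ∑ p ∈ (Finset.range k).offDiag, Measure.infinitePi (fun _ : ℕ => P) {w | w p.1 = w p.2} :=
        (measure_mono hsub).trans (measure_biUnion_finset_le _ _)
    _ ≤ ∑ _ ∈ (Finset.range k).offDiag, c :=
        Finset.sum_le_sum fun _ hp => infinitePi_setOf_eq_le hP (Finset.mem_offDiag.1 hp).2.2
    _ ≤ k ^ 2 * c := by
        rw [Finset.sum_const, nsmul_eq_mul, Finset.offDiag_card, Finset.card_range, sq]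
        gcongr
        exact_mod_cast Nat.sub_le _ _

theorem tendsto_uniformIndices_not_injOn (k : ℕ) :
    Tendsto (fun n => (uniformIndices n).real {w | ¬ Set.InjOn w (Set.Iio k)}) atTop (𝓝 0) := by
  have hlim : Tendsto (fun n : ℕ => (k : ℝ≥0∞) ^ 2 * ((n : ℝ≥0∞) + 1)⁻¹) atTop (𝓝 0) := by
    have h := ENNReal.Tendsto.const_mul (a := (k : ℝ≥0∞) ^ 2)
      ((tendsto_add_atTop_iff_nat 1).2 ENNReal.tendsto_inv_nat_nhds_zero) (.inr (by simp))
    simpa using h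
  have h := tendsto_of_tendsto_of_tendsto_of_le_of_le tendsto_const_nhds hlim
    (fun _ => zero_le) fun n => infinitePi_setOf_not_injOn_le (uniformIndex_singleton_le n) k
  exact (ENNReal.tendsto_toReal_zero_iff fun n => measure_ne_top _ _).2 h

end Birthday

theorem exists_injective_eqOn_Iio {w : ℕ → ℕ} {k : ℕ} (hw : Set.InjOn w (Set.Iio k)) :
    ∃ φ : ℕ → ℕ, φ.Injective ∧ Set.EqOn φ w (Set.Iio k) := by
  obtain ⟨b, hb⟩ := ((Set.finite_Iio k).image w).bddAbove
  have hwb (m : ℕ) (hm : m < k) : w m ≤ b := hb ⟨m, hm, rfl⟩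
  refine ⟨fun m => if m < k then w m else b + 1 + m, fun m m' h => ?_, fun m hm => if_pos hm⟩
  dsimp only at h
  split_ifs at h with hm hm' hm'
  · exact hw hm hm' h
  · linarith [hwb m hm]
  · linarith [hwb m' hm']
  · linarith

section Subsampling

/-- The average of `f` over the matrices of independent uniform samples, with replacement, of the
indices `0, …, n` of `d`. -/
def subsampleMean (n : ℕ) (f : DistMatrix → ℝ) (d : DistMatrix) : ℝ :=
  ∫ w, f (reindex w d) ∂uniformIndices n

variable {ζ : Measure DistMatrix} [IsProbabilityMeasure ζ] {f : DistMatrix → ℝ}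

theorem integrable_of_continuous (hf : Continuous f) : Integrable f ζ :=
  hf.integrable_of_hasCompactSupport (HasCompactSupport.of_compactSpace _)

theorem integral_comp_of_measurePreserving {α β : Type*} [MeasurableSpace α] [MeasurableSpace β]
    {μ : Measure α} {ν : Measure β} {T : α → β} (hT : MeasurePreserving T μ ν) {g : β → ℝ}
    (hg : AEStronglyMeasurable g ν) : ∫ a, g (T a) ∂μ = ∫ b, g b ∂ν := by
  rw [← hT.map_eq] at hg ⊢
  exact (integral_map hT.measurable.aemeasurable hg).symm

theorem disjoint_range_two_mul :
    Disjoint (Set.range fun i : ℕ => 2 * i) (Set.range fun i : ℕ => 2 * i + 1) :=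
  Set.disjoint_range_iff.2 fun i j => by omega

theorem injective_two_mul_add (c : ℕ) : Function.Injective fun i : ℕ => 2 * i + c :=
  fun i j h => by simpa using h

theorem abs_integral_reindex_sub_le
    (hζ : ∀ φ : ℕ → ℕ, φ.Injective → MeasurePreserving (reindex φ) ζ ζ) (hf : Continuous f)
    {ε : ℝ} {k : ℕ}
    (hk : ∀ d e : DistMatrix, (∀ i < k, ∀ j < k, d.1 i j = e.1 i j) → |f d - f e| < ε)
    {w : ℕ → ℕ} (hw : Set.InjOn w (Set.Iio k)) :
    |∫ d, f (reindex w d) ∂ζ - ∫ d, f d ∂ζ| ≤ ε := by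
  obtain ⟨φ, hφ, hφw⟩ := exists_injective_eqOn_Iio hw
  have hint (ψ : ℕ → ℕ) : Integrable (fun d => f (reindex ψ d)) ζ :=
    integrable_of_continuous (hf.comp (continuous_reindex ψ))
  rw [← integral_comp_of_measurePreserving (hζ φ hφ) hf.aestronglyMeasurable,
    ← integral_sub (hint w) (hint φ), ← Real.norm_eq_abs]
  have h := norm_integral_le_of_norm_le_const (μ := ζ) (C := ε)
    (f := fun d => f (reindex w d) - f (reindex φ d)) (ae_of_all _ fun d => (hk _ _
      fun i hi j hj => by rw [reindex_apply, reindex_apply, hφw hi, hφw hj]).le)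
  simpa using h

theorem integrable_reindex_prod (P : Measure (ℕ → ℕ)) [IsProbabilityMeasure P]
    (hf : Continuous f) :
    Integrable (fun p : (ℕ → ℕ) × DistMatrix => f (reindex p.1 p.2)) (P.prod ζ) := by
  obtain ⟨C, hC⟩ := isCompact_univ.exists_bound_of_continuousOn hf.continuousOn
  exact Integrable.of_bound (hf.measurable.comp measurable_reindex_uncurry).aestronglyMeasurable C
    (ae_of_all _ fun p => hC _ (Set.mem_univ _))

theorem measurableSet_setOf_injOn_Iio (k : ℕ) :
    MeasurableSet {w : ℕ → ℕ | Set.InjOn w (Set.Iio k)} := by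
  simp only [Set.InjOn, Set.ofPred_forall]
  exact .iInter fun i => .iInter fun _ => .iInter fun j => .iInter fun _ =>
    (measurableSet_eq_fun (by fun_prop) (by fun_prop)).imp (.const _)

theorem abs_integral_le_add_mul_measureReal {Ω : Type*} [MeasurableSpace Ω] {P : Measure Ω}
    [IsProbabilityMeasure P] {g : Ω → ℝ} {B : Set Ω} (hB : MeasurableSet B) {ε M : ℝ}
    (hε : 0 ≤ ε) (hM : ∀ ω, |g ω| ≤ M) (hg : ∀ ω ∉ B, |g ω| ≤ ε) :
    |∫ ω, g ω ∂P| ≤ ε + M * P.real B := by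
  have hint : Integrable (B.indicator fun _ => M) P := (integrable_const _).indicator hB
  have hle (ω : Ω) : ‖g ω‖ ≤ ε + B.indicator (fun _ => M) ω := by
    by_cases hω : ω ∈ B
    · simpa [hω] using (hM ω).trans (le_add_of_nonneg_left hε)
    · simpa [hω] using hg ω hω
  calc |∫ ω, g ω ∂P| ≤ ∫ ω, (ε + B.indicator (fun _ => M) ω) ∂P :=
        norm_integral_le_of_norm_le ((integrable_const _).add hint) (ae_of_all _ hle)
    _ = ε + M * P.real B := by
        rw [integral_add (integrable_const _) hint, integral_indicator_const _ hB]
        simp [mul_comm]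

theorem tendsto_integral_subsampleMean
    (hζ : ∀ φ : ℕ → ℕ, φ.Injective → MeasurePreserving (reindex φ) ζ ζ) (hf : Continuous f) :
    Tendsto (fun n => ∫ d, subsampleMean n f d ∂ζ) atTop (𝓝 (∫ d, f d ∂ζ)) := by
  obtain ⟨C, hC⟩ := isCompact_univ.exists_bound_of_continuousOn hf.continuousOn
  have hC' (w : ℕ → ℕ) : |∫ d, f (reindex w d) ∂ζ - ∫ d, f d ∂ζ| ≤ C + C := by
    have h (T : DistMatrix → DistMatrix) : ‖∫ d, f (T d) ∂ζ‖ ≤ C := by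
      simpa using norm_integral_le_of_norm_le_const (μ := ζ)
        (ae_of_all _ fun d => hC (T d) (Set.mem_univ _))
    exact (norm_sub_le _ _).trans (add_le_add (h _) (h id))
  have hswap (n : ℕ) : ∫ d, subsampleMean n f d ∂ζ - ∫ d, f d ∂ζ =
      ∫ w, (∫ d, f (reindex w d) ∂ζ - ∫ d, f d ∂ζ) ∂uniformIndices n := by
    have hint := integrable_reindex_prod (ζ := ζ) (uniformIndices n) hf
    rw [integral_sub hint.integral_prod_left (integrable_const _), integral_const, probReal_univ,
      one_smul]
    exact congrArg (· - _) (integral_integral_swap hint).symm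
  refine tendsto_iff_norm_sub_tendsto_zero.2 <|
    tendsto_order.2 ⟨fun a ha => Eventually.of_forall fun n => ha.trans_le (norm_nonneg _),
      fun ε hε => ?_⟩
  obtain ⟨k, hk⟩ := exists_block_abs_sub_lt hf (half_pos hε)
  have hlim : Tendsto (fun n => ε / 2 +
      (C + C) * (uniformIndices n).real {w | ¬ Set.InjOn w (Set.Iio k)}) atTop (𝓝 (ε / 2)) := by
    simpa using ((tendsto_uniformIndices_not_injOn k).const_mul (C + C)).const_add (ε / 2)
  filter_upwards [hlim.eventually_lt_const (half_lt_self hε)] with n hn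
  rw [hswap]
  refine (abs_integral_le_add_mul_measureReal (measurableSet_setOf_injOn_Iio k).compl
    (half_pos hε).le hC' fun w hw => ?_).trans_lt hn
  exact abs_integral_reindex_sub_le hζ hf hk (not_not.1 hw)

theorem integrable_subsampleMean (n : ℕ) (hf : Continuous f) :
    Integrable (subsampleMean n f) ζ :=
  (integrable_reindex_prod (uniformIndices n) hf).integral_prod_right

theorem subsampleMean_mul (n : ℕ) (hf : Continuous f) (d : DistMatrix) :
    subsampleMean n (fun e => f (reindex (2 * ·) e) * f (reindex (2 * · + 1) e)) d =
      subsampleMean n f d ^ 2 := by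
  have hsec : Measurable fun w : ℕ → ℕ => f (reindex w d) :=
    hf.measurable.comp (measurable_reindex_left d)
  have hind := (indepFun_comp_of_disjoint_range (iIndepFun_infinitePi
    (P := fun _ : ℕ => uniformIndex n) (X := fun _ w => w) fun _ => by fun_prop)
    (fun _ => by fun_prop) disjoint_range_two_mul).comp hsec hsec
  have hlaw {φ : ℕ → ℕ} (hφ : φ.Injective) :
      ∫ w, f (reindex (fun i => w (φ i)) d) ∂uniformIndices n = subsampleMean n f d :=
    integral_comp_of_measurePreserving (T := fun (w : ℕ → ℕ) i => w (φ i)) ⟨by fun_prop,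
      Measure.map_infinitePi_infinitePi_of_inj (P := fun _ : ℕ => uniformIndex n) hφ⟩
      hsec.aestronglyMeasurable
  rw [sq]
  nth_rw 1 [← hlaw (injective_two_mul_add 0)]
  rw [← hlaw (injective_two_mul_add 1)]
  exact hind.integral_mul_eq_mul_integral
    (hsec.comp (by fun_prop)).aestronglyMeasurable (hsec.comp (by fun_prop)).aestronglyMeasurable

theorem integrable_subsampleMean_sq (n : ℕ) (hf : Continuous f) :
    Integrable (fun d => subsampleMean n f d ^ 2) ζ :=
  (integrable_subsampleMean n (f := fun d => f (reindex (2 * ·) d) * f (reindex (2 * · + 1) d))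
    (by fun_prop)).congr (ae_of_all _ (subsampleMean_mul n hf))

theorem integrable_subsampleMean_sub_sq (n : ℕ) (hf : Continuous f) (c : ℝ) :
    Integrable (fun d => (subsampleMean n f d - c) ^ 2) ζ := by
  have hmean := integrable_subsampleMean (ζ := ζ) n hf
  refine (((integrable_subsampleMean_sq n hf).sub (hmean.const_mul (2 * c))).add
    (integrable_const (c ^ 2))).congr (ae_of_all _ fun d => ?_)
  simp only [Pi.add_apply, Pi.sub_apply]
  ring

theorem integral_subsampleMean_sub_sq (n : ℕ) (hf : Continuous f) (c : ℝ) :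
    ∫ d, (subsampleMean n f d - c) ^ 2 ∂ζ =
      ∫ d, subsampleMean n f d ^ 2 ∂ζ - 2 * c * ∫ d, subsampleMean n f d ∂ζ + c ^ 2 := by
  have hmean := (integrable_subsampleMean (ζ := ζ) n hf).const_mul (2 * c)
  have hsq := integrable_subsampleMean_sq (ζ := ζ) n hf
  calc ∫ d, (subsampleMean n f d - c) ^ 2 ∂ζ
      = ∫ d, (subsampleMean n f d ^ 2 - 2 * c * subsampleMean n f d + c ^ 2) ∂ζ :=
        integral_congr_ae (ae_of_all _ fun d => by ring)
    _ = _ := by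
        rw [integral_add (by exact hsq.sub hmean) (integrable_const _), integral_sub hsq hmean,
          integral_const_mul, integral_const, probReal_univ, one_smul]

theorem tendsto_integral_subsampleMean_sub_sq (hζ : IsSamplingLaw ζ) (hf : Continuous f) :
    Tendsto (fun n => ∫ d, (subsampleMean n f d - ∫ e, f e ∂ζ) ^ 2 ∂ζ) atTop (𝓝 0) := by
  have hprod : ∫ d, f (reindex (2 * ·) d) * f (reindex (2 * · + 1) d) ∂ζ = (∫ d, f d ∂ζ) ^ 2 := by
    have hind := (hζ.dissociated (injective_two_mul_add 0) (injective_two_mul_add 1)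
      disjoint_range_two_mul).comp hf.measurable hf.measurable
    have hinv {φ : ℕ → ℕ} (hφ : φ.Injective) : ∫ d, f (reindex φ d) ∂ζ = ∫ d, f d ∂ζ :=
      integral_comp_of_measurePreserving (hζ.exchangeable hφ) hf.aestronglyMeasurable
    rw [sq]
    nth_rw 1 [← hinv (injective_two_mul_add 0)]
    rw [← hinv (injective_two_mul_add 1)]
    exact hind.integral_mul_eq_mul_integral (by fun_prop) (by fun_prop)
  have hfirst := tendsto_integral_subsampleMean (fun _ => hζ.exchangeable) hf
  have hsecond := tendsto_integral_subsampleMean (fun _ => hζ.exchangeable)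
    (f := fun d => f (reindex (2 * ·) d) * f (reindex (2 * · + 1) d)) (by fun_prop)
  simp only [subsampleMean_mul _ hf, hprod] at hsecond
  have hlim := (hsecond.sub (hfirst.const_mul (2 * ∫ e, f e ∂ζ))).add_const ((∫ e, f e ∂ζ) ^ 2)
  simp only [integral_subsampleMean_sub_sq _ hf]
  rwa [show ∀ m : ℝ, m ^ 2 - 2 * m * m + m ^ 2 = 0 by intro m; ring] at hlim

end Subsampling

theorem mem_chiBar_of_isSamplingLaw {ζ : ProbabilityMeasure DistMatrix}
    (hζ : IsSamplingLaw (ζ : Measure DistMatrix)) : ζ ∈ ChiBar := by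
  refine mem_closure_of_forall_finset fun F ε hε => ?_
  have hlim : Tendsto (fun n => ∑ f ∈ F, ∫ d, (subsampleMean n f d - ∫ e, f e ∂(ζ : Measure _)) ^ 2
      ∂(ζ : Measure _)) atTop (𝓝 0) := by
    simpa using tendsto_finsetSum F fun f _ =>
      tendsto_integral_subsampleMean_sub_sq hζ f.continuous
  obtain ⟨n, hn⟩ := (hlim.eventually_lt_const (show 0 < ε ^ 2 by positivity)).exists
  rw [← integral_finsetSum _ fun f _ => integrable_subsampleMean_sub_sq n f.continuous _] at hn
  obtain ⟨d, hd, hdn⟩ := exists_notMem_null_le_integral (μ := (ζ : Measure DistMatrix))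
    (integrable_finsetSum F fun f _ => integrable_subsampleMean_sub_sq n f.continuous _)
    hζ.triangle
  obtain ⟨X, hX⟩ := exists_mmSpace_of_triangle (not_not.1 hd) n
  refine ⟨X.sampling, ⟨X, rfl⟩, fun f hf => abs_le_of_sq_le_sq ?_ hε.le⟩
  have hmean : ∫ e, f e ∂(X.sampling : Measure DistMatrix) = subsampleMean n f d := by
    rw [hX, integral_map (measurable_reindex_left d).aemeasurable
      f.continuous.aestronglyMeasurable, subsampleMean]
  rw [hmean]
  calc (subsampleMean n f d - ∫ e, f e ∂(ζ : Measure _)) ^ 2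
      ≤ ∑ f ∈ F, (subsampleMean n f d - ∫ e, f e ∂(ζ : Measure _)) ^ 2 :=
        Finset.single_le_sum (f := fun f : DistMatrix →ᵇ ℝ =>
          (subsampleMean n f d - ∫ e, f e ∂(ζ : Measure _)) ^ 2) (fun _ _ => sq_nonneg _) hf
    _ ≤ ε ^ 2 := hdn.trans hn.le

/-! ### Conditional probabilities -/

section CondProb

variable {Ω A B E ι : Type*} [MeasurableSpace Ω] [MeasurableSpace A] [MeasurableSpace B]
  [MeasurableSpace E] {P : Measure Ω} {S : Set Ω} {v : Ω → A} {h : A → ℝ≥0∞}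

theorem map_withDensity_comp {Q : Measure B} {f : B → A} (hf : Measurable f) (hh : Measurable h) :
    (Q.withDensity (h ∘ f)).map f = (Q.map f).withDensity h := by
  ext s hs
  rw [Measure.map_apply hf hs, withDensity_apply _ (hf hs), withDensity_apply _ hs,
    setLIntegral_map hs hh hf]
  rfl

/-- `h ∘ v` is a version of the conditional probability of the event `S` given `v`. The density
form makes sense for an arbitrary `v`, without passing to the `σ`-algebra it generates. -/
def IsCondProb (P : Measure Ω) (S : Set Ω) (v : Ω → A) (h : A → ℝ≥0∞) : Prop :=
  (P.restrict S).map v = (P.map v).withDensity h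

theorem IsCondProb.congr_ae {h' : A → ℝ≥0∞} (H : IsCondProb P S v h) (hh : h =ᵐ[P.map v] h') :
    IsCondProb P S v h' :=
  H.trans (withDensity_congr_ae hh)

theorem IsCondProb.comp_right {W : Ω → B} {f : B → A} (hW : Measurable W) (hf : Measurable f)
    (hh : Measurable h) (H : IsCondProb P S W (h ∘ f)) : IsCondProb P S (f ∘ W) h := by
  rw [IsCondProb, ← Measure.map_map hf hW, H, map_withDensity_comp hf hh, Measure.map_map hf hW]

theorem IsCondProb.ae_eq [IsFiniteMeasure P] {h' : A → ℝ≥0∞} (hh : Measurable h)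
    (hh' : Measurable h') (H : IsCondProb P S v h) (H' : IsCondProb P S v h') :
    h =ᵐ[P.map v] h' :=
  (withDensity_eq_iff_of_sigmaFinite hh.aemeasurable hh'.aemeasurable).1 (H.symm.trans H')

theorem IsCondProb.comp_measurePreserving (hS : MeasurableSet S) (hv : Measurable v) {T : Ω → Ω}
    (hT : MeasurePreserving T P P) (H : IsCondProb P S v h) :
    IsCondProb P (T ⁻¹' S) (v ∘ T) h := by
  rw [IsCondProb, ← Measure.map_map hv hT.measurable, ← Measure.map_map hv hT.measurable,
    (hT.restrict_preimage hS).map_eq, hT.map_eq, H]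

theorem IsCondProb.average {h' : A → ℝ≥0∞} (hh : Measurable h) (H : IsCondProb P S v h)
    (H' : IsCondProb P S v h') : IsCondProb P S v ((2⁻¹ : ℝ≥0∞) • (h + h')) := by
  rw [IsCondProb, withDensity_smul' _ _ (by simp), withDensity_add_left hh, ← H, ← H',
    ← two_smul ℝ≥0∞, smul_smul, ENNReal.inv_mul_cancel two_ne_zero ENNReal.ofNat_ne_top, one_smul]

theorem IsCondProb.inter {W : Ω → B} {f : B → A} {S' : Set B} {h' : A → ℝ≥0∞} (hW : Measurable W)
    (hf : Measurable f) (hS' : MeasurableSet S') (hh : Measurable h) (hh' : Measurable h')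
    (H : IsCondProb P S W (h ∘ f)) (H' : IsCondProb P (W ⁻¹' S') (f ∘ W) h') :
    IsCondProb P (S ∩ W ⁻¹' S') (f ∘ W) (h' * h) :=
  calc (P.restrict (S ∩ W ⁻¹' S')).map (f ∘ W)
    _ = (((P.restrict S).map W).restrict S').map f := by
      rw [Measure.restrict_map hW hS', Measure.restrict_restrict (hW hS'), Set.inter_comm,
        Measure.map_map hf hW]
    _ = ((P.restrict (W ⁻¹' S')).map (f ∘ W)).withDensity h := by
      rw [H, restrict_withDensity hS', map_withDensity_comp hf hh, Measure.restrict_map hW hS',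
        Measure.map_map hf hW]
    _ = (P.map (f ∘ W)).withDensity (h' * h) := by
      rw [H', withDensity_mul _ hh' hh]

/-- The Radon–Nikodym derivative `G` of `S` given `W` is invariant under the map `u ∘ f` induced
by `T` on the values of `W`, hence it is a function of `f`. -/
theorem IsCondProb.of_measurePreserving [IsFiniteMeasure P] (hS : MeasurableSet S) {W : Ω → B}
    {f : B → A} {u : A → B} {T : Ω → Ω} (hW : Measurable W) (hf : Measurable f) (hu : Measurable u)
    (hh : Measurable h) (hT : MeasurePreserving T P P) (hTS : T ⁻¹' S = S)
    (hTW : W ∘ T = u ∘ f ∘ W) (H : IsCondProb P S (f ∘ W) h) : IsCondProb P S W (h ∘ f) := by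
  set G := ((P.restrict S).map W).rnDeriv (P.map W)
  have hG : Measurable G := Measure.measurable_rnDeriv _ _
  have hGW : IsCondProb P S W G :=
    (Measure.withDensity_rnDeriv_eq _ _ <|
      (Measure.map_mono Measure.restrict_le_self hW).absolutelyContinuous).symm
  have hinv {Q : Measure Ω} (hQ : MeasurePreserving T Q Q) :
      MeasurePreserving (u ∘ f) (Q.map W) (Q.map W) := by
    refine ⟨hu.comp hf, ?_⟩
    rw [Measure.map_map (hu.comp hf) hW, Function.comp_assoc, ← hTW,
      ← Measure.map_map hW hQ.measurable, hQ.map_eq]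
  have hTS' : MeasurePreserving T (P.restrict S) (P.restrict S) := by
    simpa only [hTS] using hT.restrict_preimage hS
  have hGf : G =ᵐ[P.map W] (G ∘ u) ∘ f := ((hinv hTS').rnDeriv_comp_aeEq (hinv hT)).symm
  have hhG : h =ᵐ[P.map (f ∘ W)] G ∘ u :=
    H.ae_eq hh (hG.comp hu) ((hGW.congr_ae hGf).comp_right hW hf (hG.comp hu))
  rw [← Measure.map_map hf hW] at hhG
  exact hGW.congr_ae (hGf.trans (ae_eq_comp hf.aemeasurable hhG).symm)

theorem isCondProb_condDistrib [IsFiniteMeasure P] [StandardBorelSpace E] [Nonempty E] {e : Ω → E}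
    (he : Measurable e) (hv : Measurable v) {s : Set E} (hs : MeasurableSet s) :
    IsCondProb P (e ⁻¹' s) v (fun a => condDistrib e v P a s) := by
  ext t ht
  rw [Measure.map_apply hv ht, Measure.restrict_apply (hv ht), withDensity_apply _ ht,
    Measure.restrict_map hv ht, lintegral_map ((condDistrib e v P).measurable_coe hs) hv,
    setLIntegral_preimage_condDistrib hv he.aemeasurable hs ht]

theorem isCondProb_preimage_iff {z : Ω → E} (hv : Measurable v) (hz : Measurable z)
    {κ : Kernel A E} {s : Set E} (hs : MeasurableSet s) :
    IsCondProb P (z ⁻¹' s) v (fun a => κ a s) ↔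
      ∀ B, MeasurableSet B → P.map (fun ω => (v ω, z ω)) (B ×ˢ s) = ∫⁻ a in B, κ a s ∂P.map v := by
  refine Measure.ext_iff.trans (forall₂_congr fun B hB => ?_)
  rw [Measure.map_apply hv hB, Measure.restrict_apply (hv hB), withDensity_apply _ hB,
    Measure.map_apply (hv.prodMk hz) (hB.prod hs), Set.mk_preimage_prod]

theorem isCondProb_of_hasCondDistrib [SFinite P] {z : Ω → E} (hv : Measurable v)
    (hz : Measurable z) {κ : Kernel A E} [IsSFiniteKernel κ] (H : HasCondDistrib z v κ P)
    {s : Set E} (hs : MeasurableSet s) : IsCondProb P (z ⁻¹' s) v (fun a => κ a s) :=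
  (isCondProb_preimage_iff hv hz hs).2 fun B hB => by
    rw [H.map_eq, Measure.compProd_apply_prod hB hs]

theorem hasCondDistrib_of_isCondProb [IsFiniteMeasure P] {z : Ω → E} (hv : Measurable v)
    (hz : Measurable z) {κ : Kernel A E} [IsMarkovKernel κ] {C : Set (Set E)}
    (hCgen : ‹MeasurableSpace E› = .generateFrom C) (hC : IsPiSystem C)
    (H : ∀ s ∈ C, IsCondProb P (z ⁻¹' s) v (fun a => κ a s)) : HasCondDistrib z v κ P := by
  refine ⟨by fun_prop, Measure.ext_prod fun {B s} hB hs => ?_⟩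
  have hCm : ∀ s ∈ C, MeasurableSet s := fun s hs => hCgen ▸ .basic s hs
  suffices h : (P.restrict (v ⁻¹' B)).map z = ((P.map v).restrict B).bind κ by
    have := congrArg (· s) h
    rw [Measure.compProd_apply_prod hB hs, ← Measure.bind_apply hs κ.aemeasurable, ← h,
      Measure.map_apply hz hs, Measure.restrict_apply (hz hs),
      Measure.map_apply (hv.prodMk hz) (hB.prod hs), Set.mk_preimage_prod, Set.inter_comm]
  refine ext_of_generate_finite C hCgen hC (fun s hs => ?_) ?_
  · rw [Measure.bind_apply (hCm s hs) κ.aemeasurable,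
      ← (isCondProb_preimage_iff hv hz (hCm s hs)).1 (H s hs) B hB, Measure.map_apply hz (hCm s hs),
      Measure.restrict_apply (hz (hCm s hs)), Measure.map_apply (hv.prodMk hz) (hB.prod (hCm s hs)),
      Set.mk_preimage_prod, Set.inter_comm]
  · rw [Measure.bind_apply .univ κ.aemeasurable, Measure.map_apply hz .univ]
    simp [Measure.map_apply hv hB]

theorem hasCondDistrib_pi_of_isCondProb_box [IsFiniteMeasure P] {z : Ω → ι → E} (hv : Measurable v)
    (hz : Measurable z) {κ : Kernel A (ι → E)} [IsMarkovKernel κ]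
    (H : ∀ (J : Finset ι) (t : ι → Set E), (∀ i, MeasurableSet (t i)) →
      IsCondProb P (z ⁻¹' (J : Set ι).pi t) v (fun a => κ a ((J : Set ι).pi t))) :
    HasCondDistrib z v κ P := by
  refine hasCondDistrib_of_isCondProb hv hz (generateFrom_squareCylinders (α := fun _ => E)).symm
    (isPiSystem_squareCylinders (fun _ => MeasurableSpace.isPiSystem_measurableSet)
      fun _ => .univ) ?_
  rintro _ ⟨J, t, ht, rfl⟩
  exact H J t fun i => ht i (Set.mem_univ i)

theorem hasCondDistrib_prodMk [IsFiniteMeasure P] {F : Type*} [MeasurableSpace F] {y : Ω → E}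
    {z : Ω → F} {κ : Kernel A E} [IsMarkovKernel κ] {η : Kernel (A × E) F} [IsMarkovKernel η]
    (hy : HasCondDistrib y v κ P) (hz : HasCondDistrib z (fun ω => (v ω, y ω)) η P) :
    HasCondDistrib (fun ω => (y ω, z ω)) v (κ ⊗ₖ η) P := by
  have hvyz : AEMeasurable (fun ω => ((v ω, y ω), z ω)) P := hz.aemeasurable
  refine ⟨by fun_prop, ?_⟩
  rw [← Measure.compProd_assoc', ← hy.map_eq, ← hz.map_eq,
    AEMeasurable.map_map_of_aemeasurable (by fun_prop) hvyz]
  rfl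

end CondProb

section InfinitePiKernel

variable {Ω A E ι : Type*} [MeasurableSpace Ω] [MeasurableSpace A] [MeasurableSpace E]
  {κ : ι → Kernel A E} {P : Measure Ω} {v : Ω → A} {z : Ω → ι → E}

theorem isCondProb_box_of_erase (hv : Measurable v) (hz : Measurable z)
    (H : ∀ i s, MeasurableSet s → IsCondProb P {ω | z ω i ∈ s}
      (fun ω => (v ω, fun j : {j // j ≠ i} => z ω j)) (fun w => κ i w.1 s))
    {t : ι → Set E} (ht : ∀ i, MeasurableSet (t i)) (J : Finset ι) :
    IsCondProb P (z ⁻¹' (J : Set ι).pi t) v (fun a => ∏ i ∈ J, κ i a (t i)) := by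
  classical
  induction J using Finset.induction_on with
  | empty => simp [IsCondProb, ← Pi.one_def]
  | insert i J hi ih =>
    let J' : Set {j // j ≠ i} := Subtype.val ⁻¹' (J : Set ι)
    let t' (j : {j // j ≠ i}) := t j
    have hJi : z ⁻¹' (J : Set ι).pi t =
        (fun ω => (v ω, fun j : {j // j ≠ i} => z ω j)) ⁻¹' (Set.univ ×ˢ J'.pi t') := by
      ext ω
      simp only [J', t', Set.mem_preimage, Set.mem_pi, Set.mem_prod, Set.mem_univ, true_and,
        Subtype.forall, Finset.mem_coe]
      exact ⟨fun h j _ hj => h j hj, fun h j hj => h j (fun e => hi (e ▸ hj)) hj⟩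
    have hm : MeasurableSet (Set.univ ×ˢ J'.pi t' : Set (A × ({j // j ≠ i} → E))) :=
      .prod .univ (.pi (J.finite_toSet.preimage Subtype.val_injective.injOn).countable
        fun j _ => ht j)
    have hvz : Measurable fun ω => (v ω, fun j : {j // j ≠ i} => z ω j) := by fun_prop
    rw [Finset.coe_insert, Set.insert_eq, Set.union_pi, Set.singleton_pi, Set.preimage_inter]
    simp only [Finset.prod_insert hi]
    rw [hJi] at ih ⊢
    have hprod : (fun a => κ i a (t i) * ∏ j ∈ J, κ j a (t j)) =
        (fun a => ∏ j ∈ J, κ j a (t j)) * fun a => κ i a (t i) := funext fun _ => mul_comm _ _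
    rw [hprod]
    exact IsCondProb.inter hvz measurable_fst hm ((κ i).measurable_coe (ht i))
      (Finset.measurable_prod _ fun j _ => (κ j).measurable_coe (ht j)) (H i _ (ht i)) ih

variable (κ) [∀ i, IsMarkovKernel (κ i)]

/-- The kernel of the products of the laws of a family of Markov kernels. -/
def infinitePiKernel : Kernel A (ι → E) where
  toFun a := Measure.infinitePi fun i => κ i a
  measurable' := by
    refine Measurable.measure_of_isPiSystem_of_isProbabilityMeasure
      (generateFrom_squareCylinders (α := fun _ : ι => E)).symm
      (isPiSystem_squareCylinders (fun _ => MeasurableSpace.isPiSystem_measurableSet)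
        (fun _ => MeasurableSet.univ (α := E))) ?_
    rintro _ ⟨s, t, ht, rfl⟩
    simp only [Measure.infinitePi_pi _ fun i _ => ht i (Set.mem_univ i)]
    exact Finset.measurable_prod _ fun i _ => (κ i).measurable_coe (ht i (Set.mem_univ i))

theorem infinitePiKernel_apply (a : A) :
    infinitePiKernel κ a = Measure.infinitePi fun i => κ i a := rfl

instance : IsMarkovKernel (infinitePiKernel κ) :=
  ⟨fun a => by rw [infinitePiKernel_apply]; infer_instance⟩

variable {κ}

theorem hasCondDistrib_infinitePiKernel [IsFiniteMeasure P] (hv : Measurable v) (hz : Measurable z)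
    (H : ∀ i s, MeasurableSet s → IsCondProb P {ω | z ω i ∈ s}
      (fun ω => (v ω, fun j : {j // j ≠ i} => z ω j)) (fun w => κ i w.1 s)) :
    HasCondDistrib z v (infinitePiKernel κ) P := by
  refine hasCondDistrib_pi_of_isCondProb_box hv hz fun J t ht => ?_
  simpa only [infinitePiKernel_apply, Measure.infinitePi_pi _ fun i _ => ht i] using
    isCondProb_box_of_erase hv hz H ht J

end InfinitePiKernel

/-! ### Directing random points of a sampling law -/

section OddArray

/-- The subarray of the entries with both indices odd. -/
def oddPart (d : DistMatrix) (i j : ℕ) : I := d.1 (2 * i + 1) (2 * j + 1)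

/-- The distances of the point of index `2 * p` to the odd-indexed points. This row will play the
role of a random point directing the index `2 * p`. -/
def oddRow (p : ℕ) (d : DistMatrix) (k : ℕ) : I := d.1 (2 * p) (2 * k + 1)

/-- The entries above the diagonal of the submatrix with both indices even. -/
def evenPart (d : DistMatrix) (p : Upper) : I := d.1 (2 * p.1.1) (2 * p.1.2)

@[fun_prop] theorem measurable_oddPart : Measurable oddPart :=
  measurable_pi_lambda _ fun _ => measurable_pi_lambda _ fun _ => measurable_entry _ _

@[fun_prop] theorem measurable_oddRow (p : ℕ) : Measurable (oddRow p) :=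
  measurable_pi_lambda _ fun _ => measurable_entry _ _

@[fun_prop] theorem measurable_evenPart : Measurable evenPart :=
  measurable_pi_lambda _ fun _ => measurable_entry _ _

theorem map_evenPart {ζ : Measure DistMatrix} (hζ : IsSamplingLaw ζ) :
    ζ.map evenPart = ζ.map upperEquiv := by
  conv_rhs => rw [← (hζ.exchangeable (injective_two_mul_add 0)).map_eq,
    Measure.map_map upperEquiv.measurable (measurable_reindex _)]
  rfl

variable (ζ : Measure DistMatrix) [IsProbabilityMeasure ζ]

/-- The conditional law of a row of `oddRow` given `oddPart`. -/
def rowKernel : Kernel (ℕ → ℕ → I) (ℕ → I) := condDistrib (fun d => oddRow 0 d) oddPart ζ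

/-- The conditional law of an entry of `evenPart` given `oddPart` and the two rows of its
indices. -/
def entryKernel : Kernel ((ℕ → ℕ → I) × (ℕ → I) × (ℕ → I)) I :=
  condDistrib (fun d => d.1 (2 * 0) (2 * 1)) (fun d => (oddPart d, oddRow 0 d, oddRow 1 d)) ζ

instance : IsMarkovKernel (rowKernel ζ) := by unfold rowKernel; infer_instance

instance : IsMarkovKernel (entryKernel ζ) := by unfold entryKernel; infer_instance

variable {ζ}

theorem exists_injective_fixing_odd {p q : ℕ} (hpq : p ≠ q) :
    ∃ ψ : ℕ → ℕ, ψ.Injective ∧ ψ (2 * 0) = 2 * p ∧ ψ (2 * 1) = 2 * q ∧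
      ∀ k, ψ (2 * k + 1) = 2 * k + 1 := by
  refine ⟨fun n => if n % 2 = 1 then n else if n = 0 then 2 * p else if n = 2 then 2 * q else
    n + 2 * (p + q), fun m n h => ?_, rfl, rfl, fun k => if_pos (by omega)⟩
  dsimp only at h
  split_ifs at h <;> omega

theorem isCondProb_entry (hζ : IsSamplingLaw ζ) {p q : ℕ} (hpq : p ≠ q) {s : Set I}
    (hs : MeasurableSet s) :
    IsCondProb ζ {d | d.1 (2 * p) (2 * q) ∈ s} (fun d => (oddPart d, oddRow p d, oddRow q d))
      (fun w => entryKernel ζ w s) := by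
  obtain ⟨ψ, hψ, hp, hq, hodd⟩ := exists_injective_fixing_odd hpq
  have hv : Measurable fun d => (oddPart d, oddRow 0 d, oddRow 1 d) := by fun_prop
  have he : Measurable fun d : DistMatrix => d.1 (2 * 0) (2 * 1) := measurable_entry _ _
  have hodd' (d : DistMatrix) : oddPart (reindex ψ d) = oddPart d := by
    ext i j : 2; simp only [oddPart, reindex_apply, hodd]
  have hp' (d : DistMatrix) : oddRow 0 (reindex ψ d) = oddRow p d := by
    ext k : 1; simp only [oddRow, reindex_apply, hp, hodd]
  have hq' (d : DistMatrix) : oddRow 1 (reindex ψ d) = oddRow q d := by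
    ext k : 1; simp only [oddRow, reindex_apply, hq, hodd]
  unfold entryKernel
  have := (isCondProb_condDistrib he hv hs).comp_measurePreserving (he hs) hv (hζ.exchangeable hψ)
  simpa only [Function.comp_def, Set.preimage, Set.mem_ofPred_eq, reindex_apply, hp, hq, hodd',
    hp', hq'] using this

theorem isCondProb_row (hζ : IsSamplingLaw ζ) (p : ℕ) {s : Set (ℕ → I)} (hs : MeasurableSet s) :
    IsCondProb ζ {d | oddRow p d ∈ s} oddPart (fun a => rowKernel ζ a s) := by
  obtain ⟨ψ, hψ, hp, -, hodd⟩ := exists_injective_fixing_odd p.succ_ne_self.symm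
  have hodd' (d : DistMatrix) : oddPart (reindex ψ d) = oddPart d := by
    ext i j : 2; simp only [oddPart, reindex_apply, hodd]
  have hp' (d : DistMatrix) : oddRow 0 (reindex ψ d) = oddRow p d := by
    ext k : 1; simp only [oddRow, reindex_apply, hp, hodd]
  unfold rowKernel
  have := (isCondProb_condDistrib (measurable_oddRow 0) measurable_oddPart
    hs).comp_measurePreserving (measurable_oddRow 0 hs) measurable_oddPart (hζ.exchangeable hψ)
  simpa only [Function.comp_def, Set.preimage, Set.mem_ofPred_eq, hodd', hp'] using this

theorem exists_injective_forall_lt_odd (K : ℕ) : ∃ φ : ℕ → ℕ, φ.Injective ∧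
    ∀ k < K, φ (2 * k + 1) = k := by
  refine ⟨fun n => if n % 2 = 1 ∧ n < 2 * K then n / 2 else n + K, fun m n h => ?_,
    fun k hk => ?_⟩
  · dsimp only at h
    split_ifs at h <;> omega
  · dsimp only
    rw [if_pos (by omega)]
    omega

/-- The index map `n ↦ 2 * φ n + 1` fixes finitely many odd indices, and moves all the other
indices into the odd ones; leaving `2 * p` in place, it shows that the other rows carry no
information on row `p` beyond that in `oddPart`. -/
theorem isCondProb_row_box_erase (hζ : IsSamplingLaw ζ) (p : ℕ) (J : Finset ℕ) {t : ℕ → Set I}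
    (ht : ∀ k, MeasurableSet (t k)) :
    IsCondProb ζ {d | oddRow p d ∈ (J : Set ℕ).pi t}
      (fun d => (oddPart d, fun r : {r // r ≠ p} => oddRow r d))
      (fun w => rowKernel ζ w.1 ((J : Set ℕ).pi t)) := by
  obtain ⟨K, hK⟩ := J.exists_nat_subset_range
  obtain ⟨φ, hφ, hφK⟩ := exists_injective_forall_lt_odd K
  set T := reindex fun n => if n = 2 * p then 2 * p else 2 * φ n + 1
  have hT : MeasurePreserving T ζ ζ := by
    refine hζ.exchangeable fun m n h => ?_
    have := @hφ m n
    split_ifs at h <;> omega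
  have hbox : MeasurableSet ((J : Set ℕ).pi t) := .pi J.countable_toSet fun k _ => ht k
  let u (a : ℕ → ℕ → I) : (ℕ → ℕ → I) × ({r // r ≠ p} → ℕ → I) :=
    (fun i j => a (φ (2 * i + 1)) (φ (2 * j + 1)), fun r k => a (φ (2 * r)) (φ (2 * k + 1)))
  have hodd (k : ℕ) : 2 * k + 1 ≠ 2 * p := by omega
  have hTS : T ⁻¹' {d | oddRow p d ∈ (J : Set ℕ).pi t} = {d | oddRow p d ∈ (J : Set ℕ).pi t} := by
    ext d
    refine forall₂_congr fun k hk => ?_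
    simp only [T, oddRow, reindex_apply, if_pos, if_neg (hodd _),
      hφK k (Finset.mem_range.1 (hK hk))]
  let W (d : DistMatrix) := (oddPart d, fun r : {r // r ≠ p} => oddRow r d)
  have hW : Measurable W := by fun_prop
  have hTW : W ∘ T = u ∘ Prod.fst ∘ W := by
    refine funext fun d => Prod.ext (funext₂ fun i j => ?_) (funext₂ fun r k => ?_)
    · simp only [T, u, W, Function.comp_apply, oddPart, reindex_apply, if_neg (hodd _)]
    · have hne : 2 * r.1 ≠ 2 * p := by have := r.2; omega
      simp only [T, u, W, Function.comp_apply, oddPart, oddRow, reindex_apply, if_neg (hodd _),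
        if_neg hne]
  exact IsCondProb.of_measurePreserving (f := Prod.fst) (u := u)
    (h := fun a => rowKernel ζ a ((J : Set ℕ).pi t)) (measurable_oddRow p hbox) hW measurable_fst
    (by fun_prop) ((rowKernel ζ).measurable_coe hbox) hT hTS hTW (isCondProb_row hζ p hbox)

theorem hasCondDistrib_oddRow (hζ : IsSamplingLaw ζ) :
    HasCondDistrib (fun d p => oddRow p d) oddPart
      (infinitePiKernel fun _ : ℕ => rowKernel ζ) ζ := by
  refine hasCondDistrib_infinitePiKernel measurable_oddPart (by fun_prop) fun p s hs => ?_
  have hv : Measurable fun d => (oddPart d, fun r : {r // r ≠ p} => oddRow r d) := by fun_prop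
  have hz : Measurable fun d => oddRow p d := by fun_prop
  exact isCondProb_of_hasCondDistrib hv hz (κ := (rowKernel ζ).comap Prod.fst measurable_fst)
    (hasCondDistrib_pi_of_isCondProb_box hv hz fun J _ ht => isCondProb_row_box_erase hζ p J ht) hs

variable (ζ) in
/-- The symmetrization of `entryKernel` in the two rows. -/
def symmEntryKernel : Kernel ((ℕ → ℕ → I) × (ℕ → I) × (ℕ → I)) I where
  toFun w := (2⁻¹ : ℝ≥0∞) • (entryKernel ζ w + entryKernel ζ (w.1, w.2.swap))
  measurable' := by
    refine Measure.measurable_of_measurable_coe _ fun s hs => ?_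
    simp only [Measure.smul_apply, Measure.add_apply, smul_eq_mul]
    have h := (entryKernel ζ).measurable_coe hs
    exact (h.add (h.comp (g := fun w => entryKernel ζ w s)
      (f := fun w => (w.1, w.2.swap)) (by fun_prop))).const_mul _

theorem symmEntryKernel_apply (w : (ℕ → ℕ → I) × (ℕ → I) × (ℕ → I)) :
    symmEntryKernel ζ w = (2⁻¹ : ℝ≥0∞) • (entryKernel ζ w + entryKernel ζ (w.1, w.2.swap)) := rfl

theorem symmEntryKernel_comm (a : ℕ → ℕ → I) (r r' : ℕ → I) :
    symmEntryKernel ζ (a, r, r') = symmEntryKernel ζ (a, r', r) := by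
  simp only [symmEntryKernel_apply, Prod.swap_prod_mk, add_comm]

instance : IsMarkovKernel (symmEntryKernel ζ) :=
  ⟨fun w => ⟨by
    simp [symmEntryKernel_apply, ENNReal.inv_two_add_inv_two]⟩⟩

theorem isCondProb_entry_symm (hζ : IsSamplingLaw ζ) {p q : ℕ} (hpq : p ≠ q) {s : Set I}
    (hs : MeasurableSet s) :
    IsCondProb ζ {d | d.1 (2 * p) (2 * q) ∈ s} (fun d => (oddPart d, oddRow p d, oddRow q d))
      (fun w => symmEntryKernel ζ w s) := by
  have hh := (entryKernel ζ).measurable_coe hs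
  have hswap : Measurable fun w : (ℕ → ℕ → I) × (ℕ → I) × (ℕ → I) => (w.1, w.2.swap) := by
    fun_prop
  refine (isCondProb_entry hζ hpq hs).average hh ?_
  simp only [fun d : DistMatrix => d.2.1 (2 * p) (2 * q)]
  exact IsCondProb.comp_right (by fun_prop) hswap (hh.comp hswap) (isCondProb_entry hζ hpq.symm hs)

/-- The index map fixing `2 * p` and `2 * q` and moving all other indices into the odd ones. -/
def shiftOutside (p q n : ℕ) : ℕ := if n = 2 * p ∨ n = 2 * q then n else 2 * n + 1

theorem shiftOutside_injective (p q : ℕ) : (shiftOutside p q).Injective := by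
  intro m n h
  unfold shiftOutside at h
  split_ifs at h <;> omega

theorem shiftOutside_odd (p q k : ℕ) : shiftOutside p q (2 * k + 1) = 2 * (2 * k + 1) + 1 :=
  if_neg (by omega)

theorem shiftOutside_even {p q m : ℕ} (hp : m ≠ p) (hq : m ≠ q) :
    shiftOutside p q (2 * m) = 2 * (2 * m) + 1 :=
  if_neg (by omega)

/-- The distances of the point of index `shiftOutside p q (2 * m)` to the odd-indexed points, as a
function of `oddPart` and of the rows `p` and `q`. -/
def shiftedRow (p q m : ℕ) (w : (ℕ → ℕ → I) × (ℕ → I) × (ℕ → I)) : ℕ → I :=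
  if m = p then w.2.1 else if m = q then w.2.2 else w.1 (2 * m)

@[fun_prop] theorem measurable_shiftedRow (p q m : ℕ) : Measurable (shiftedRow p q m) := by
  unfold shiftedRow
  split_ifs <;> fun_prop

theorem entry_shiftOutside (d : DistMatrix) (p q m k : ℕ) :
    d.1 (shiftOutside p q (2 * m)) (2 * k + 1) =
      shiftedRow p q m (oddPart d, oddRow p d, oddRow q d) k := by
  unfold shiftedRow
  split_ifs with hp hq
  · simp [shiftOutside, hp, oddRow]
  · simp [shiftOutside, hq, oddRow]
  · rw [shiftOutside_even hp hq]
    rfl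

/-- Reindexing by `shiftOutside` shows that the entry at `(2 * p, 2 * q)` depends on the rest only
through `oddPart` and its two rows. -/
theorem isCondProb_entry_erase (hζ : IsSamplingLaw ζ) (p : Upper) {s : Set I}
    (hs : MeasurableSet s) :
    IsCondProb ζ {d | evenPart d p ∈ s}
      (fun d => ((oddPart d, fun m => oddRow m d), fun q : {q // q ≠ p} => evenPart d q))
      (fun w => symmEntryKernel ζ (w.1.1, w.1.2 p.1.1, w.1.2 p.1.2) s) := by
  obtain ⟨⟨p, q⟩, hpq : p < q⟩ := p
  set T := reindex (shiftOutside p q)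
  let W (d : DistMatrix) :=
    ((oddPart d, fun m => oddRow m d), fun r : {r : Upper // r ≠ ⟨(p, q), hpq⟩} => evenPart d r)
  let f (w : ((ℕ → ℕ → I) × (ℕ → ℕ → I)) × ({r : Upper // r ≠ ⟨(p, q), hpq⟩} → I)) :=
    (w.1.1, w.1.2 p, w.1.2 q)
  let u (w : (ℕ → ℕ → I) × (ℕ → I) × (ℕ → I)) :
      ((ℕ → ℕ → I) × (ℕ → ℕ → I)) × ({r : Upper // r ≠ ⟨(p, q), hpq⟩} → I) :=
    ((fun i j => w.1 (2 * i + 1) (2 * j + 1), fun m k => shiftedRow p q m w (2 * k + 1)), fun r =>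
      if r.1.1.2 = p ∨ r.1.1.2 = q then shiftedRow p q r.1.1.2 w (2 * r.1.1.1)
      else shiftedRow p q r.1.1.1 w (2 * r.1.1.2))
  have hu : Measurable u := by
    refine .prodMk (.prodMk (by fun_prop) (by fun_prop)) (measurable_pi_lambda _ fun r => ?_)
    split_ifs <;> fun_prop
  have hTW : W ∘ T = u ∘ f ∘ W := by
    refine funext fun d => Prod.ext (Prod.ext (funext₂ fun i j => ?_) (funext₂ fun m k => ?_))
      (funext fun ⟨⟨⟨m, n⟩, (hmn : m < n)⟩, hne⟩ => ?_)
    · simp only [T, W, u, f, Function.comp_apply, oddPart, reindex_apply, shiftOutside_odd]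
    · exact (congrArg _ (shiftOutside_odd p q k)).trans (entry_shiftOutside d p q m _)
    · change d.1 (shiftOutside p q (2 * m)) (shiftOutside p q (2 * n)) = ite _ _ _
      simp only [ne_eq, Subtype.mk.injEq, Prod.mk.injEq] at hne
      split_ifs with hn <;> dsimp only at hn
      · rw [d.2.1, shiftOutside_even (m := m) (by omega) (by omega)]
        exact entry_shiftOutside d p q n _
      · rw [shiftOutside_even (m := n) (by omega) (by omega)]
        exact entry_shiftOutside d p q m _
  exact IsCondProb.of_measurePreserving (f := f) (u := u) (h := fun w => symmEntryKernel ζ w s)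
    (measurable_entry (2 * p) (2 * q) hs) (by fun_prop) (by fun_prop) hu
    ((symmEntryKernel ζ).measurable_coe hs) (hζ.exchangeable (shiftOutside_injective p q))
    (by ext d; simp [shiftOutside]) hTW (isCondProb_entry_symm hζ hpq.ne hs)

variable (ζ) in
/-- The conditional law of `evenPart` given `oddPart` and all rows. -/
def evenKernel : Kernel ((ℕ → ℕ → I) × (ℕ → ℕ → I)) (Upper → I) :=
  infinitePiKernel fun p : Upper => (symmEntryKernel ζ).comap
    (fun w : (ℕ → ℕ → I) × (ℕ → ℕ → I) => (w.1, w.2 p.1.1, w.2 p.1.2)) (by fun_prop)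

instance : IsMarkovKernel (evenKernel ζ) := by unfold evenKernel; infer_instance

theorem hasCondDistrib_evenPart (hζ : IsSamplingLaw ζ) :
    HasCondDistrib evenPart (fun d => (oddPart d, fun p => oddRow p d)) (evenKernel ζ) ζ :=
  hasCondDistrib_infinitePiKernel (by fun_prop) measurable_evenPart fun p _ hs =>
    isCondProb_entry_erase hζ p hs

theorem hasCondDistrib_evenPart_const (hζ : IsSamplingLaw ζ) :
    HasCondDistrib evenPart oddPart (Kernel.const _ (ζ.map upperEquiv)) ζ := by
  have hind : IndepFun oddPart evenPart ζ :=
    (hζ.dissociated (injective_two_mul_add 1) (injective_two_mul_add 0)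
      disjoint_range_two_mul.symm).comp measurable_subtype_coe upperEquiv.measurable
  refine ⟨by fun_prop, ?_⟩
  rw [Measure.compProd_const, ← map_evenPart hζ]
  exact (indepFun_iff_map_prod_eq_prod_map_map (by fun_prop) (by fun_prop)).1 hind

/-- The law of the entries above the diagonal, chosen independently with laws `η (r i, r j)` for a
sequence `r` of points. -/
def entriesKernel {R : Type*} [MeasurableSpace R] (η : Kernel (R × R) I) [IsMarkovKernel η] :
    Kernel (ℕ → R) (Upper → I) :=
  infinitePiKernel fun p : Upper => η.comap (fun r => (r p.1.1, r p.1.2)) (by fun_prop)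

/-- The Aldous–Hoover representation. The directing randomness is the odd part of the array, frozen
at a typical value. -/
theorem exists_mixture (hζ : IsSamplingLaw ζ) :
    ∃ (ρ : Measure (ℕ → I)) (_ : IsProbabilityMeasure ρ) (η : Kernel ((ℕ → I) × (ℕ → I)) I)
      (_ : IsMarkovKernel η), (∀ r r', η (r, r') = η (r', r)) ∧
      ζ.map upperEquiv = entriesKernel η ∘ₘ (Measure.infinitePi fun _ : ℕ => ρ) := by
  have : IsProbabilityMeasure (ζ.map oddPart) :=
    Measure.isProbabilityMeasure_map measurable_oddPart.aemeasurable
  have : IsProbabilityMeasure (ζ.map upperEquiv) :=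
    Measure.isProbabilityMeasure_map upperEquiv.measurable.aemeasurable
  have hjoint := (hasCondDistrib_prodMk (hasCondDistrib_oddRow hζ) (hasCondDistrib_evenPart hζ)).snd
  obtain ⟨a, ha⟩ := (Kernel.ae_eq_of_compProd_eq
    (hjoint.map_eq.symm.trans (hasCondDistrib_evenPart_const hζ).map_eq)).exists
  refine ⟨rowKernel ζ a, inferInstance, (symmEntryKernel ζ).comap (fun w => (a, w.1, w.2))
    (by fun_prop), inferInstance, fun r r' => ?_, ?_⟩
  · simp only [Kernel.comap_apply, symmEntryKernel_comm]
  · rw [Kernel.const_apply] at ha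
    rw [← ha]
    ext s hs
    rw [Kernel.snd_apply' _ _ hs, Kernel.compProd_apply (measurable_snd hs),
      Measure.bind_apply hs (Kernel.aemeasurable _)]
    rfl

end OddArray

section BlowUp

theorem ae_prod_fst_ne_snd {α : Type*} [MeasurableSpace α] [MeasurableEq α] {μ : Measure α}
    [SFinite μ] [NullSingletonClass μ] : ∀ᵐ p ∂μ.prod μ, p.1 ≠ p.2 := by
  rw [Measure.ae_prod_iff_ae_ae (p := fun p : α × α => p.1 ≠ p.2)
    (measurableSet_eq_fun measurable_fst measurable_snd).compl]
  exact ae_of_all _ fun x => (measure_eq_zero_iff_ae_notMem.1 (measure_singleton x)).mono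
    fun y hy hxy => hy hxy.symm

variable {R : Type} [MeasurableSpace R] {ρ : Measure R} [IsProbabilityMeasure ρ]
  {η : Kernel (R × R) I} [IsMarkovKernel η]

theorem entriesKernel_apply (r : ℕ → R) :
    entriesKernel η r = Measure.infinitePi fun p : Upper => η (r p.1.1, r p.1.2) := rfl

theorem measurableSet_triangle : MeasurableSet {l : I × I × I |
    (l.2.2 : ℝ) ≤ l.1 + l.2.1 ∧ (l.1 : ℝ) ≤ l.2.1 + l.2.2 ∧ (l.2.1 : ℝ) ≤ l.1 + l.2.2} := by
  have h₁ : Measurable fun l : I × I × I => (l.1 : ℝ) := by fun_prop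
  have h₂ : Measurable fun l : I × I × I => (l.2.1 : ℝ) := by fun_prop
  have h₃ : Measurable fun l : I × I × I => (l.2.2 : ℝ) := by fun_prop
  exact (measurableSet_le h₃ (h₁.add h₂)).inter
    ((measurableSet_le h₁ (h₂.add h₃)).inter (measurableSet_le h₂ (h₁.add h₃)))

theorem ae_triangle_of_mixture {ζ : Measure DistMatrix} (hζ : IsSamplingLaw ζ)
    (hmix : ζ.map upperEquiv = entriesKernel η ∘ₘ (Measure.infinitePi fun _ : ℕ => ρ)) :
    ∀ᵐ p ∂(ρ.prod (ρ.prod ρ)),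
      ∀ᵐ l ∂((η (p.1, p.2.1)).prod ((η (p.2.1, p.2.2)).prod (η (p.1, p.2.2)))),
        (l.2.2 : ℝ) ≤ l.1 + l.2.1 ∧ (l.1 : ℝ) ≤ l.2.1 + l.2.2 ∧ (l.2.1 : ℝ) ≤ l.1 + l.2.2 := by
  let u01 : Upper := ⟨(0, 1), by norm_num⟩
  let u12 : Upper := ⟨(1, 2), by norm_num⟩
  let u02 : Upper := ⟨(0, 2), by norm_num⟩
  let triangles : Kernel (R × R × R) (I × I × I) :=
    (η.comap (fun p => (p.1, p.2.1)) (by fun_prop)) ×ₖ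
      ((η.comap (fun p => (p.2.1, p.2.2)) (by fun_prop)) ×ₖ
        (η.comap (fun p => (p.1, p.2.2)) (by fun_prop)))
  have htriangles : ∀ p, triangles p =
      (η (p.1, p.2.1)).prod ((η (p.2.1, p.2.2)).prod (η (p.1, p.2.2))) := fun p => by
    simp only [triangles, Kernel.prod_apply, Kernel.comap_apply]
  have hentries : ∀ᵐ ω ∂(entriesKernel η ∘ₘ (Measure.infinitePi fun _ : ℕ => ρ)),
      (ω u02 : ℝ) ≤ ω u01 + ω u12 ∧ (ω u01 : ℝ) ≤ ω u12 + ω u02 ∧ (ω u12 : ℝ) ≤ ω u01 + ω u02 := by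
    rw [← hmix, upperEquiv.measurableEmbedding.ae_map_iff]
    filter_upwards [hζ.triangle] with d hd
    have h021 := hd 0 2 1
    have h102 := hd 1 0 2
    rw [d.2.1 2 1, add_comm] at h021
    rw [d.2.1 1 0] at h102
    exact ⟨hd 0 1 2, h021, h102⟩
  have hpoints : ∀ᵐ r ∂(Measure.infinitePi fun _ : ℕ => ρ), ∀ᵐ l ∂triangles (r 0, r 1, r 2),
      (l.2.2 : ℝ) ≤ l.1 + l.2.1 ∧ (l.1 : ℝ) ≤ l.2.1 + l.2.2 ∧ (l.2.1 : ℝ) ≤ l.1 + l.2.2 := by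
    filter_upwards [Measure.ae_ae_of_ae_bind (Kernel.aemeasurable _) hentries] with r hr
    rw [htriangles, ← infinitePi_map_eval_triple (fun p : Upper => η (r p.1.1, r p.1.2))
      (i := u01) (j := u12) (k := u02) (by simp [u01, u12]) (by simp [u01, u02])
      (by simp [u12, u02]), ae_map_iff (by fun_prop) measurableSet_triangle]
    exact hr
  simp only [← htriangles]
  rw [← infinitePi_map_eval_triple (fun _ : ℕ => ρ) (i := 0) (j := 1) (k := 2) (by norm_num)
    (by norm_num) (by norm_num), ae_map_iff (by fun_prop)]
  · exact hpoints
  · exact triangles.measurable_coe measurableSet_triangle.compl (measurableSet_singleton 0)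

theorem measurableSet_setOf_label_eq :
    MeasurableSet {p : (R × I) × (R × I) | p.1.2 = p.2.2} :=
  measurableSet_eq_fun (by fun_prop) (by fun_prop)

variable (η) in
open Classical in
/-- The kernel `η` made to vanish on the diagonal: every point of `R` is blown up to an interval of
labels, and two points with the same label have distance zero. -/
def blowUpKernel : Kernel ((R × I) × (R × I)) I :=
  Kernel.piecewise measurableSet_setOf_label_eq (Kernel.const _ (Measure.dirac 0))
    (η.comap (fun p => (p.1.1, p.2.1)) (by fun_prop))

instance : IsMarkovKernel (blowUpKernel η) := by unfold blowUpKernel; infer_instance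

omit [IsMarkovKernel η] in
theorem blowUpKernel_of_eq {p : (R × I) × (R × I)} (h : p.1.2 = p.2.2) :
    blowUpKernel η p = Measure.dirac 0 := by
  rw [blowUpKernel, Kernel.piecewise_apply, if_pos (by exact h), Kernel.const_apply]

omit [IsMarkovKernel η] in
theorem blowUpKernel_of_ne {p : (R × I) × (R × I)} (h : p.1.2 ≠ p.2.2) :
    blowUpKernel η p = η (p.1.1, p.2.1) := by
  rw [blowUpKernel, Kernel.piecewise_apply, if_neg (by exact h), Kernel.comap_apply]

theorem ae_label_ne :
    ∀ᵐ p ∂(ρ.prod (volume : Measure I)).prod (ρ.prod (volume : Measure I)), p.1.2 ≠ p.2.2 :=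
  ((measurePreserving_snd (μ := ρ) (ν := (volume : Measure I))).prod
    (measurePreserving_snd (μ := ρ) (ν := (volume : Measure I)))).quasiMeasurePreserving.ae
    ae_prod_fst_ne_snd

variable (ρ η) in
/-- The qmm-space directed by the points of `(R, ρ)`, blown up so that almost all pairs of points
are off the diagonal. -/
abbrev blowUp [StandardBorelSpace R] (hsymm : ∀ r r', η (r, r') = η (r', r))
    (htri : ∀ᵐ p ∂(ρ.prod (ρ.prod ρ)),
      ∀ᵐ l ∂((η (p.1, p.2.1)).prod ((η (p.2.1, p.2.2)).prod (η (p.1, p.2.2)))),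
        (l.2.2 : ℝ) ≤ l.1 + l.2.1 ∧ (l.1 : ℝ) ≤ l.2.1 + l.2.2 ∧ (l.2.1 : ℝ) ≤ l.1 + l.2.2) :
    QMMSpace where
  carrier := R × I
  μ := ρ.prod volume
  dStar := blowUpKernel η
  dStar_self _ := blowUpKernel_of_eq rfl
  dStar_comm x y := by
    by_cases h : x.2 = y.2
    · rw [blowUpKernel_of_eq h, blowUpKernel_of_eq h.symm]
    · rw [blowUpKernel_of_ne h, blowUpKernel_of_ne (Ne.symm h), hsymm]
  triangle := by
    have hfst : MeasurePreserving Prod.fst (ρ.prod (volume : Measure I)) ρ := measurePreserving_fst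
    have hid := MeasurePreserving.id (ρ.prod (volume : Measure I))
    filter_upwards [Measure.quasiMeasurePreserving_snd.ae ae_label_ne,
      (hid.prod measurePreserving_fst).quasiMeasurePreserving.ae ae_label_ne,
      (hid.prod measurePreserving_snd).quasiMeasurePreserving.ae ae_label_ne,
      (hfst.prod (hfst.prod hfst)).quasiMeasurePreserving.ae htri] with p h₂₃ h₁₂ h₁₃ hp
    rw [blowUpKernel_of_ne h₂₃, blowUpKernel_of_ne (p := (p.1, p.2.1)) h₁₂,
      blowUpKernel_of_ne (p := (p.1, p.2.2)) h₁₃]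
    exact hp

theorem map_upperEquiv_blowUp_sampling [StandardBorelSpace R]
    (hsymm : ∀ r r', η (r, r') = η (r', r)) (htri) :
    ((blowUp ρ η hsymm htri).sampling : Measure DistMatrix).map upperEquiv =
      entriesKernel η ∘ₘ (Measure.infinitePi fun _ : ℕ => ρ) := by
  have hlabel : ∀ᵐ x ∂(Measure.infinitePi fun _ : ℕ => ρ.prod (volume : Measure I)),
      ∀ p : Upper, (x p.1.1).2 ≠ (x p.1.2).2 := by
    refine ae_all_iff.2 fun p => ?_
    have hpair := Measure.infinitePi_map_eval_prod (P := fun _ : ℕ => ρ.prod (volume : Measure I))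
      p.2.ne
    exact ae_of_ae_map (p := fun q : (R × I) × (R × I) => q.1.2 ≠ q.2.2) (by fun_prop)
      (hpair ▸ ae_label_ne)
  have hlaw : ∀ᵐ x ∂(Measure.infinitePi fun _ : ℕ => ρ.prod (volume : Measure I)),
      ((blowUp ρ η hsymm htri).matrixLaw x).map upperEquiv =
        entriesKernel η fun i => (x i).1 := by
    filter_upwards [hlabel] with x hx
    rw [QMMSpace.matrixLaw_map_upperEquiv, entriesKernel_apply]
    exact congrArg _ (funext fun p => blowUpKernel_of_ne (hx p))
  have hfst : (Measure.infinitePi fun _ : ℕ => ρ.prod (volume : Measure I)).map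
      (fun x i => (x i).1) = Measure.infinitePi fun _ : ℕ => ρ := by
    have h := Measure.infinitePi_map_pi (μ := fun _ : ℕ => ρ.prod (volume : Measure I))
      (f := fun _ => Prod.fst) fun _ => measurable_fst
    simpa only [measurePreserving_fst.map_eq] using h
  ext s hs
  rw [Measure.map_apply upperEquiv.measurable hs,
    QMMSpace.sampling_apply _ (upperEquiv.measurable hs),
    Measure.bind_apply hs (Kernel.aemeasurable _), ← hfst,
    lintegral_map (Kernel.measurable_coe _ hs) (by fun_prop)]
  refine lintegral_congr_ae ?_
  filter_upwards [hlaw] with x hx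
  rw [← hx, Measure.map_apply upperEquiv.measurable hs]

theorem exists_qmmSpace_of_isSamplingLaw {ζ : ProbabilityMeasure DistMatrix}
    (hζ : IsSamplingLaw (ζ : Measure DistMatrix)) : ∃ X : QMMSpace, X.sampling = ζ := by
  obtain ⟨ρ, hρ, η, hη, hsymm, hmix⟩ := exists_mixture hζ
  refine ⟨blowUp ρ η hsymm (ae_triangle_of_mixture hζ hmix), Subtype.ext ?_⟩
  exact upperEquiv.map_measurableEquiv_injective
    ((map_upperEquiv_blowUp_sampling hsymm (ae_triangle_of_mixture hζ hmix)).trans hmix.symm)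

end BlowUp

/-! ### Partial diameters and labelled samples -/

section PartialDiam

variable {Y : Type*} [MetricSpace Y]

theorem partialDiam_le_ediam [MeasurableSpace Y] {ν : Measure Y} {κ : ℝ} {A : Set Y}
    (hA : MeasurableSet A) (h : ENNReal.ofReal (1 - κ) ≤ ν A) :
    partialDiam ν κ ≤ Metric.ediam A :=
  iInf₂_le A ⟨hA, h⟩

theorem partialDiam_lt_iff [MeasurableSpace Y] {ν : Measure Y} {κ : ℝ} {c : ℝ≥0∞} :
    partialDiam ν κ < c ↔
      ∃ A, (MeasurableSet A ∧ ENNReal.ofReal (1 - κ) ≤ ν A) ∧ Metric.ediam A < c := by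
  simp only [partialDiam, iInf_lt_iff, exists_prop]

theorem exists_ediam_thickening_lt {A : Set Y} {c : ℝ≥0∞} (h : Metric.ediam A < c) :
    ∃ δ : ℝ, 0 < δ ∧ Metric.ediam (Metric.thickening δ A) < c := by
  obtain ⟨r, hr, hrc⟩ := ENNReal.lt_iff_exists_add_pos_lt.1 h
  refine ⟨(r / 2 : NNReal), NNReal.coe_pos.2 (half_pos hr), lt_of_le_of_lt ?_ hrc⟩
  refine (Metric.ediam_thickening_le _).trans_eq ?_
  rw [two_mul, ← ENNReal.coe_add, add_halves]

theorem eventually_partialDiam_lt [MeasurableSpace Y] [OpensMeasurableSpace Y] {ι : Type*}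
    {L : Filter ι} {ν : ι → ProbabilityMeasure Y} {ν₀ : ProbabilityMeasure Y}
    (h : Tendsto ν L (𝓝 ν₀)) {κ κ' : ℝ} (hκ : κ' < κ) (hκ1 : κ < 1) {c : ℝ≥0∞}
    (hc : partialDiam (ν₀ : Measure Y) κ' < c) :
    ∀ᶠ i in L, partialDiam (ν i : Measure Y) κ < c := by
  obtain ⟨A, ⟨-, hA⟩, hAc⟩ := partialDiam_lt_iff.1 hc
  obtain ⟨δ, hδ, hδc⟩ := exists_ediam_thickening_lt hAc
  have hopen : IsOpen (Metric.thickening δ A) := Metric.isOpen_thickening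
  have hlt : ENNReal.ofReal (1 - κ) <
      liminf (fun i => (ν i : Measure Y) (Metric.thickening δ A)) L :=
    calc ENNReal.ofReal (1 - κ) < ENNReal.ofReal (1 - κ') :=
          (ENNReal.ofReal_lt_ofReal_iff (by linarith)).2 (by linarith)
      _ ≤ (ν₀ : Measure Y) (Metric.thickening δ A) :=
          hA.trans (measure_mono (Metric.self_subset_thickening hδ A))
      _ ≤ _ := ProbabilityMeasure.le_liminf_measure_open_of_tendsto h hopen
  filter_upwards [eventually_lt_of_lt_liminf hlt] with i hi
  exact (partialDiam_le_ediam hopen.measurableSet hi.le).trans_lt hδc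

theorem subset_thickening_of_hausdorffEDist_lt {s t : Set Y} {δ : ℝ}
    (h : Metric.hausdorffEDist s t < ENNReal.ofReal δ) : s ⊆ Metric.thickening δ t :=
  fun _ hx => (Metric.infEDist_le_hausdorffEDist_of_mem hx).trans_lt h

theorem eventually_subset_thickening (K : TopologicalSpace.Closeds Y) {δ : ℝ} (hδ : 0 < δ) :
    ∀ᶠ A : TopologicalSpace.Closeds Y in 𝓝 K,
      (A : Set Y) ⊆ Metric.thickening δ K ∧ (K : Set Y) ⊆ Metric.thickening δ A := by
  filter_upwards [Metric.eball_mem_nhds K (ENNReal.ofReal_pos.2 hδ)] with A hA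
  have hAK : Metric.hausdorffEDist (A : Set Y) K < ENNReal.ofReal δ := hA
  refine ⟨subset_thickening_of_hausdorffEDist_lt hAK, subset_thickening_of_hausdorffEDist_lt ?_⟩
  rwa [Metric.hausdorffEDist_comm]

theorem isClosed_setOf_ediam_closeds_le (c : ℝ≥0∞) :
    IsClosed {K : TopologicalSpace.Closeds Y | Metric.ediam (K : Set Y) ≤ c} := by
  refine isClosed_iff_forall_filter.2 fun K F _ hF hK => ?_
  refine ENNReal.le_of_forall_pos_le_add fun ε hε _ => ?_
  have hle : ∀ᶠ A : TopologicalSpace.Closeds Y in F, Metric.ediam (A : Set Y) ≤ c :=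
    le_principal_iff.1 hF
  have hsub := hK (eventually_subset_thickening K (NNReal.coe_pos.2 (half_pos hε)))
  obtain ⟨A, hAc, -, hKA⟩ := (hle.and hsub).exists
  calc Metric.ediam (K : Set Y) ≤ Metric.ediam (A : Set Y) + 2 * ((ε / 2 : NNReal) : ℝ≥0∞) :=
        (Metric.ediam_mono hKA).trans (Metric.ediam_thickening_le _)
    _ ≤ c + ε := by
        rw [two_mul, ← ENNReal.coe_add, add_halves]
        gcongr

variable [MeasurableSpace Y] [BorelSpace Y]

theorem isClosed_setOf_le_measure_closeds (a : ℝ≥0∞) :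
    IsClosed {p : ProbabilityMeasure Y × TopologicalSpace.Closeds Y |
      a ≤ (p.1 : Measure Y) p.2} := by
  refine isClosed_iff_forall_filter.2 fun ⟨ν, K⟩ F _ hF hlim => ?_
  have hle : ∀ᶠ p : ProbabilityMeasure Y × TopologicalSpace.Closeds Y in F,
      a ≤ (p.1 : Measure Y) p.2 := le_principal_iff.1 hF
  have hν : Tendsto Prod.fst F (𝓝 ν) := (continuous_fst.tendsto _).mono_left hlim
  have hK : Tendsto Prod.snd F (𝓝 K) := (continuous_snd.tendsto _).mono_left hlim
  have hthick (ε : ℝ) (hε : 0 < ε) : a ≤ (ν : Measure Y) (Metric.cthickening ε (K : Set Y)) := by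
    refine le_trans ?_ (ProbabilityMeasure.limsup_measure_closed_le_of_tendsto hν
      Metric.isClosed_cthickening)
    refine le_limsup_of_frequently_le (Eventually.frequently ?_)
    filter_upwards [hle, hK.eventually (eventually_subset_thickening K hε)] with p hp hpK
    exact hp.trans
      (measure_mono (hpK.1.trans (Metric.thickening_subset_cthickening _ _)))
  have hcont : Tendsto (fun r => (ν : Measure Y) (Metric.cthickening r (K : Set Y))) (𝓝[>] 0)
      (𝓝 ((ν : Measure Y) K)) :=
    (tendsto_measure_cthickening_of_isClosed ⟨1, one_pos, measure_ne_top _ _⟩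
      K.isClosed).mono_left nhdsWithin_le_nhds
  exact ge_of_tendsto hcont (eventually_mem_nhdsWithin.mono hthick)

theorem lowerSemicontinuous_partialDiam [CompactSpace Y] (κ : ℝ) :
    LowerSemicontinuous fun ν : ProbabilityMeasure Y => partialDiam (ν : Measure Y) κ := by
  refine lowerSemicontinuous_iff_isClosed_preimage.2 fun c => ?_
  have hproj (c' : ℝ≥0∞) : IsClosed (Prod.fst ''
      ({p : ProbabilityMeasure Y × TopologicalSpace.Closeds Y |
        ENNReal.ofReal (1 - κ) ≤ (p.1 : Measure Y) p.2} ∩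
        Prod.snd ⁻¹' {K | Metric.ediam (K : Set Y) ≤ c'})) :=
    isClosedMap_fst_of_compactSpace _ ((isClosed_setOf_le_measure_closeds _).inter
      ((isClosed_setOf_ediam_closeds_le c').preimage continuous_snd))
  convert! isClosed_biInter fun c' (_ : c' ∈ Set.Ioi c) => hproj c' using 1
  ext ν
  simp only [Set.mem_preimage, Set.mem_Iic, Set.mem_iInter, Set.mem_Ioi]
  constructor
  · intro hν c' hc'
    obtain ⟨A, ⟨-, hA⟩, hAc⟩ := partialDiam_lt_iff.1 (hν.trans_lt hc')
    exact ⟨(ν, ⟨closure A, isClosed_closure⟩),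
      ⟨hA.trans (measure_mono subset_closure), (Metric.ediam_closure A).trans_le hAc.le⟩, rfl⟩
  · refine fun h => le_of_forall_gt_imp_ge_of_dense fun c' hc' => ?_
    obtain ⟨⟨ν, K⟩, ⟨hK, hKc⟩, rfl⟩ := h c' hc'
    exact (partialDiam_le_ediam K.isClosed.measurableSet hK).trans hKc

end PartialDiam

section SampleMean

/-- The mean of `a` over the first `N` terms of a sequence of points. -/
def sampleMean {Ω : Type*} (N : ℕ) (a : Ω → ℝ) (x : ℕ → Ω) : ℝ :=
  (∑ i ∈ Finset.range N, a (x i)) / N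

variable {Ω : Type*} [MeasurableSpace Ω] (μ : Measure Ω) [IsProbabilityMeasure μ] {a : Ω → ℝ}
  {N : ℕ}

theorem integral_sampleMean (ha : Integrable a μ) (hN : N ≠ 0) :
    ∫ x, sampleMean N a x ∂(Measure.infinitePi fun _ : ℕ => μ) = ∫ ω, a ω ∂μ := by
  have hev (i : ℕ) := measurePreserving_eval_infinitePi (fun _ : ℕ => μ) i
  have hint (i : ℕ) : ∫ x, a (x i) ∂(Measure.infinitePi fun _ : ℕ => μ) = ∫ ω, a ω ∂μ := by
    conv_rhs => rw [← (hev i).map_eq]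
    exact (integral_map (hev i).aemeasurable ((hev i).map_eq.symm ▸ ha.1)).symm
  have hsum : ∫ x, ∑ i ∈ Finset.range N, a (x i) ∂(Measure.infinitePi fun _ : ℕ => μ) =
      N * ∫ ω, a ω ∂μ := by
    refine (integral_finsetSum _ fun i _ => (hev i).integrable_comp_of_integrable ha).trans ?_
    simp [hint]
  simp only [sampleMean]
  rw [integral_div, hsum, mul_div_cancel_left₀ _ (Nat.cast_ne_zero.2 hN)]

theorem memLp_sampleMean {p : ℝ≥0∞} (ha : MemLp a p μ) :
    MemLp (sampleMean N a) p (Measure.infinitePi fun _ : ℕ => μ) := by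
  unfold sampleMean
  simp only [div_eq_mul_inv]
  exact (memLp_finsetSum _ fun i _ =>
    ha.comp_measurePreserving (measurePreserving_eval_infinitePi (fun _ : ℕ => μ) i)).mul_const _

theorem variance_sampleMean (ha : Measurable a) (ha2 : MemLp a 2 μ) :
    variance (sampleMean N a) (Measure.infinitePi fun _ : ℕ => μ) = variance a μ / N := by
  have hev (i : ℕ) := measurePreserving_eval_infinitePi (fun _ : ℕ => μ) i
  have hind := iIndepFun_infinitePi (P := fun _ : ℕ => μ) (X := fun _ => a) fun _ => ha
  have hsum : variance (∑ i ∈ Finset.range N, fun x : ℕ → Ω => a (x i))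
      (Measure.infinitePi fun _ : ℕ => μ) = N * variance a μ := by
    refine (IndepFun.variance_sum (fun i _ => ha2.comp_measurePreserving (hev i))
      fun i _ j _ hij => hind.indepFun hij).trans ?_
    exact (Finset.sum_congr rfl fun i _ => (hev i).variance_fun_comp ha.aemeasurable).trans
      (by simp)
  have hmean : sampleMean N a =
      fun x => (N : ℝ)⁻¹ * (∑ i ∈ Finset.range N, fun x : ℕ → Ω => a (x i)) x := by
    ext x
    simp [sampleMean, div_eq_inv_mul]
  rw [hmean, variance_const_mul, hsum]
  field_simp

theorem measure_le_abs_sampleMean_sub_integral_le (ha : Measurable a) {C : ℝ}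
    (hC : ∀ ω, |a ω| ≤ C) (hN : N ≠ 0) {δ : ℝ} (hδ : 0 < δ) :
    (Measure.infinitePi fun _ : ℕ => μ) {x | δ ≤ |sampleMean N a x - ∫ ω, a ω ∂μ|} ≤
      ENNReal.ofReal (C ^ 2 / (N * δ ^ 2)) := by
  have ha2 : MemLp a 2 μ := MemLp.of_bound ha.aestronglyMeasurable C (Eventually.of_forall hC)
  have hvar : variance a μ ≤ C ^ 2 :=
    (variance_le_sq_of_bounded (Eventually.of_forall fun ω => abs_le.1 (hC ω))
      ha.aemeasurable).trans_eq (by ring)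
  rw [← integral_sampleMean μ (ha2.integrable one_le_two) hN]
  refine (meas_ge_le_variance_div_sq (memLp_sampleMean μ ha2) hδ).trans
    (ENNReal.ofReal_le_ofReal ?_)
  rw [variance_sampleMean μ ha ha2, div_div]
  gcongr

end SampleMean

section Labels

variable {Y : Type*} [MetricSpace Y] [MeasurableSpace Y]

/-- The distance matrices whose first `N` points carry labels in `Y` that depend on them in a
`1`-Lipschitz way and whose statistics, tested on the functions in `Φ`, are `δ`-close to `ν`. -/
def labelable (N : ℕ) (Φ : Finset C(Y, ℝ)) (ν : Measure Y) (δ : ℝ) : Set DistMatrix :=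
  {d | ∃ y : ℕ → Y, (∀ i < N, ∀ j < N, dist (y i) (y j) ≤ d.1 i j) ∧
    ∀ b ∈ Φ, |sampleMean N b y - ∫ t, b t ∂ν| ≤ δ}

theorem isClosed_labelable [CompactSpace Y] (N : ℕ) (Φ : Finset C(Y, ℝ)) (ν : Measure Y) (δ : ℝ) :
    IsClosed (labelable N Φ ν δ) := by
  let S : Set (DistMatrix × (ℕ → Y)) :=
    {p | (∀ i < N, ∀ j < N, dist (p.2 i) (p.2 j) ≤ p.1.1 i j) ∧
      ∀ b ∈ Φ, |sampleMean N b p.2 - ∫ t, b t ∂ν| ≤ δ}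
  have hS : IsClosed S := by
    simp only [S, sampleMean, Set.ofPred_and, Set.ofPred_forall]
    refine IsClosed.inter ?_ ?_
    · refine isClosed_iInter fun i => isClosed_iInter fun _ => isClosed_iInter fun j =>
        isClosed_iInter fun _ => isClosed_le (by fun_prop) ?_
      exact continuous_subtype_val.comp ((continuous_entry i j).comp continuous_fst)
    · exact isClosed_iInter fun b => isClosed_iInter fun _ =>
        isClosed_le (by fun_prop) continuous_const
  have himage : labelable N Φ ν δ = Prod.fst '' S := by
    ext d
    simp [labelable, S]
  rw [himage]
  exact isClosedMap_fst_of_compactSpace _ hS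

theorem mem_labelable_of_forall_upper {N : ℕ} {Φ : Finset C(Y, ℝ)} {ν : Measure Y} {δ : ℝ}
    {d : DistMatrix} {y : ℕ → Y} (hd : ∀ p : Upper, dist (y p.1.1) (y p.1.2) ≤ d.1 p.1.1 p.1.2)
    (hy : ∀ b ∈ Φ, |sampleMean N b y - ∫ t, b t ∂ν| ≤ δ) : d ∈ labelable N Φ ν δ := by
  refine ⟨y, fun i _ j _ => ?_, hy⟩
  rcases lt_trichotomy i j with hij | rfl | hij
  · exact hd ⟨(i, j), hij⟩
  · simp [d.2.2]
  · rw [d.2.1, dist_comm]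
    exact hd ⟨(j, i), hij⟩

namespace QMMSpace

theorem ae_lowerEnd_le_matrixLaw (X : QMMSpace) (x : ℕ → X.carrier) :
    ∀ᵐ d ∂X.matrixLaw x, ∀ p : Upper,
      lowerEnd (X.dStar (x p.1.1, x p.1.2)) ≤ d.1 p.1.1 p.1.2 := by
  refine ae_all_iff.2 fun p => ?_
  have hlaw : MeasurePreserving (fun d => upperEquiv d p) (X.matrixLaw x)
      (X.dStar (x p.1.1, x p.1.2)) :=
    (measurePreserving_eval_infinitePi _ p).comp
      ⟨upperEquiv.measurable, X.matrixLaw_map_upperEquiv x⟩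
  exact hlaw.quasiMeasurePreserving.ae (ae_lowerEnd_le _)

variable {X : QMMSpace} {f : X.carrier → Y}

theorem ae_dist_le_lowerEnd (hf : f ∈ X.Lip1 Y) :
    ∀ᵐ x ∂(Measure.infinitePi fun _ : ℕ => X.μ), ∀ p : Upper,
      dist (f (x p.1.1)) (f (x p.1.2)) ≤ lowerEnd (X.dStar (x p.1.1, x p.1.2)) := by
  refine ae_all_iff.2 fun p => ?_
  have hlaw : MeasurePreserving (fun x : ℕ → X.carrier => (x p.1.1, x p.1.2))
      (Measure.infinitePi fun _ : ℕ => X.μ) (X.μ.prod X.μ) :=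
    ⟨by fun_prop, Measure.infinitePi_map_eval_prod p.2.ne⟩
  exact hlaw.quasiMeasurePreserving.ae hf.2

variable [BorelSpace Y]

/-- Labelling each sampled point by its image under a `1`-Lipschitz map fails only when one of the
sample means deviates. -/
theorem ae_matrixLaw_labelable_compl_le (hf : f ∈ X.Lip1 Y) {Φ : Finset C(Y, ℝ)} {ν : Measure Y}
    (N : ℕ) {δ : ℝ} (hν : ∀ b ∈ Φ, |∫ t, b t ∂(X.μ.map f) - ∫ t, b t ∂ν| ≤ δ / 2) :
    ∀ᵐ x ∂(Measure.infinitePi fun _ : ℕ => X.μ), X.matrixLaw x (labelable N Φ ν δ)ᶜ ≤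
      (⋃ b ∈ Φ, {x | δ / 2 ≤ |sampleMean N (b ∘ f) x - ∫ t, b (f t) ∂X.μ|}).indicator 1 x := by
  filter_upwards [ae_dist_le_lowerEnd hf] with x hx
  refine Set.le_indicator_apply (fun _ => prob_le_one) fun hxB => ?_
  simp only [Set.mem_iUnion, Set.mem_ofPred_eq, not_exists, not_le] at hxB
  refine (le_of_eq ?_ : _ ≤ (0 : ℝ≥0∞))
  filter_upwards [X.ae_lowerEnd_le_matrixLaw x] with d hd
  refine mem_labelable_of_forall_upper (y := f ∘ x) (fun p => (hx p).trans (hd p)) fun b hb => ?_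
  have hfb := hν b hb
  rw [integral_map hf.1.aemeasurable b.continuous.aestronglyMeasurable] at hfb
  calc |sampleMean N b (f ∘ x) - ∫ t, b t ∂ν|
      ≤ |sampleMean N (b ∘ f) x - ∫ t, b (f t) ∂X.μ| + |∫ t, b (f t) ∂X.μ - ∫ t, b t ∂ν| :=
        abs_sub_le _ _ _
    _ ≤ δ := by linarith [hxB b hb]

theorem sampling_labelable_compl_le [CompactSpace Y] (hf : f ∈ X.Lip1 Y) {Φ : Finset C(Y, ℝ)}
    {ν : Measure Y} {N : ℕ} (hN : N ≠ 0) {δ : ℝ} (hδ : 0 < δ)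
    (hν : ∀ b ∈ Φ, |∫ t, b t ∂(X.μ.map f) - ∫ t, b t ∂ν| ≤ δ / 2) :
    (X.sampling : Measure DistMatrix) (labelable N Φ ν δ)ᶜ ≤
      ∑ b ∈ Φ, ENNReal.ofReal (‖b‖ ^ 2 / (N * (δ / 2) ^ 2)) := by
  have hbf (b : C(Y, ℝ)) : Measurable (b ∘ f) := b.continuous.measurable.comp hf.1
  have hmeas : MeasurableSet
      (⋃ b ∈ Φ, {x | δ / 2 ≤ |sampleMean N (b ∘ f) x - ∫ t, b (f t) ∂X.μ|}) := by
    refine Finset.measurableSet_biUnion _ fun b _ => measurableSet_le measurable_const ?_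
    have : Measurable (sampleMean N (b ∘ f)) := by
      have (i : ℕ) := (hbf b).comp (measurable_pi_apply (X := fun _ : ℕ => X.carrier) i)
      exact (Finset.measurable_sum _ fun i _ => this i).div_const _
    fun_prop
  rw [X.sampling_apply (isClosed_labelable N Φ ν δ).measurableSet.compl]
  refine (lintegral_mono_ae (ae_matrixLaw_labelable_compl_le hf N hν)).trans ?_
  rw [lintegral_indicator_one hmeas]
  refine (measure_biUnion_finset_le _ _).trans (Finset.sum_le_sum fun b _ => ?_)
  exact measure_le_abs_sampleMean_sub_integral_le X.μ (hbf b) (fun t => b.norm_coe_le_norm _) hN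
    (by positivity)

end QMMSpace

theorem measure_labelable_compl_le_of_tendsto [CompactSpace Y] [BorelSpace Y] {ι : Type*}
    {L : Filter ι} [L.NeBot] {X : ι → QMMSpace} {f : ∀ i, (X i).carrier → Y}
    (hf : ∀ i, f i ∈ (X i).Lip1 Y) {ζ : ProbabilityMeasure DistMatrix}
    (hX : Tendsto (fun i => (X i).sampling) L (𝓝 ζ)) {ν : Measure Y}
    (hν : ∀ b : C(Y, ℝ), Tendsto (fun i => ∫ t, b t ∂((X i).μ.map (f i))) L (𝓝 (∫ t, b t ∂ν)))
    (Φ : Finset C(Y, ℝ)) {N : ℕ} (hN : N ≠ 0) {δ : ℝ} (hδ : 0 < δ) :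
    (ζ : Measure DistMatrix) (labelable N Φ ν δ)ᶜ ≤
      ∑ b ∈ Φ, ENNReal.ofReal (‖b‖ ^ 2 / (N * (δ / 2) ^ 2)) := by
  refine (ProbabilityMeasure.le_liminf_measure_open_of_tendsto hX
    (isClosed_labelable N Φ ν δ).isOpen_compl).trans ?_
  have hclose : ∀ᶠ i in L, ∀ b ∈ Φ,
      |∫ t, b t ∂((X i).μ.map (f i)) - ∫ t, b t ∂ν| ≤ δ / 2 :=
    (Filter.eventually_all_finset _).2 fun b _ =>
      (hν b).eventually (Metric.closedBall_mem_nhds _ (half_pos hδ))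
  exact liminf_le_of_frequently_le
    (hclose.mono fun i hi => QMMSpace.sampling_labelable_compl_le (hf i) hN hδ hi).frequently

end Labels

section Excess

variable (Y : Type*) [MetricSpace Y]

/-- The excess `(dist y y' - l)⁺` of a distance in `Y` over a length `l`, as a continuous function
of `(y, y')` depending continuously on `l`. -/
def excessMap : C(I, C(Y × Y, ℝ)) :=
  ContinuousMap.curry ⟨fun p : I × (Y × Y) => max (dist p.2.1 p.2.2 - (p.1 : ℝ)) 0, by fun_prop⟩

variable {Y} [CompactSpace Y]

theorem integrable_excessMap (m : Measure I) [IsFiniteMeasure m] :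
    Integrable (fun l => excessMap Y l) m :=
  (excessMap Y).continuous.integrable_of_hasCompactSupport (.of_compactSpace _)

namespace QMMSpace

variable (X : QMMSpace)

/-- The mean excess of the distances in `Y` over the random length `d*(p)`. -/
def excess (p : X.carrier × X.carrier) : C(Y × Y, ℝ) :=
  ∫ l, excessMap Y l ∂(X.dStar p)

theorem excess_apply (p : X.carrier × X.carrier) (q : Y × Y) :
    X.excess p q = ∫ l : I, max (dist q.1 q.2 - (l : ℝ)) 0 ∂(X.dStar p) := by
  have := (ContinuousMap.evalCLM ℝ q).integral_comp_comm
    (integrable_excessMap (Y := Y) (X.dStar p))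
  exact this.symm

theorem excess_comm (x x' : X.carrier) (y y' : Y) :
    X.excess (x, x') (y, y') = X.excess (x', x) (y', y) := by
  simp only [excess_apply, X.dStar_comm x x', dist_comm y y']

theorem excess_nonneg (p : X.carrier × X.carrier) (q : Y × Y) : 0 ≤ X.excess p q := by
  rw [excess_apply]
  exact integral_nonneg fun l => le_max_right _ _

theorem excess_le (p : X.carrier × X.carrier) {q : Y × Y} {t η R : ℝ} (hη : 0 ≤ η)
    (hR : dist q.1 q.2 ≤ R) (ht : dist q.1 q.2 ≤ t + η) :
    X.excess p q ≤ η + R * (X.dStar p).real {l : I | (l : ℝ) < t} := by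
  have hm : MeasurableSet {l : I | (l : ℝ) < t} :=
    measurableSet_lt measurable_subtype_coe measurable_const
  have hR0 : 0 ≤ R := dist_nonneg.trans hR
  rw [excess_apply]
  calc ∫ l : I, max (dist q.1 q.2 - (l : ℝ)) 0 ∂(X.dStar p)
      ≤ ∫ l : I, (η + {l : I | (l : ℝ) < t}.indicator (fun _ => R) l) ∂(X.dStar p) := by
        refine integral_mono ?_ ((integrable_const _).add ((integrable_const _).indicator hm))
          fun l => ?_
        · exact (by fun_prop : Continuous fun l : I =>
            max (dist q.1 q.2 - (l : ℝ)) 0).integrable_of_hasCompactSupport (.of_compactSpace _)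
        · have hl := l.2.1
          simp only [Set.indicator_apply, Set.mem_ofPred_eq]
          split_ifs with h <;> exact max_le (by linarith) (by linarith)
    _ = η + R * (X.dStar p).real {l : I | (l : ℝ) < t} := by
        rw [integral_add (integrable_const _) ((integrable_const _).indicator hm),
          integral_indicator_const _ hm]
        simp [mul_comm]

end QMMSpace

end Excess

section UpperBlock

/-- The positions above the diagonal in the upper left `N × N` block. -/
def upperBlock (N : ℕ) : Finset Upper :=
  (Finset.range N ×ˢ Finset.range N).subtype fun p => p.1 < p.2

theorem mem_upperBlock {N : ℕ} {p : Upper} : p ∈ upperBlock N ↔ p.1.2 < N := by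
  have := p.2
  simp only [upperBlock, Finset.mem_subtype, Finset.mem_product, Finset.mem_range]
  omega

theorem card_upperBlock_le (N : ℕ) : (upperBlock N).card ≤ N ^ 2 := by
  rw [upperBlock, Finset.card_subtype]
  exact (Finset.card_filter_le _ _).trans (by simp [sq])

theorem sum_offDiag_range {M : Type*} [NonAssocSemiring M] (N : ℕ) {F : ℕ × ℕ → M}
    (hF : ∀ p, F p.swap = F p) :
    ∑ p ∈ (Finset.range N).offDiag, F p = 2 * ∑ p ∈ upperBlock N, F p.1 := by
  set s := Finset.range N ×ˢ Finset.range N with hs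
  have hupper : ∑ p ∈ upperBlock N, F p.1 = ∑ p ∈ s with p.1 < p.2, F p := by
    rw [upperBlock, Finset.sum_subtype_eq_sum_filter]
  have hlower : ∑ p ∈ s with p.2 < p.1, F p = ∑ p ∈ s with p.1 < p.2, F p :=
    Finset.sum_equiv (Equiv.prodComm ℕ ℕ) (by simp [hs, and_comm]) fun p _ => (hF p).symm
  have hunion : (Finset.range N).offDiag = {p ∈ s | p.1 < p.2} ∪ {p ∈ s | p.2 < p.1} := by
    ext p
    simp only [hs, Finset.mem_offDiag, Finset.mem_union, Finset.mem_filter, Finset.mem_product,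
      ne_iff_lt_or_gt]
    tauto
  rw [hunion, Finset.sum_union, hupper, hlower, two_mul]
  exact Finset.disjoint_filter.2 fun p _ h => by omega

end UpperBlock

namespace QMMSpace

variable (X : QMMSpace)

section Thresholds

theorem matrixLaw_cylinder (x : ℕ → X.carrier) (P : Finset Upper) {S : Upper → Set I}
    (hS : ∀ p, MeasurableSet (S p)) :
    X.matrixLaw x {d | ∀ p ∈ P, upperEquiv d p ∈ S p} =
      ∏ p ∈ P, X.dStar (x p.1.1, x p.1.2) (S p) := by
  have hpi := Measure.infinitePi_pi (fun p : Upper => X.dStar (x p.1.1, x p.1.2)) (s := P)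
    (t := S) fun p _ => hS p
  rw [← hpi, ← matrixLaw_map_upperEquiv, upperEquiv.map_apply]
  rfl

/-- The expected number of positions `p ∈ P` at which the random matrix over the points `x` is
below the threshold `t p`. -/
def expectedUndershoots (x : ℕ → X.carrier) (P : Finset Upper) (t : Upper → ℝ) : ℝ :=
  ∑ p ∈ P, (X.dStar (x p.1.1, x p.1.2)).real {l : I | (l : ℝ) < t p}

theorem matrixLaw_forall_ge_le (x : ℕ → X.carrier) (P : Finset Upper) (t : Upper → ℝ) :
    X.matrixLaw x {d | ∀ p ∈ P, t p ≤ d.1 p.1.1 p.1.2} ≤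
      ENNReal.ofReal (Real.exp (-X.expectedUndershoots x P t)) := by
  have hge (p : Upper) : X.dStar (x p.1.1, x p.1.2) {l : I | t p ≤ (l : ℝ)} ≤
      ENNReal.ofReal (Real.exp (-(X.dStar (x p.1.1, x p.1.2)).real {l : I | (l : ℝ) < t p})) := by
    have hcompl : {l : I | t p ≤ (l : ℝ)} = {l : I | (l : ℝ) < t p}ᶜ := by
      ext l
      simp
    rw [hcompl, ← ofReal_measureReal,
      probReal_compl_eq_one_sub (measurableSet_lt measurable_subtype_coe measurable_const)]
    exact ENNReal.ofReal_le_ofReal (Real.one_sub_le_exp_neg _)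
  calc X.matrixLaw x {d | ∀ p ∈ P, t p ≤ d.1 p.1.1 p.1.2}
      = ∏ p ∈ P, X.dStar (x p.1.1, x p.1.2) {l : I | t p ≤ (l : ℝ)} :=
        X.matrixLaw_cylinder x P fun p => measurableSet_le measurable_const measurable_subtype_coe
    _ ≤ ∏ p ∈ P, ENNReal.ofReal
          (Real.exp (-(X.dStar (x p.1.1, x p.1.2)).real {l : I | (l : ℝ) < t p})) :=
        Finset.prod_le_prod' fun p _ => hge p
    _ = _ := by
        rw [← ENNReal.ofReal_prod_of_nonneg fun _ _ => (Real.exp_pos _).le, ← Real.exp_sum,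
          Finset.sum_neg_distrib, expectedUndershoots]

theorem matrixLaw_exists_forall_ge_le {ι : Type*} [Fintype ι] (x : ℕ → X.carrier) (P : Finset Upper)
    (t : ι → Upper → ℝ) (s : ℝ) :
    X.matrixLaw x {d | ∃ i, s ≤ X.expectedUndershoots x P (t i) ∧
        ∀ p ∈ P, t i p ≤ d.1 p.1.1 p.1.2} ≤
      Fintype.card ι * ENNReal.ofReal (Real.exp (-s)) := by
  have hle (i : ι) : X.matrixLaw x {d | s ≤ X.expectedUndershoots x P (t i) ∧
      ∀ p ∈ P, t i p ≤ d.1 p.1.1 p.1.2} ≤ ENNReal.ofReal (Real.exp (-s)) := by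
    by_cases hi : s ≤ X.expectedUndershoots x P (t i)
    · exact (measure_mono fun d hd => hd.2).trans <| (X.matrixLaw_forall_ge_le x P (t i)).trans
        (ENNReal.ofReal_le_ofReal (Real.exp_le_exp.2 (neg_le_neg hi)))
    · simp [hi]
  rw [Set.ofPred_exists]
  refine (measure_iUnion_fintype_le _ _).trans ((Finset.sum_le_sum fun i _ => hle i).trans ?_)
  simp

/-- A labelling `a : ℕ → A` enters only through its first `N` values, so that the union bound
involves `|A| ^ N` labellings. -/
theorem matrixLaw_exists_labelling_le {A : Type*} [Fintype A] (x : ℕ → X.carrier) {N : ℕ}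
    (hN : N ≠ 0) (t : A → A → ℝ) (s : ℝ) :
    X.matrixLaw x {d | ∃ a : ℕ → A,
        s ≤ X.expectedUndershoots x (upperBlock N) (fun p => t (a p.1.1) (a p.1.2)) ∧
        ∀ p ∈ upperBlock N, t (a p.1.1) (a p.1.2) ≤ d.1 p.1.1 p.1.2} ≤
      (Fintype.card A : ℝ≥0∞) ^ N * ENNReal.ofReal (Real.exp (-s)) := by
  classical
  have : NeZero N := ⟨hN⟩
  let T (b : Fin N → A) (p : Upper) : ℝ := t (b (Fin.ofNat N p.1.1)) (b (Fin.ofNat N p.1.2))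
  have hT (a : ℕ → A) : ∀ p ∈ upperBlock N, T (fun i => a i) p = t (a p.1.1) (a p.1.2) := by
    intro p hp
    have hp2 := mem_upperBlock.1 hp
    simp [T, Nat.mod_eq_of_lt hp2, Nat.mod_eq_of_lt (lt_trans p.2 hp2)]
  refine (measure_mono ?_).trans ((X.matrixLaw_exists_forall_ge_le x (upperBlock N) T s).trans
    (by simp))
  rintro d ⟨a, ha, had⟩
  refine ⟨fun i => a i, ha.trans_eq (Finset.sum_congr rfl fun p hp => ?_), fun p hp => ?_⟩
  · rw [hT a p hp]
  · rw [hT a p hp]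
    exact had p hp

end Thresholds

end QMMSpace

theorem eventually_pow_mul_exp_lt (K : ℕ) {δ : ℝ} (hδ : 0 < δ) :
    ∀ᶠ N : ℕ in atTop,
      (K : ℝ≥0∞) ^ N * ENNReal.ofReal (Real.exp (-(δ * N ^ 2))) < 1 / 2 := by
  have hexp : Tendsto (fun N : ℕ => Real.exp (δ * N - 1)) atTop atTop :=
    Real.tendsto_exp_atTop.comp (tendsto_atTop_add_const_right _ _
      (tendsto_natCast_atTop_atTop.const_mul_atTop hδ))
  filter_upwards [hexp.eventually_ge_atTop (K : ℝ), eventually_ge_atTop 1] with N hN hN1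
  have hhalf : (1 / 2 : ℝ≥0∞) = ENNReal.ofReal (1 / 2) := by
    rw [ENNReal.ofReal_div_of_pos (by norm_num)]
    simp
  rw [hhalf, ← ENNReal.ofReal_natCast, ← ENNReal.ofReal_pow (by positivity),
    ← ENNReal.ofReal_mul (by positivity), ENNReal.ofReal_lt_ofReal_iff (by norm_num)]
  calc (K : ℝ) ^ N * Real.exp (-(δ * N ^ 2))
      ≤ Real.exp (δ * N - 1) ^ N * Real.exp (-(δ * N ^ 2)) := by gcongr
    _ = Real.exp (-N) := by
        rw [← Real.exp_nat_mul, ← Real.exp_add]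
        ring_nf
    _ ≤ Real.exp (-1) := Real.exp_le_exp.2 (neg_le_neg (by exact_mod_cast hN1))
    _ < 1 / 2 := by
        rw [Real.exp_neg, one_div]
        exact inv_strictAnti₀ (by norm_num) (by linarith [Real.exp_one_gt_d9])

theorem eventually_sum_ofReal_div_lt {α : Type*} (S : Finset α) (C : α → ℝ) {c : ℝ} (hc : 0 < c)
    {ε : ℝ≥0∞} (hε : 0 < ε) :
    ∀ᶠ N : ℕ in atTop, ∑ a ∈ S, ENNReal.ofReal (C a / (N * c)) < ε := by
  have hlim : Tendsto (fun N : ℕ => ∑ a ∈ S, ENNReal.ofReal (C a / (N * c))) atTop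
      (𝓝 (∑ _a ∈ S, ENNReal.ofReal 0)) :=
    tendsto_finsetSum _ fun a _ => ENNReal.tendsto_ofReal
      (Tendsto.const_div_atTop (tendsto_natCast_atTop_atTop.atTop_mul_const hc) _)
  exact hlim.eventually_lt_const (by simpa using hε)

theorem exists_finite_net (Y : Type*) [PseudoMetricSpace Y] [CompactSpace Y] {ε : ℝ} (hε : 0 < ε) :
    ∃ (S : Finset Y) (q : Y → S), ∀ y : Y, dist y (q y : Y) < ε := by
  obtain ⟨s, -, hs, hcover⟩ := (isCompact_univ (X := Y)).finite_cover_balls hε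
  have hnear (y : Y) : ∃ c : hs.toFinset, dist y (c : Y) < ε := by
    simpa using hcover (Set.mem_univ y)
  choose q hq using hnear
  exact ⟨hs.toFinset, q, hq⟩

theorem lintegral_sum_offDiag_le {Ω : Type*} [MeasurableSpace Ω] (μ : Measure Ω)
    [IsProbabilityMeasure μ] {v : Ω × Ω → ℝ≥0∞} (hv : Measurable v) (N : ℕ) :
    ∫⁻ x, ∑ p ∈ (Finset.range N).offDiag, v (x p.1, x p.2) ∂(Measure.infinitePi fun _ : ℕ => μ) ≤
      (N : ℝ≥0∞) ^ 2 * ∫⁻ z, v z ∂(μ.prod μ) := by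
  have hpair : ∀ p ∈ (Finset.range N).offDiag,
      ∫⁻ x, v (x p.1, x p.2) ∂(Measure.infinitePi fun _ : ℕ => μ) = ∫⁻ z, v z ∂(μ.prod μ) := by
    intro p hp
    rw [← Measure.infinitePi_map_eval_prod (P := fun _ : ℕ => μ) (Finset.mem_offDiag.1 hp).2.2,
      lintegral_map hv (by fun_prop)]
  have hm (p : ℕ × ℕ) : Measurable fun x : ℕ → Ω => v (x p.1, x p.2) := hv.comp (by fun_prop)
  have hcard : (Finset.range N).offDiag.card ≤ N ^ 2 := by
    rw [Finset.offDiag_card, Finset.card_range, sq]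
    exact Nat.sub_le _ _
  rw [lintegral_finsetSum _ fun p _ => hm p, Finset.sum_congr rfl hpair, Finset.sum_const,
    nsmul_eq_mul]
  gcongr
  exact_mod_cast hcard

theorem measure_exists_le_two_pow_mul_sum_offDiag_le {Ω : Type*} [MeasurableSpace Ω]
    (μ : Measure Ω) [IsProbabilityMeasure μ] {v : ℕ → Ω × Ω → ℝ≥0∞} (hv : ∀ j, Measurable (v j))
    {N : ℕ} (hN : N ≠ 0) :
    (Measure.infinitePi fun _ : ℕ => μ) {x | ∃ j,
        (N : ℝ≥0∞) ^ 2 ≤ 2 ^ j * ∑ p ∈ (Finset.range N).offDiag, v j (x p.1, x p.2)} ≤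
      ∑' j, 2 ^ j * ∫⁻ z, v j z ∂(μ.prod μ) := by
  rw [Set.ofPred_exists]
  refine (measure_iUnion_le _).trans (ENNReal.tsum_le_tsum fun j => ?_)
  have hm : Measurable fun x : ℕ → Ω =>
      2 ^ j * ∑ p ∈ (Finset.range N).offDiag, v j (x p.1, x p.2) :=
    (Finset.measurable_sum _ fun p _ => (hv j).comp (by fun_prop)).const_mul _
  have hmarkov := mul_meas_ge_le_lintegral (μ := Measure.infinitePi fun _ : ℕ => μ) hm
    ((N : ℝ≥0∞) ^ 2)
  rw [lintegral_const_mul' _ _ (by finiteness)] at hmarkov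
  replace hmarkov := hmarkov.trans (mul_le_mul_right (lintegral_sum_offDiag_le μ (hv j) N) (2 ^ j))
  rw [mul_left_comm] at hmarkov
  exact (ENNReal.mul_le_mul_iff_right (by simpa using hN) (by finiteness)).1 hmarkov

namespace QMMSpace

variable (X : QMMSpace)

theorem measure_half_le_matrixLaw_le {S : Set DistMatrix} (hS : MeasurableSet S) :
    (Measure.infinitePi fun _ : ℕ => X.μ) {x | 1 / 2 ≤ X.matrixLaw x S} ≤
      2 * (X.sampling : Measure DistMatrix) S := by
  have hmarkov := meas_ge_le_lintegral_div (μ := Measure.infinitePi fun _ : ℕ => X.μ)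
    (X.measurable_matrixLaw_apply hS).aemeasurable (ε := 1 / 2) (by simp) (by simp)
  rw [← X.sampling_apply hS] at hmarkov
  simpa [div_eq_mul_inv, mul_comm] using hmarkov

/-- The three ways for the points `x` to be bad have probabilities at most `1/4`, `1/8`, `1/4`. -/
theorem eventually_exists_points {S : ℕ → Set DistMatrix} (hS : ∀ N, MeasurableSet (S N))
    (hSlim : ∀ᶠ N in atTop, (X.sampling : Measure DistMatrix) (S N) ≤ 1 / 8)
    {α : Type*} (A : Finset α) {φ : α → X.carrier → ℝ} (hφ : ∀ a, Measurable (φ a))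
    {C : α → ℝ} (hC : ∀ a x, |φ a x| ≤ C a) {δ : ℝ} (hδ : 0 < δ)
    {v : ℕ → X.carrier × X.carrier → ℝ≥0∞} (hv : ∀ j, Measurable (v j))
    (hv1 : ∑' j, 2 ^ j * ∫⁻ z, v j z ∂(X.μ.prod X.μ) ≤ 1 / 4) :
    ∀ᶠ N : ℕ in atTop, ∃ x : ℕ → X.carrier, X.matrixLaw x (S N) < 1 / 2 ∧
      (∀ a ∈ A, |sampleMean N (φ a) x - ∫ t, φ a t ∂X.μ| ≤ δ) ∧
      ∀ j, 2 ^ j * ∑ p ∈ (Finset.range N).offDiag, v j (x p.1, x p.2) ≤ (N : ℝ≥0∞) ^ 2 := by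
  filter_upwards [hSlim, eventually_sum_ofReal_div_lt A (fun a => C a ^ 2) (c := δ ^ 2)
    (by positivity) (ε := 1 / 8) (by simp), eventually_ne_atTop 0] with N hSN hAN hN
  set P := Measure.infinitePi fun _ : ℕ => X.μ
  set B₁ : Set (ℕ → X.carrier) := {x | 1 / 2 ≤ X.matrixLaw x (S N)}
  set B₂ : Set (ℕ → X.carrier) :=
    ⋃ a ∈ A, {x | δ ≤ |sampleMean N (φ a) x - ∫ t, φ a t ∂X.μ|}
  set B₃ : Set (ℕ → X.carrier) := {x | ∃ j,
    (N : ℝ≥0∞) ^ 2 ≤ 2 ^ j * ∑ p ∈ (Finset.range N).offDiag, v j (x p.1, x p.2)}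
  have hB₁ : P B₁ ≤ 2 * (1 / 8) := (X.measure_half_le_matrixLaw_le (hS N)).trans (by gcongr)
  have hB₂ : P B₂ ≤ 1 / 8 := (measure_biUnion_finset_le _ _).trans <| (Finset.sum_le_sum
    fun a _ => measure_le_abs_sampleMean_sub_integral_le X.μ (hφ a) (hC a) hN hδ).trans hAN.le
  have hB₃ : P B₃ ≤ 1 / 4 := (measure_exists_le_two_pow_mul_sum_offDiag_le X.μ hv hN).trans hv1
  have hbad : P (B₁ ∪ (B₂ ∪ B₃)) < P Set.univ := by
    refine ((measure_union_le _ _).trans (add_le_add hB₁ ((measure_union_le _ _).trans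
      (add_le_add hB₂ hB₃)))).trans_lt ?_
    rw [measure_univ, ← ENNReal.toReal_lt_toReal (by finiteness) (by finiteness),
      ENNReal.toReal_add (by finiteness) (by finiteness),
      ENNReal.toReal_add (by finiteness) (by finiteness)]
    norm_num
  obtain ⟨x, hx⟩ := (Set.ne_univ_iff_exists_notMem _).1 fun h => hbad.ne (congrArg P h)
  simp only [B₁, B₂, B₃, Set.mem_union, Set.mem_iUnion, Set.mem_ofPred_eq, not_or, not_exists,
    not_le] at hx
  exact ⟨x, hx.1, fun a ha => (hx.2.1 a ha).le, fun j => (hx.2.2 j).le⟩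

variable {Y : Type*} [MetricSpace Y] [CompactSpace Y]

theorem sum_offDiag_excess_le {x : ℕ → X.carrier} {y : ℕ → Y} {N : ℕ} {q : Y → Y} {δ : ℝ}
    (hδ : 0 < δ) (hq : ∀ u, dist u (q u) < δ / 16)
    (hx : X.expectedUndershoots x (upperBlock N)
        (fun p => dist (q (y p.1.1)) (q (y p.1.2)) - δ / 8) ≤
      δ / (4 * (Metric.diam (Set.univ : Set Y) + 1)) * N ^ 2) :
    ∑ p ∈ (Finset.range N).offDiag, X.excess (x p.1, x p.2) (y p.1, y p.2) ≤ δ * N ^ 2 := by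
  set R := Metric.diam (Set.univ : Set Y)
  have hR : 0 ≤ R := Metric.diam_nonneg
  have hle (p : Upper) : X.excess (x p.1.1, x p.1.2) (y p.1.1, y p.1.2) ≤
      δ / 4 + R * (X.dStar (x p.1.1, x p.1.2)).real
        {l : I | (l : ℝ) < dist (q (y p.1.1)) (q (y p.1.2)) - δ / 8} := by
    refine X.excess_le _ (by positivity) (Metric.dist_le_diam_of_mem isCompact_univ.isBounded
      (Set.mem_univ _) (Set.mem_univ _)) ?_
    have htri := dist_triangle4_right (y p.1.1) (y p.1.2) (q (y p.1.1)) (q (y p.1.2))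
    linarith [hq (y p.1.1), hq (y p.1.2)]
  have hcard : ((upperBlock N).card : ℝ) ≤ N ^ 2 := by exact_mod_cast card_upperBlock_le N
  calc ∑ p ∈ (Finset.range N).offDiag, X.excess (x p.1, x p.2) (y p.1, y p.2)
      = 2 * ∑ p ∈ upperBlock N, X.excess (x p.1.1, x p.1.2) (y p.1.1, y p.1.2) :=
        sum_offDiag_range N fun p => X.excess_comm _ _ _ _
    _ ≤ 2 * ((upperBlock N).card * (δ / 4) + R * X.expectedUndershoots x (upperBlock N)
          fun p => dist (q (y p.1.1)) (q (y p.1.2)) - δ / 8) := by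
        gcongr
        refine (Finset.sum_le_sum fun p _ => hle p).trans_eq ?_
        rw [Finset.sum_add_distrib, Finset.sum_const, nsmul_eq_mul, ← Finset.mul_sum]
        rfl
    _ ≤ 2 * (N ^ 2 * (δ / 4) + (R + 1) * (δ / (4 * (R + 1)) * N ^ 2)) := by
        gcongr
        · exact Finset.sum_nonneg fun _ _ => measureReal_nonneg
        · linarith
    _ = δ * N ^ 2 := by
        field_simp
        ring

/-- The excess of a labelling is small because the labelling stays a labelling, up to `δ / 8`, when
its values are moved to the finite net. -/
theorem exists_labelling_of_matrixLaw_labelable_compl_lt [MeasurableSpace Y] {ν : Measure Y}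
    {Φ : Finset C(Y, ℝ)} {δ : ℝ} (hδ : 0 < δ) {A : Finset Y} {q : Y → A}
    (hq : ∀ u, dist u (q u : Y) < δ / 16) {N : ℕ} (hN : N ≠ 0)
    (hAN : (Fintype.card A : ℝ≥0∞) ^ N * ENNReal.ofReal
      (Real.exp (-(δ / (4 * (Metric.diam (Set.univ : Set Y) + 1)) * N ^ 2))) < 1 / 2)
    {x : ℕ → X.carrier} (hx : X.matrixLaw x (labelable N Φ ν δ)ᶜ < 1 / 2) :
    ∃ y : ℕ → Y, (∀ b ∈ Φ, |sampleMean N b y - ∫ t, b t ∂ν| ≤ δ) ∧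
      ∑ p ∈ (Finset.range N).offDiag, X.excess (x p.1, x p.2) (y p.1, y p.2) ≤ δ * N ^ 2 := by
  set s := δ / (4 * (Metric.diam (Set.univ : Set Y) + 1)) * N ^ 2
  let t (c c' : A) : ℝ := dist (c : Y) c' - δ / 8
  let B : Set DistMatrix := {d | ∃ a : ℕ → A,
    s ≤ X.expectedUndershoots x (upperBlock N) (fun p => t (a p.1.1) (a p.1.2)) ∧
    ∀ p ∈ upperBlock N, t (a p.1.1) (a p.1.2) ≤ d.1 p.1.1 p.1.2}
  have hB : X.matrixLaw x B < 1 / 2 := (X.matrixLaw_exists_labelling_le x hN t s).trans_lt hAN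
  have hbad : X.matrixLaw x ((labelable N Φ ν δ)ᶜ ∪ B) < X.matrixLaw x Set.univ := by
    rw [measure_univ, ← ENNReal.add_halves 1]
    exact (measure_union_le _ _).trans_lt (ENNReal.add_lt_add hx hB)
  obtain ⟨d, hd⟩ :=
    (Set.ne_univ_iff_exists_notMem _).1 fun h => hbad.ne (congrArg (X.matrixLaw x) h)
  simp only [Set.mem_union, not_or, Set.mem_compl_iff, not_not] at hd
  obtain ⟨⟨y, hyd, hyν⟩, hdB⟩ := hd
  refine ⟨y, hyν, X.sum_offDiag_excess_le hδ hq (not_lt.1 fun hlt => hdB ?_)⟩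
  refine ⟨fun i => q (y i), hlt.le, fun p hp => ?_⟩
  have hp2 := mem_upperBlock.1 hp
  have htri := dist_triangle4_left (y p.1.1) (y p.1.2) (q (y p.1.1) : Y) (q (y p.1.2))
  simp only [t]
  linarith [hq (y p.1.1), hq (y p.1.2), hyd p.1.1 (lt_trans p.2 hp2) p.1.2 hp2]

theorem eventually_exists_labelled_sample [MeasurableSpace Y] {ν : Measure Y}
    (Φ : Finset C(Y, ℝ)) {δ : ℝ} (hδ : 0 < δ) (hlab : ∀ N : ℕ, N ≠ 0 →
      (X.sampling : Measure DistMatrix) (labelable N Φ ν δ)ᶜ ≤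
        ∑ b ∈ Φ, ENNReal.ofReal (‖b‖ ^ 2 / (N * (δ / 2) ^ 2)))
    {α : Type*} (A : Finset α) {φ : α → X.carrier → ℝ} (hφ : ∀ a, Measurable (φ a))
    {C : α → ℝ} (hC : ∀ a x, |φ a x| ≤ C a)
    {v : ℕ → X.carrier × X.carrier → ℝ≥0∞} (hv : ∀ j, Measurable (v j))
    (hv1 : ∑' j, 2 ^ j * ∫⁻ z, v j z ∂(X.μ.prod X.μ) ≤ 1 / 4) :
    ∀ᶠ N : ℕ in atTop, ∃ (x : ℕ → X.carrier) (y : ℕ → Y),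
      (∀ a ∈ A, |sampleMean N (φ a) x - ∫ t, φ a t ∂X.μ| ≤ δ) ∧
      (∀ b ∈ Φ, |sampleMean N b y - ∫ t, b t ∂ν| ≤ δ) ∧
      (∀ j, 2 ^ j * ∑ p ∈ (Finset.range N).offDiag, v j (x p.1, x p.2) ≤ (N : ℝ≥0∞) ^ 2) ∧
      ∑ p ∈ (Finset.range N).offDiag, X.excess (x p.1, x p.2) (y p.1, y p.2) ≤ δ * N ^ 2 := by
  obtain ⟨T, q, hq⟩ := exists_finite_net Y (ε := δ / 16) (by positivity)
  have hsampling : ∀ᶠ N in atTop,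
      (X.sampling : Measure DistMatrix) (labelable N Φ ν δ)ᶜ ≤ 1 / 8 := by
    filter_upwards [eventually_ne_atTop 0, eventually_sum_ofReal_div_lt Φ (fun b => ‖b‖ ^ 2)
      (c := (δ / 2) ^ 2) (by positivity) (ε := 1 / 8) (by simp)] with N hN hΦN
    exact (hlab N hN).trans hΦN.le
  filter_upwards [eventually_ne_atTop 0, eventually_pow_mul_exp_lt (Fintype.card T)
      (δ := δ / (4 * (Metric.diam (Set.univ : Set Y) + 1))) (by positivity),
    X.eventually_exists_points (fun N => (isClosed_labelable N Φ ν δ).measurableSet.compl)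
      hsampling A hφ hC hδ hv hv1] with N hN hTN ⟨x, hxlab, hxφ, hxv⟩
  obtain ⟨y, hyν, hy⟩ := X.exists_labelling_of_matrixLaw_labelable_compl_lt hδ hq hN hTN hxlab
  exact ⟨x, y, hxφ, hyν, hxv, hy⟩

end QMMSpace

/-! ### Couplings without excess -/

section Empirical

variable {Z : Type*} [MeasurableSpace Z] {N : ℕ}

/-- The empirical measure of the first `N` points of a sequence. -/
def empirical (N : ℕ) (z : ℕ → Z) : Measure Z :=
  (N : ℝ≥0∞)⁻¹ • ∑ i ∈ Finset.range N, Measure.dirac (z i)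

theorem isProbabilityMeasure_empirical (hN : N ≠ 0) (z : ℕ → Z) :
    IsProbabilityMeasure (empirical N z) := by
  constructor
  simp only [empirical, Measure.smul_apply, Measure.coe_finsetSum, Finset.sum_apply,
    measure_univ, Finset.sum_const, Finset.card_range, nsmul_eq_mul, mul_one, smul_eq_mul]
  exact ENNReal.inv_mul_cancel (by exact_mod_cast hN) (ENNReal.natCast_ne_top N)

theorem integral_empirical (N : ℕ) (z : ℕ → Z) {f : Z → ℝ} (hf : StronglyMeasurable f) :
    ∫ t, f t ∂(empirical N z) = sampleMean N f z := by
  rw [empirical, integral_smul_measure, integral_finsetSum_measure]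
  · simp only [integral_dirac' _ _ hf, ENNReal.toReal_inv, ENNReal.toReal_natCast, smul_eq_mul]
    rw [sampleMean, div_eq_inv_mul]
  · exact fun i _ => integrable_dirac' hf (by simp)

theorem integral_prod_empirical (hN : N ≠ 0) (z : ℕ → Z) {f : Z × Z → ℝ}
    (hf : StronglyMeasurable f) {C : ℝ} (hC : ∀ w, |f w| ≤ C) :
    ∫ w, f w ∂((empirical N z).prod (empirical N z)) =
      (∑ p ∈ (Finset.range N).offDiag, f (z p.1, z p.2) +
        ∑ i ∈ Finset.range N, f (z i, z i)) / N ^ 2 := by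
  classical
  have := isProbabilityMeasure_empirical hN z
  have hsection (t : Z) : StronglyMeasurable fun t' => f (t, t') :=
    hf.comp_measurable measurable_prodMk_left
  have hmean : StronglyMeasurable fun t => sampleMean N (fun t' => f (t, t')) z := by
    have (i : ℕ) : StronglyMeasurable fun t => f (t, z i) :=
      hf.comp_measurable measurable_prodMk_right
    exact (Finset.stronglyMeasurable_fun_sum _ fun i _ => this i).mul_const (N : ℝ)⁻¹
  rw [integral_prod _ (.of_bound hf.aestronglyMeasurable C (.of_forall hC))]
  simp only [fun t => integral_empirical N z (hsection t)]
  rw [integral_empirical N z hmean]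
  simp only [sampleMean]
  rw [← Finset.sum_div, div_div, ← sq, ← Finset.sum_product', ← Finset.diag_union_offDiag,
    Finset.sum_union (Finset.disjoint_diag_offDiag _), add_comm, Finset.sum_diag]

end Empirical

theorem continuousMap_apply_le_add_norm_sub {Z : Type*} [TopologicalSpace Z] [CompactSpace Z]
    (f g : C(Z, ℝ)) (z : Z) : f z ≤ g z + ‖f - g‖ := by
  have := le_of_abs_le ((f - g).norm_coe_le_norm z)
  rw [ContinuousMap.sub_apply] at this
  linarith

section PairEval

variable {S Y : Type*} [TopologicalSpace Y]

/-- The function of pairs of labelled points given by a function of pairs of points with values in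
the functions of pairs of labels. -/
def pairEval (c : S × S → C(Y × Y, ℝ)) (w : (S × Y) × (S × Y)) : ℝ :=
  c (w.1.1, w.2.1) (w.1.2, w.2.2)

variable [CompactSpace Y]

theorem continuous_pairEval [TopologicalSpace S] {c : S × S → C(Y × Y, ℝ)} (hc : Continuous c) :
    Continuous (pairEval c) := by
  unfold pairEval
  fun_prop

theorem pairEval_le_norm (c : S × S → C(Y × Y, ℝ)) (w : (S × Y) × (S × Y)) :
    |pairEval c w| ≤ ‖c (w.1.1, w.2.1)‖ :=
  (c _).norm_coe_le_norm _

variable [MeasurableSpace S] [TopologicalSpace.PseudoMetrizableSpace Y]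
  [SecondCountableTopology Y] [MeasurableSpace Y] [OpensMeasurableSpace Y]

theorem stronglyMeasurable_pairEval {c : S × S → C(Y × Y, ℝ)} (hc : StronglyMeasurable c) :
    StronglyMeasurable (pairEval c) := by
  have hpoints : StronglyMeasurable fun w : (S × Y) × (S × Y) => c (w.1.1, w.2.1) :=
    hc.comp_measurable (g := fun w : (S × Y) × (S × Y) => (w.1.1, w.2.1)) (by fun_prop)
  have hlabels : StronglyMeasurable fun w : (S × Y) × (S × Y) => (w.1.2, w.2.2) :=
    Measurable.stronglyMeasurable (by fun_prop)
  exact (by fun_prop : Continuous fun q : C(Y × Y, ℝ) × (Y × Y) =>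
    q.1 q.2).comp_stronglyMeasurable (hpoints.prodMk hlabels)

/-- The diagonal, on which nothing is known about `c`, contributes the error `C / N`. -/
theorem integral_pairEval_empirical_le {c : S × S → C(Y × Y, ℝ)} (hc : StronglyMeasurable c)
    {C : ℝ} (hC : ∀ q, ‖c q‖ ≤ C) {N : ℕ} (hN : N ≠ 0) (t : ℕ → S) (y : ℕ → Y)
    {h : ℕ × ℕ → C(Y × Y, ℝ)} {δ η : ℝ}
    (hδ : ∑ p ∈ (Finset.range N).offDiag, h p (y p.1, y p.2) ≤ δ * N ^ 2)
    (hη : ∑ p ∈ (Finset.range N).offDiag, ‖h p - c (t p.1, t p.2)‖ ≤ η * N ^ 2) :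
    ∫ w, pairEval c w ∂((empirical N fun i => (t i, y i)).prod (empirical N fun i => (t i, y i))) ≤
      δ + η + C / N := by
  have hoff : ∑ p ∈ (Finset.range N).offDiag, pairEval c ((t p.1, y p.1), (t p.2, y p.2)) ≤
      (δ + η) * N ^ 2 := by
    calc ∑ p ∈ (Finset.range N).offDiag, pairEval c ((t p.1, y p.1), (t p.2, y p.2))
        ≤ ∑ p ∈ (Finset.range N).offDiag,
            (h p (y p.1, y p.2) + ‖h p - c (t p.1, t p.2)‖) := by
          refine Finset.sum_le_sum fun p _ => ?_
          rw [norm_sub_rev]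
          exact continuousMap_apply_le_add_norm_sub _ _ _
      _ ≤ (δ + η) * N ^ 2 := by
          rw [Finset.sum_add_distrib]
          linarith
  have hdiag : ∑ i ∈ Finset.range N, pairEval c ((t i, y i), (t i, y i)) ≤ N * C := by
    calc ∑ i ∈ Finset.range N, pairEval c ((t i, y i), (t i, y i))
        ≤ ∑ _i ∈ Finset.range N, C := Finset.sum_le_sum fun i _ =>
          (le_of_abs_le (pairEval_le_norm c _)).trans (hC _)
      _ = N * C := by simp
  rw [integral_prod_empirical hN _ (stronglyMeasurable_pairEval hc)
    fun w => (pairEval_le_norm c w).trans (hC _), div_le_iff₀ (by positivity)]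
  calc _ ≤ (δ + η) * N ^ 2 + N * C := add_le_add hoff hdiag
    _ = (δ + η + C / N) * N ^ 2 := by field_simp

theorem integral_pairEval_le_add {c H : S × S → C(Y × Y, ℝ)} (hc : StronglyMeasurable c)
    (hH : StronglyMeasurable H) {C D : ℝ} (hC : ∀ q, ‖c q‖ ≤ C) (hD : ∀ q, ‖H q‖ ≤ D)
    (Θ : Measure (S × Y)) [IsFiniteMeasure Θ] :
    ∫ w, pairEval H w ∂(Θ.prod Θ) ≤ ∫ w, pairEval c w ∂(Θ.prod Θ) +
      ∫ q, ‖H q - c q‖ ∂((Θ.map Prod.fst).prod (Θ.map Prod.fst)) := by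
  have hmap : (Θ.prod Θ).map (fun w => (w.1.1, w.2.1)) =
      (Θ.map Prod.fst).prod (Θ.map Prod.fst) :=
    (Measure.map_prod_map _ _ measurable_fst measurable_fst).symm
  have hfst : Measurable fun w : (S × Y) × (S × Y) => (w.1.1, w.2.1) := by fun_prop
  have hbound (q : S × S) : ‖‖H q - c q‖‖ ≤ D + C :=
    (norm_norm _).trans_le ((norm_sub_le _ _).trans (add_le_add (hD q) (hC q)))
  have hnorm : StronglyMeasurable fun q => ‖H q - c q‖ := (hH.sub hc).norm
  have hci : Integrable (pairEval c) (Θ.prod Θ) :=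
    .of_bound (stronglyMeasurable_pairEval hc).aestronglyMeasurable C
      (.of_forall fun w => (pairEval_le_norm c w).trans (hC _))
  have hHi : Integrable (pairEval H) (Θ.prod Θ) :=
    .of_bound (stronglyMeasurable_pairEval hH).aestronglyMeasurable D
      (.of_forall fun w => (pairEval_le_norm H w).trans (hD _))
  have hei : Integrable (fun w : (S × Y) × (S × Y) => ‖H (w.1.1, w.2.1) - c (w.1.1, w.2.1)‖)
      (Θ.prod Θ) :=
    .of_bound (hnorm.comp_measurable hfst).aestronglyMeasurable (D + C)
      (.of_forall fun w => hbound _)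
  rw [← hmap, integral_map hfst.aemeasurable hnorm.aestronglyMeasurable, ← integral_add hci hei]
  exact integral_mono hHi (hci.add hei) fun w => continuousMap_apply_le_add_norm_sub _ _ _

theorem ae_pairEval_eq_zero {c : ℕ → S × S → C(Y × Y, ℝ)} {H : S × S → C(Y × Y, ℝ)}
    (hc : ∀ j, StronglyMeasurable (c j)) (hH : StronglyMeasurable H) {C : ℕ → ℝ} {D : ℝ}
    (hC : ∀ j q, ‖c j q‖ ≤ C j) (hD : ∀ q, ‖H q‖ ≤ D) (hH0 : 0 ≤ pairEval H)
    {Θ : Measure (S × Y)} [IsFiniteMeasure Θ]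
    (hΘ : ∀ j, ∫ w, pairEval (c j) w ∂(Θ.prod Θ) ≤ (1 / 2) ^ j)
    (herr : ∀ j, ∫ q, ‖H q - c j q‖ ∂((Θ.map Prod.fst).prod (Θ.map Prod.fst)) ≤ (1 / 2) ^ j) :
    pairEval H =ᵐ[Θ.prod Θ] 0 := by
  have hbound (j : ℕ) : ∫ w, pairEval H w ∂(Θ.prod Θ) ≤ (1 / 2) ^ j + (1 / 2) ^ j :=
    (integral_pairEval_le_add (hc j) hH (hC j) hD Θ).trans (add_le_add (hΘ j) (herr j))
  have hpow : Tendsto (fun j : ℕ => (1 / 2 : ℝ) ^ j) atTop (𝓝 0) :=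
    tendsto_pow_atTop_nhds_zero_of_lt_one (by norm_num) (by norm_num)
  have hlim : Tendsto (fun j : ℕ => (1 / 2 : ℝ) ^ j + (1 / 2) ^ j) atTop (𝓝 0) := by
    simpa using hpow.add hpow
  have hzero : ∫ w, pairEval H w ∂(Θ.prod Θ) = 0 :=
    le_antisymm (ge_of_tendsto' hlim hbound) (integral_nonneg hH0)
  exact (integral_eq_zero_iff_of_nonneg hH0 <| .of_bound
    (stronglyMeasurable_pairEval hH).aestronglyMeasurable _
    (.of_forall fun w => (pairEval_le_norm H w).trans (hD _))).1 hzero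

end PairEval

theorem exists_continuousMap_seq_tsum_le {Z E : Type*} [TopologicalSpace Z] [NormalSpace Z]
    [MeasurableSpace Z] [BorelSpace Z] [NormedAddCommGroup E] [NormedSpace ℝ E] {m : Measure Z}
    [m.WeaklyRegular] {H : Z → E} (hH : Integrable H m) {ε : ℝ≥0∞} (hε : ε ≠ 0) :
    ∃ c : ℕ → C(Z, E), ∑' j, 2 ^ j * ∫⁻ q, ‖H q - c j q‖ₑ ∂m ≤ ε := by
  obtain ⟨ε', hε', hsum⟩ := ENNReal.exists_pos_sum_of_countable' hε ℕ
  choose c hc _ using fun j => hH.exists_boundedContinuous_lintegral_sub_le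
    (ENNReal.div_pos (hε' j).ne' (by finiteness : (2 : ℝ≥0∞) ^ j ≠ ∞)).ne'
  refine ⟨fun j => c j, (ENNReal.tsum_le_tsum fun j => ?_).trans hsum.le⟩
  exact (mul_le_mul_right (hc j) _).trans ENNReal.mul_div_le

section ApproxCouplings

variable {S Y : Type*} [MetricSpace S] [MeasurableSpace S] [MetricSpace Y] [MeasurableSpace Y]

/-- The couplings of `m` and `ν` under which each `pairEval (c j)` has mean at most `2⁻ʲ`, up to
an error depending on `n`, and tested only on `j ≤ n` and on the functions in `Ψ` and `Φ`. -/
def approxCouplings (m : Measure S) (ν : Measure Y) (c : ℕ → C(S × S, C(Y × Y, ℝ)))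
    (Ψ : Finset C(S, ℝ)) (Φ : Finset C(Y, ℝ)) (n : ℕ) : Set (ProbabilityMeasure (S × Y)) :=
  {Θ | (∀ a ∈ Ψ, |∫ z, a z.1 ∂(Θ : Measure (S × Y)) - ∫ t, a t ∂m| ≤ 1 / ((n : ℝ) + 1)) ∧
    (∀ b ∈ Φ, |∫ z, b z.2 ∂(Θ : Measure (S × Y)) - ∫ t, b t ∂ν| ≤ 1 / ((n : ℝ) + 1)) ∧
    ∀ j ≤ n, ∫ w, pairEval (c j) w ∂((Θ : Measure (S × Y)).prod (Θ : Measure (S × Y))) ≤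
      1 / ((n : ℝ) + 1) + (1 / 2) ^ j + 1 / ((n : ℝ) + 1)}

variable {m : Measure S} {ν : Measure Y} {c : ℕ → C(S × S, C(Y × Y, ℝ))}

theorem approxCouplings_antitone {Ψ Ψ' : Finset C(S, ℝ)} (hΨ : Ψ ⊆ Ψ') {Φ Φ' : Finset C(Y, ℝ)}
    (hΦ : Φ ⊆ Φ') {n n' : ℕ} (hn : n ≤ n') :
    approxCouplings m ν c Ψ' Φ' n' ⊆ approxCouplings m ν c Ψ Φ n := by
  have hinv : 1 / ((n' : ℝ) + 1) ≤ 1 / ((n : ℝ) + 1) := by gcongr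
  rintro Θ ⟨hfst, hsnd, hpair⟩
  exact ⟨fun a ha => (hfst a (hΨ ha)).trans hinv, fun b hb => (hsnd b (hΦ hb)).trans hinv,
    fun j hj => (hpair j (hj.trans hn)).trans (by gcongr)⟩

variable [CompactSpace S] [BorelSpace S] [CompactSpace Y] [BorelSpace Y]

theorem isClosed_approxCouplings (m : Measure S) (ν : Measure Y)
    (c : ℕ → C(S × S, C(Y × Y, ℝ))) (Ψ : Finset C(S, ℝ)) (Φ : Finset C(Y, ℝ)) (n : ℕ) :
    IsClosed (approxCouplings m ν c Ψ Φ n) := by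
  have hint (f : C(S × Y, ℝ)) :
      Continuous fun Θ : ProbabilityMeasure (S × Y) => ∫ z, f z ∂(Θ : Measure (S × Y)) :=
    ProbabilityMeasure.continuous_integral_continuousMap f
  have hpair (j : ℕ) : Continuous fun Θ : ProbabilityMeasure (S × Y) =>
      ∫ w, pairEval (c j) w ∂((Θ : Measure (S × Y)).prod (Θ : Measure (S × Y))) :=
    (ProbabilityMeasure.continuous_integral_continuousMap
      (⟨pairEval (c j), continuous_pairEval (c j).continuous⟩ : C((S × Y) × (S × Y), ℝ))).comp
        (ProbabilityMeasure.continuous_prod.comp (continuous_id.prodMk continuous_id))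
  simp only [approxCouplings, Set.ofPred_and, Set.ofPred_forall]
  refine .inter ?_ (.inter ?_ ?_)
  · exact isClosed_biInter fun a _ => isClosed_le
      ((hint (a.comp ContinuousMap.fst)).sub continuous_const).abs continuous_const
  · exact isClosed_biInter fun b _ => isClosed_le
      ((hint (b.comp ContinuousMap.snd)).sub continuous_const).abs continuous_const
  · exact isClosed_iInter fun j => isClosed_iInter fun _ => isClosed_le (hpair j) continuous_const

theorem exists_coupling_of_approxCouplings_nonempty [IsFiniteMeasure m] [IsFiniteMeasure ν]
    (h : ∀ Ψ Φ n, (approxCouplings m ν c Ψ Φ n).Nonempty) :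
    ∃ Θ : ProbabilityMeasure (S × Y), (Θ : Measure (S × Y)).map Prod.fst = m ∧
      (Θ : Measure (S × Y)).map Prod.snd = ν ∧
      ∀ j, ∫ w, pairEval (c j) w ∂((Θ : Measure (S × Y)).prod (Θ : Measure (S × Y))) ≤
        (1 / 2) ^ j := by
  classical
  let K (T : Finset C(S, ℝ) × Finset C(Y, ℝ) × ℕ) := approxCouplings m ν c T.1 T.2.1 T.2.2
  obtain ⟨Θ, hΘ⟩ : (⋂ T, K T).Nonempty :=
    IsCompact.nonempty_iInter_of_directed_nonempty_isCompact_isClosed K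
      (directed_of_isDirected_le fun T T' (hT : T ≤ T') =>
        approxCouplings_antitone hT.1 hT.2.1 hT.2.2)
      (fun T => h _ _ _) (fun T => (isClosed_approxCouplings m ν c _ _ _).isCompact)
      fun T => isClosed_approxCouplings m ν c _ _ _
  have hmem (Ψ Φ n) : Θ ∈ approxCouplings m ν c Ψ Φ n := Set.mem_iInter.1 hΘ (Ψ, Φ, n)
  have hinv : Tendsto (fun n : ℕ => 1 / ((n : ℝ) + 1)) atTop (𝓝 0) :=
    tendsto_one_div_add_atTop_nhds_zero_nat
  have heq {u u' : ℝ} (hu : ∀ n : ℕ, |u - u'| ≤ 1 / ((n : ℝ) + 1)) : u = u' :=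
    sub_eq_zero.1 (abs_nonpos_iff.1 (ge_of_tendsto' hinv hu))
  refine ⟨Θ, ?_, ?_, fun j => ?_⟩
  · refine ext_of_forall_integral_eq_of_IsFiniteMeasure fun a => ?_
    rw [integral_map measurable_fst.aemeasurable a.continuous.aestronglyMeasurable]
    exact heq fun n => (hmem {a.toContinuousMap} ∅ n).1 _ (Finset.mem_singleton_self _)
  · refine ext_of_forall_integral_eq_of_IsFiniteMeasure fun b => ?_
    rw [integral_map measurable_snd.aemeasurable b.continuous.aestronglyMeasurable]
    exact heq fun n => (hmem ∅ {b.toContinuousMap} n).2.1 _ (Finset.mem_singleton_self _)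
  · have hlim := (hinv.add_const ((1 / 2 : ℝ) ^ j)).add hinv
    rw [zero_add, add_zero] at hlim
    refine ge_of_tendsto hlim ?_
    filter_upwards [eventually_ge_atTop j] with n hn
    exact (hmem ∅ ∅ n).2.2 j hn

end ApproxCouplings

namespace QMMSpace

variable {Y : Type*} [MetricSpace Y] [CompactSpace Y] (X : QMMSpace)

theorem norm_excess_le (p : X.carrier × X.carrier) :
    ‖(X.excess p : C(Y × Y, ℝ))‖ ≤ ‖excessMap Y‖ := by
  have := norm_integral_le_of_norm_le_const (μ := X.dStar p) (f := fun l => excessMap Y l)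
    (C := ‖excessMap Y‖) (.of_forall fun l => (excessMap Y).norm_coe_le_norm l)
  rwa [probReal_univ, mul_one] at this

theorem stronglyMeasurable_excess :
    StronglyMeasurable fun p => (X.excess p : C(Y × Y, ℝ)) :=
  StronglyMeasurable.integral_kernel (κ := X.dStar)
    (ContinuousMap.continuous (excessMap Y)).stronglyMeasurable

end QMMSpace

theorem sum_norm_le_of_two_pow_mul_sum_enorm_le {ι E : Type*} [SeminormedAddGroup E]
    {s : Finset ι} {f : ι → E} {j N : ℕ} (h : 2 ^ j * ∑ i ∈ s, ‖f i‖ₑ ≤ (N : ℝ≥0∞) ^ 2) :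
    ∑ i ∈ s, ‖f i‖ ≤ (1 / 2) ^ j * (N : ℝ) ^ 2 := by
  have hreal := ENNReal.toReal_mono (by finiteness) h
  rw [ENNReal.toReal_mul, ENNReal.toReal_sum fun i _ => enorm_ne_top] at hreal
  simp only [toReal_enorm, ENNReal.toReal_pow, ENNReal.toReal_ofNat, ENNReal.toReal_natCast]
    at hreal
  rwa [one_div, inv_pow, ← div_eq_inv_mul, le_div_iff₀ (by positivity), mul_comm]

theorem integral_norm_le_of_two_pow_mul_lintegral_enorm_le {α E : Type*} [MeasurableSpace α]
    {μ : Measure α} [NormedAddCommGroup E] {f : α → E} (hf : AEStronglyMeasurable f μ) {j : ℕ}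
    (h : 2 ^ j * ∫⁻ x, ‖f x‖ₑ ∂μ ≤ 1) : ∫ x, ‖f x‖ ∂μ ≤ (1 / 2) ^ j := by
  have hreal := ENNReal.toReal_mono ENNReal.one_ne_top h
  rw [ENNReal.toReal_mul, ENNReal.toReal_pow, ENNReal.toReal_ofNat, ENNReal.toReal_one] at hreal
  rwa [integral_norm_eq_lintegral_enorm hf, one_div, inv_pow, ← one_div,
    le_div_iff₀ (by positivity), mul_comm]

namespace QMMSpace

variable {Y : Type*} [MetricSpace Y] [CompactSpace Y] [MeasurableSpace Y] [BorelSpace Y]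
  (X : QMMSpace) {ν : Measure Y}

theorem approxCouplings_nonempty {S : Type*} [MetricSpace S] [CompactSpace S] [MeasurableSpace S]
    [BorelSpace S] {e : X.carrier → S} (he : Measurable e)
    (hlab : ∀ (Φ : Finset C(Y, ℝ)) (δ : ℝ), 0 < δ → ∀ N : ℕ, N ≠ 0 →
      (X.sampling : Measure DistMatrix) (labelable N Φ ν δ)ᶜ ≤
        ∑ b ∈ Φ, ENNReal.ofReal (‖b‖ ^ 2 / (N * (δ / 2) ^ 2)))
    {c : ℕ → C(S × S, C(Y × Y, ℝ))}
    (hc : ∑' j, 2 ^ j * ∫⁻ p, ‖X.excess p - c j (Prod.map e e p)‖ₑ ∂(X.μ.prod X.μ) ≤ 1 / 4)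
    (Ψ : Finset C(S, ℝ)) (Φ : Finset C(Y, ℝ)) (n : ℕ) :
    (approxCouplings (X.μ.map e) ν c Ψ Φ n).Nonempty := by
  have hδ : (0 : ℝ) < 1 / (n + 1) := by positivity
  have hmeas (j : ℕ) : Measurable fun p => ‖X.excess p - c j (Prod.map e e p)‖ₑ :=
    (X.stronglyMeasurable_excess.sub ((c j).continuous.stronglyMeasurable.comp_measurable
      (he.prodMap he))).enorm
  have hdiag : ∀ᶠ N : ℕ in atTop, ∀ j ≤ n, ‖c j‖ / N ≤ 1 / ((n : ℝ) + 1) := by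
    refine (Set.finite_Iic n).eventually_all.2 fun j _ => ?_
    exact ((tendsto_const_div_atTop_nhds_zero_nat ‖c j‖).eventually_lt_const hδ).mono
      fun N hN => hN.le
  obtain ⟨N, hdiagN, hN, x, y, hx, hy, hxc, hxy⟩ := (hdiag.and ((eventually_ne_atTop 0).and
    (X.eventually_exists_labelled_sample Φ hδ (hlab Φ _ hδ) Ψ (φ := fun a => a ∘ e)
      (fun a => a.continuous.measurable.comp he) (fun a p => a.norm_coe_le_norm (e p))
      hmeas hc))).exists
  have := isProbabilityMeasure_empirical hN fun i => (e (x i), y i)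
  refine ⟨⟨empirical N fun i => (e (x i), y i), this⟩, fun a ha => ?_, fun b hb => ?_,
    fun j hj => ?_⟩
  · rw [ProbabilityMeasure.coe_mk, integral_empirical N _
      (by fun_prop : Continuous fun z : S × Y => a z.1).stronglyMeasurable,
      integral_map he.aemeasurable a.continuous.aestronglyMeasurable]
    exact hx a ha
  · rw [ProbabilityMeasure.coe_mk, integral_empirical N _
      (by fun_prop : Continuous fun z : S × Y => b z.2).stronglyMeasurable]
    exact hy b hb
  · have hpair := integral_pairEval_empirical_le (c j).continuous.stronglyMeasurable
      (c j).norm_coe_le_norm hN (fun i => e (x i)) y hxy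
      (sum_norm_le_of_two_pow_mul_sum_enorm_le (hxc j))
    exact hpair.trans (add_le_add le_rfl (hdiagN j hj))

theorem exists_coupling {e : X.carrier → I} (he : Measurable e) {s : I → X.carrier}
    (hs : Measurable s) (hse : ∀ x, s (e x) = x) [IsFiniteMeasure ν]
    (hlab : ∀ (Φ : Finset C(Y, ℝ)) (δ : ℝ), 0 < δ → ∀ N : ℕ, N ≠ 0 →
      (X.sampling : Measure DistMatrix) (labelable N Φ ν δ)ᶜ ≤
        ∑ b ∈ Φ, ENNReal.ofReal (‖b‖ ^ 2 / (N * (δ / 2) ^ 2))) :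
    ∃ Θ : ProbabilityMeasure (I × Y), (Θ : Measure (I × Y)).fst = X.μ.map e ∧
      (Θ : Measure (I × Y)).snd = ν ∧
      ∀ᵐ w ∂((Θ : Measure (I × Y)).prod (Θ : Measure (I × Y))),
        X.excess (s w.1.1, s w.2.1) (w.1.2, w.2.2) = 0 := by
  set m : Measure I := X.μ.map e with hm
  have : IsProbabilityMeasure m := Measure.isProbabilityMeasure_map he.aemeasurable
  let H : I × I → C(Y × Y, ℝ) := fun q => X.excess (Prod.map s s q)
  have hHm : StronglyMeasurable H := X.stronglyMeasurable_excess.comp_measurable (hs.prodMap hs)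
  have hHb (q : I × I) : ‖H q‖ ≤ ‖excessMap Y‖ := X.norm_excess_le _
  obtain ⟨c, hc⟩ := exists_continuousMap_seq_tsum_le (m := m.prod m)
    (.of_bound hHm.aestronglyMeasurable _ (.of_forall hHb)) (ε := 1 / 4) (by simp)
  have hdm (j : ℕ) : StronglyMeasurable fun q => H q - c j q :=
    hHm.sub (c j).continuous.stronglyMeasurable
  have hcX : ∑' j, 2 ^ j * ∫⁻ p, ‖X.excess p - c j (Prod.map e e p)‖ₑ ∂(X.μ.prod X.μ) ≤ 1 / 4 := by
    refine le_of_eq_of_le (tsum_congr fun j => ?_) hc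
    rw [hm, Measure.map_prod_map _ _ he he, lintegral_map (hdm j).enorm (he.prodMap he)]
    simp only [H, Prod.map_apply', hse]
  obtain ⟨Θ, hfst, hsnd, hΘ⟩ := exists_coupling_of_approxCouplings_nonempty
    (X.approxCouplings_nonempty he hlab hcX)
  refine ⟨Θ, hfst, hsnd, ae_pairEval_eq_zero (fun j => (c j).continuous.stronglyMeasurable) hHm
    (fun j => (c j).norm_coe_le_norm) hHb (fun w => X.excess_nonneg _ _) hΘ fun j => ?_⟩
  rw [hfst]
  exact integral_norm_le_of_two_pow_mul_lintegral_enorm_le (hdm j).aestronglyMeasurable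
    ((ENNReal.le_tsum j).trans (hc.trans (by simp)))

end QMMSpace

/-! ### Selecting maps from random maps -/

theorem prod_compProd_compProd {A A' B B' : Type*} [MeasurableSpace A] [MeasurableSpace A']
    [MeasurableSpace B] [MeasurableSpace B'] (m : Measure A) [IsFiniteMeasure m] (m' : Measure A')
    [IsFiniteMeasure m'] (θ : Kernel A B) [IsFiniteKernel θ] (θ' : Kernel A' B')
    [IsFiniteKernel θ'] :
    (m ⊗ₘ θ).prod (m' ⊗ₘ θ') = ((m.prod m') ⊗ₘ (θ ∥ₖ θ')).map
      (fun z => ((z.1.1, z.2.1), (z.1.2, z.2.2))) := by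
  refine Measure.prod_eq fun S T hS hT => ?_
  have hr : Measurable fun z : (A × A') × (B × B') => ((z.1.1, z.2.1), (z.1.2, z.2.2)) := by
    fun_prop
  rw [Measure.map_apply hr (hS.prod hT), Measure.compProd_apply (hr (hS.prod hT)),
    Measure.compProd_apply hS, Measure.compProd_apply hT,
    ← lintegral_prod_mul (Kernel.measurable_kernel_prodMk_left hS).aemeasurable
      (Kernel.measurable_kernel_prodMk_left hT).aemeasurable]
  refine lintegral_congr fun p => ?_
  rw [Kernel.parallelComp_apply, ← Measure.prod_prod]
  rfl

section Support

theorem dist_le_of_mem_support {Y : Type*} [PseudoMetricSpace Y] [MeasurableSpace Y]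
    {ν ν' : Measure Y} [SFinite ν'] {r : ℝ} (h : ∀ᵐ q ∂(ν.prod ν'), dist q.1 q.2 ≤ r) {y y' : Y}
    (hy : y ∈ ν.support) (hy' : y' ∈ ν'.support) : dist y y' ≤ r := by
  by_contra! hlt
  obtain ⟨U, hU, V, hV, hUV⟩ := mem_nhds_prod_iff.1
    ((isOpen_lt continuous_const continuous_dist).mem_nhds hlt)
  have hnull : (ν.prod ν') (U ×ˢ V) = 0 :=
    measure_mono_null (fun q hq => not_le.2 (hUV hq)) (ae_iff.1 h)
  rw [Measure.prod_prod] at hnull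
  exact mul_ne_zero ((Measure.mem_support_iff_forall y).1 hy U hU).ne'
    ((Measure.mem_support_iff_forall y').1 hy' V hV).ne' hnull

variable {T Y : Type*} [MeasurableSpace T] [TopologicalSpace Y] [SecondCountableTopology Y]
  [MeasurableSpace Y] [OpensMeasurableSpace Y]

theorem measurableSet_setOf_mem_support (θ : Kernel T Y) :
    MeasurableSet {p : T × Y | p.2 ∈ (θ p.1).support} := by
  obtain ⟨B, hBc, -, hB⟩ := TopologicalSpace.exists_countable_basis Y
  have hbasis : {p : T × Y | p.2 ∈ (θ p.1).support} =
      ⋂ U ∈ B, {p : T × Y | p.2 ∈ U → θ p.1 U ≠ 0} := by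
    ext p
    simp only [Set.mem_ofPred_eq, Set.mem_iInter, hB.nhds_hasBasis.mem_measureSupport,
      pos_iff_ne_zero, and_imp]
  rw [hbasis]
  exact .biInter hBc fun U hU => (measurable_snd (hB.isOpen hU).measurableSet).imp
    (((θ.measurable_coe (hB.isOpen hU).measurableSet).comp measurable_fst)
      (measurableSet_singleton 0)).compl

theorem ae_ae_mem_support {Ω : Type*} [MeasurableSpace Ω] {P : Measure Ω} [SFinite P]
    {m : Measure T} [SFinite m] {θ : Kernel T Y} {G : T → Ω → Y}
    (hG : Measurable (Function.uncurry G)) (hGθ : ∀ t, P.map (G t) = θ t) :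
    ∀ᵐ ω ∂P, ∀ᵐ t ∂m, G t ω ∈ (θ t).support := by
  rw [← Measure.ae_ae_comm (p := fun t ω => G t ω ∈ (θ t).support)
    ((measurable_fst.prodMk hG) (measurableSet_setOf_mem_support θ))]
  refine .of_forall fun t => ae_of_ae_map hG.of_uncurry_left.aemeasurable ?_
  rw [hGθ]
  exact Measure.support_mem_ae

theorem ae_ae_dist_le {T Ω Y : Type*} [MeasurableSpace T] [MeasurableSpace Ω] [PseudoMetricSpace Y]
    [SecondCountableTopology Y] [MeasurableSpace Y] [OpensMeasurableSpace Y] {P : Measure Ω}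
    [SFinite P] {m : Measure T} [SFinite m] {θ : Kernel T Y} [IsSFiniteKernel θ] {G : T → Ω → Y}
    (hG : Measurable (Function.uncurry G)) (hGθ : ∀ t, P.map (G t) = θ t) {r : T × T → ℝ}
    (hr : ∀ᵐ p ∂(m.prod m), ∀ᵐ q ∂((θ p.1).prod (θ p.2)), dist q.1 q.2 ≤ r p) :
    ∀ᵐ ω ∂P, ∀ᵐ p ∂(m.prod m), dist (G p.1 ω) (G p.2 ω) ≤ r p := by
  filter_upwards [ae_ae_mem_support (m := m) hG hGθ] with ω hω
  filter_upwards [hr, Measure.quasiMeasurePreserving_fst.ae hω,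
    Measure.quasiMeasurePreserving_snd.ae hω] with p hp hp₁ hp₂
  exact dist_le_of_mem_support hp hp₁ hp₂

end Support

section RandomAverage

variable {Ω T : Type*} [MeasurableSpace Ω] [MeasurableSpace T] {P : Measure Ω}
  [IsProbabilityMeasure P] {m : Measure T} [IsFiniteMeasure m] {C : ℝ}

theorem abs_sub_integral_le {f : Ω → ℝ} (hf : ∀ ω, |f ω| ≤ C) (ω : Ω) :
    |f ω - ∫ ω, f ω ∂P| ≤ 2 * C := by
  have hmean : |∫ ω, f ω ∂P| ≤ C := by
    simpa using norm_integral_le_of_norm_le_const (f := f) (μ := P) (ae_of_all _ hf)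
  linarith [abs_sub (f ω) (∫ ω, f ω ∂P), hf ω]

theorem norm_centred_mul_centred_le {f g : Ω → ℝ} (hf : ∀ ω, |f ω| ≤ C) (hg : ∀ ω, |g ω| ≤ C)
    (ω : Ω) : ‖(f ω - ∫ ω, f ω ∂P) * (g ω - ∫ ω, g ω ∂P)‖ ≤ (2 * C) ^ 2 := by
  rw [norm_mul, sq]
  exact mul_le_mul (abs_sub_integral_le hf ω) (abs_sub_integral_le hg ω) (norm_nonneg _)
    ((abs_nonneg _).trans (abs_sub_integral_le (P := P) hf ω))

theorem norm_covariance_le {f g : Ω → ℝ} (hf : ∀ ω, |f ω| ≤ C) (hg : ∀ ω, |g ω| ≤ C) :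
    ‖cov[f, g; P]‖ ≤ (2 * C) ^ 2 := by
  simpa [covariance] using norm_integral_le_of_norm_le_const
    (ae_of_all P (norm_centred_mul_centred_le hf hg))

theorem measurable_centred_mul_centred {X : T → Ω → ℝ} (hX : Measurable (Function.uncurry X)) :
    Measurable fun z : (T × T) × Ω =>
      (X z.1.1 z.2 - ∫ ω, X z.1.1 ω ∂P) * (X z.1.2 z.2 - ∫ ω, X z.1.2 ω ∂P) := by
  have hmean : Measurable fun t => ∫ ω, X t ω ∂P :=
    hX.stronglyMeasurable.integral_prod_right'.measurable
  have hcentred : Measurable fun z : T × Ω => X z.1 z.2 - ∫ ω, X z.1 ω ∂P :=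
    hX.sub (hmean.comp measurable_fst)
  exact (hcentred.comp (by fun_prop : Measurable fun z : (T × T) × Ω => (z.1.1, z.2))).mul
    (hcentred.comp (by fun_prop : Measurable fun z : (T × T) × Ω => (z.1.2, z.2)))

theorem integral_integral_swap_of_bounded {X : T → Ω → ℝ} (hX : Measurable (Function.uncurry X))
    (hC : ∀ t ω, |X t ω| ≤ C) : ∫ ω, ∫ t, X t ω ∂m ∂P = ∫ t, ∫ ω, X t ω ∂P ∂m :=
  (integral_integral_swap (.of_bound hX.aestronglyMeasurable C (.of_forall fun _ => hC _ _))).symm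

theorem variance_integral {X : T → Ω → ℝ} (hX : Measurable (Function.uncurry X))
    (hC : ∀ t ω, |X t ω| ≤ C) :
    Var[fun ω => ∫ t, X t ω ∂m; P] = ∫ p, cov[X p.1, X p.2; P] ∂(m.prod m) := by
  have hmean : Integrable (fun t => ∫ ω, X t ω ∂P) m :=
    .of_bound hX.stronglyMeasurable.integral_prod_right'.aestronglyMeasurable C
      (.of_forall fun t => by
        simpa using norm_integral_le_of_norm_le_const (f := X t) (ae_of_all P (hC t)))
  have hsq (ω : Ω) : (∫ t, X t ω ∂m - ∫ ω, ∫ t, X t ω ∂m ∂P) ^ 2 =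
      ∫ p, (X p.1 ω - ∫ ω, X p.1 ω ∂P) * (X p.2 ω - ∫ ω, X p.2 ω ∂P) ∂(m.prod m) := by
    rw [integral_prod_mul (fun t => X t ω - ∫ ω, X t ω ∂P) (fun t => X t ω - ∫ ω, X t ω ∂P), ← sq,
      integral_integral_swap_of_bounded hX hC, integral_sub _ hmean]
    exact .of_bound hX.of_uncurry_right.aestronglyMeasurable C (.of_forall fun t => hC t ω)
  have hint : AEMeasurable (fun ω => ∫ t, X t ω ∂m) P :=
    hX.stronglyMeasurable.integral_prod_left'.measurable.aemeasurable
  rw [variance_eq_integral hint]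
  simp only [hsq]
  exact integral_integral_swap_of_bounded (measurable_centred_mul_centred hX)
    fun p ω => norm_centred_mul_centred_le (hC p.1) (hC p.2) ω

theorem tendsto_variance_integral {X : ℕ → T → Ω → ℝ}
    (hX : ∀ n, Measurable (Function.uncurry (X n))) (hC : ∀ n t ω, |X n t ω| ≤ C)
    (hcov : ∀ᵐ p ∂(m.prod m), Tendsto (fun n => cov[X n p.1, X n p.2; P]) atTop (𝓝 0)) :
    Tendsto (fun n => Var[fun ω => ∫ t, X n t ω ∂m; P]) atTop (𝓝 0) := by
  simp only [variance_integral (hX _) (hC _)]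
  rw [← integral_zero (T × T) ℝ (μ := m.prod m)]
  exact tendsto_integral_of_dominated_convergence (fun _ => (2 * C) ^ 2)
    (fun n => (measurable_centred_mul_centred
      (hX n)).stronglyMeasurable.integral_prod_right'.aestronglyMeasurable)
    (integrable_const _) (fun n => .of_forall fun p => norm_covariance_le (hC n p.1) (hC n p.2))
    hcov

theorem tendsto_measure_le_abs_integral_sub {X : ℕ → T → Ω → ℝ}
    (hX : ∀ n, Measurable (Function.uncurry (X n))) (hC : ∀ n t ω, |X n t ω| ≤ C)
    (hcov : ∀ᵐ p ∂(m.prod m), Tendsto (fun n => cov[X n p.1, X n p.2; P]) atTop (𝓝 0))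
    {ε : ℝ} (hε : 0 < ε) :
    Tendsto (fun n => P {ω | ε ≤ |∫ t, X n t ω ∂m - ∫ t, ∫ ω, X n t ω ∂P ∂m|}) atTop (𝓝 0) := by
  have hlim := ENNReal.tendsto_ofReal ((tendsto_variance_integral hX hC hcov).div_const (ε ^ 2))
  rw [zero_div, ENNReal.ofReal_zero] at hlim
  refine tendsto_of_tendsto_of_tendsto_of_le_of_le tendsto_const_nhds hlim (fun n => zero_le)
    fun n => ?_
  have hmemLp : MemLp (fun ω => ∫ t, X n t ω ∂m) 2 P :=
    .of_bound (hX n).stronglyMeasurable.integral_prod_left'.aestronglyMeasurable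
      (C * m.real Set.univ) (.of_forall fun ω =>
        norm_integral_le_of_norm_le_const (ae_of_all _ fun t => hC n t ω))
  rw [← integral_integral_swap_of_bounded (hX n) (hC n)]
  exact meas_ge_le_variance_div_sq hmemLp hε

end RandomAverage

section CellSelection

/-- The index of the cell of a point in the partition of the unit interval into `n` intervals of
equal length. -/
def cell (n : ℕ) (t : I) : ℕ := ⌊(n : ℝ) * t⌋₊

theorem measurable_cell (n : ℕ) : Measurable (cell n) :=
  Nat.measurable_floor.comp (measurable_subtype_coe.const_mul _)

theorem eventually_cell_ne {t t' : I} (h : t ≠ t') : ∀ᶠ n in atTop, cell n t ≠ cell n t' := by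
  wlog hlt : t < t' generalizing t t'
  · exact (this h.symm (h.symm.lt_of_le (not_lt.1 hlt))).mono fun n hn => hn.symm
  have hgap : Tendsto (fun n : ℕ => (n : ℝ) * ((t' : ℝ) - t)) atTop atTop :=
    tendsto_natCast_atTop_atTop.atTop_mul_const (sub_pos.2 hlt)
  filter_upwards [hgap.eventually_ge_atTop 1] with n hn heq
  have hle : (cell n t : ℝ) ≤ n * t := Nat.floor_le (mul_nonneg n.cast_nonneg t.2.1)
  have hlt' : (n : ℝ) * t' < cell n t' + 1 := Nat.lt_floor_add_one _
  rw [heq] at hle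
  linarith

variable {U Y : Type*} [MeasurableSpace U] [MeasurableSpace Y] {ρ : Measure U}
  [IsProbabilityMeasure ρ] {F : I → U → Y}

/-- The random map choosing `F t u` at `t`, with one random seed `u` for each cell of the partition
of the unit interval. -/
def cellSelection (F : I → U → Y) (n : ℕ) (t : I) (ω : ℕ → U) : Y := F t (ω (cell n t))

theorem measurable_cellSelection (hF : Measurable (Function.uncurry F)) (n : ℕ) :
    Measurable (Function.uncurry (cellSelection F n)) := by
  have heval : Measurable fun q : (ℕ → U) × ℕ => q.1 q.2 :=
    measurable_from_prod_countable_left fun k => measurable_pi_apply k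
  exact hF.comp (measurable_fst.prodMk
    (heval.comp (measurable_snd.prodMk ((measurable_cell n).comp measurable_fst))))

theorem map_cellSelection {t : I} (hF : Measurable (F t)) (n : ℕ) :
    (Measure.infinitePi fun _ : ℕ => ρ).map (cellSelection F n t) = ρ.map (F t) := by
  have heval := measurePreserving_eval_infinitePi (fun _ : ℕ => ρ) (cell n t)
  exact (Measure.map_map hF heval.measurable).symm.trans (by rw [heval.map_eq])

theorem indepFun_cellSelection {t t' : I} (hF : Measurable (F t)) (hF' : Measurable (F t')) {n : ℕ}
    (h : cell n t ≠ cell n t') :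
    cellSelection F n t ⟂ᵢ[Measure.infinitePi fun _ : ℕ => ρ] cellSelection F n t' :=
  ((iIndepFun_infinitePi (P := fun _ : ℕ => ρ) (X := fun _ u => u) fun _ =>
    measurable_id).indepFun h).comp hF hF'

theorem tendsto_covariance_cellSelection (hF : ∀ t, Measurable (F t)) {b : Y → ℝ}
    (hb : Measurable b) {C : ℝ} (hC : ∀ y, |b y| ≤ C) {t t' : I}
    (h : t = t' → ∀ᵐ q ∂((ρ.map (F t)).prod (ρ.map (F t))), q.1 = q.2) :
    Tendsto (fun n => cov[fun ω => b (cellSelection F n t ω),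
      fun ω => b (cellSelection F n t' ω); Measure.infinitePi fun _ : ℕ => ρ]) atTop (𝓝 0) := by
  have hmeas (n : ℕ) (t : I) : Measurable (cellSelection F n t) :=
    (hF t).comp (measurable_pi_apply _)
  have hmemLp (n : ℕ) (t : I) :
      MemLp (fun ω => b (cellSelection F n t ω)) 2 (Measure.infinitePi fun _ : ℕ => ρ) :=
    .of_bound (hb.comp (hmeas n t)).aestronglyMeasurable C (.of_forall fun ω => hC _)
  refine tendsto_const_nhds.congr' ?_
  rcases eq_or_ne t t' with rfl | hne
  · have := Measure.isProbabilityMeasure_map (μ := ρ) (hF t).aemeasurable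
    obtain ⟨y, hy⟩ := (Measure.ae_ae_of_ae_prod (h rfl)).exists
    refine .of_forall fun n => ?_
    rw [← map_cellSelection (hF t) n] at hy
    have hconst : (fun ω => b (cellSelection F n t ω)) =ᵐ[Measure.infinitePi fun _ => ρ]
        fun _ => b y :=
      (ae_of_ae_map (hmeas n t).aemeasurable hy).mono fun ω hω => congrArg b hω.symm
    exact ((covariance_self (hb.comp (hmeas n t)).aemeasurable).trans <|
      (variance_congr hconst).trans <|
        (covariance_self aemeasurable_const).symm.trans (covariance_const_left _)).symm
  · filter_upwards [eventually_cell_ne hne] with n hn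
    exact (((indepFun_cellSelection (hF t) (hF t') hn).comp hb hb).covariance_eq_zero
      (hmemLp n t) (hmemLp n t')).symm

end CellSelection

/-- On the diagonal the hypothesis forces the measures at the atoms of `m` to be Dirac measures;
elsewhere the seeds of distinct cells average out. -/
theorem exists_selection {Y : Type*} [MetricSpace Y] [CompactSpace Y] [MeasurableSpace Y]
    [BorelSpace Y] (m : Measure I) [IsFiniteMeasure m] (θ : Kernel I Y) [IsMarkovKernel θ]
    {r : I × I → ℝ} (hr0 : ∀ t, r (t, t) = 0)
    (hr : ∀ᵐ p ∂(m.prod m), ∀ᵐ q ∂((θ p.1).prod (θ p.2)), dist q.1 q.2 ≤ r p)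
    (Φ : Finset C(Y, ℝ)) {ε : ℝ} (hε : 0 < ε) :
    ∃ g : I → Y, Measurable g ∧ (∀ᵐ p ∂(m.prod m), dist (g p.1) (g p.2) ≤ r p) ∧
      ∀ b ∈ Φ, |∫ t, b (g t) ∂m - ∫ t, ∫ y, b y ∂(θ t) ∂m| < ε := by
  have : Nonempty Y := (θ 0).nonempty_of_neZero
  obtain ⟨F, hF, hFθ⟩ := θ.exists_measurable_map_eq_unitInterval
  let P : Measure (ℕ → I) := Measure.infinitePi fun _ => volume
  have hFt (t : I) : Measurable (F t) := hF.of_uncurry_left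
  have hG := measurable_cellSelection hF
  have hGθ (n : ℕ) (t : I) : P.map (cellSelection F n t) = θ t :=
    (map_cellSelection (hFt t) n).trans (hFθ t)
  have hmean (b : C(Y, ℝ)) (n : ℕ) (t : I) :
      ∫ ω, b (cellSelection F n t ω) ∂P = ∫ y, b y ∂(θ t) := by
    rw [← hGθ n t, integral_map (hG n).of_uncurry_left.aemeasurable
      b.continuous.aestronglyMeasurable]
  have hcov (b : C(Y, ℝ)) : ∀ᵐ p ∂(m.prod m), Tendsto (fun n =>
      cov[fun ω => b (cellSelection F n p.1 ω), fun ω => b (cellSelection F n p.2 ω); P])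
        atTop (𝓝 0) := by
    filter_upwards [hr] with ⟨t, t'⟩ hp
    refine tendsto_covariance_cellSelection hFt b.continuous.measurable b.norm_coe_le_norm
      fun (hdiag : t = t') => ?_
    subst hdiag
    rw [hFθ]
    exact hp.mono fun q hq => dist_le_zero.1 (hq.trans_eq (hr0 t))
  have hlim (b : C(Y, ℝ)) := tendsto_measure_le_abs_integral_sub
    (X := fun n t ω => b (cellSelection F n t ω)) (fun n => b.continuous.measurable.comp (hG n))
    (fun n t ω => b.norm_coe_le_norm _) (hcov b) hε
  simp only [hmean] at hlim
  have hsum := tendsto_finsetSum Φ fun b _ => hlim b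
  rw [Finset.sum_const_zero] at hsum
  obtain ⟨n, hn⟩ := (hsum.eventually_lt_const one_pos).exists
  have hlip := ae_ae_dist_le (hG n) (hGθ n) hr
  have hbad := (measure_union_le _ _).trans_lt
    ((add_le_add (ae_iff.1 hlip).le (measure_biUnion_finset_le Φ _)).trans_lt
      ((zero_add _).trans_lt hn))
  obtain ⟨ω, hω⟩ := (Set.ne_univ_iff_exists_notMem _).1 fun h =>
    hbad.ne ((congrArg P h).trans measure_univ)
  simp only [Set.mem_union, Set.mem_iUnion, Set.mem_ofPred_eq, not_or, not_not, not_exists,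
    not_le] at hω
  exact ⟨fun t => cellSelection F n t ω, (hG n).of_uncurry_right, hω.1, hω.2⟩

/-! ### Lipschitz maps on limit spaces -/

theorem ae_ae_prod_condKernel {A B : Type*} [MeasurableSpace A] [MeasurableSpace B]
    [StandardBorelSpace B] [Nonempty B] {Θ : Measure (A × B)} [IsFiniteMeasure Θ]
    {Q : (A × B) × (A × B) → Prop} (h : ∀ᵐ w ∂(Θ.prod Θ), Q w) :
    ∀ᵐ p ∂(Θ.fst.prod Θ.fst), ∀ᵐ q ∂((Θ.condKernel p.1).prod (Θ.condKernel p.2)),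
      Q ((p.1, q.1), (p.2, q.2)) := by
  rw [← Θ.disintegrate Θ.condKernel, prod_compProd_compProd] at h
  have hprod := Measure.ae_ae_of_ae_compProd (ae_of_ae_map (by fun_prop) h)
  filter_upwards [hprod] with p hp
  rwa [Kernel.parallelComp_apply] at hp

namespace QMMSpace

variable {Y : Type*} [MetricSpace Y] (X : QMMSpace)

theorem dist_le_lowerEnd_of_excess_eq_zero [CompactSpace Y] {p : X.carrier × X.carrier}
    {y y' : Y} (h : X.excess p (y, y') = 0) : dist y y' ≤ lowerEnd (X.dStar p) := by
  have hc : Continuous fun l : I => max (dist y y' - (l : ℝ)) 0 := by fun_prop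
  rw [excess_apply] at h
  refine le_lowerEnd (IsProbabilityMeasure.ne_zero _) ?_
  filter_upwards [(integral_eq_zero_iff_of_nonneg (fun l => le_max_right _ _)
    (hc.integrable_of_hasCompactSupport (.of_compactSpace _))).1 h] with l hl
  exact sub_nonpos.1 (max_eq_right_iff.1 hl)

variable [MeasurableSpace Y]

theorem le_obsDiam {g : X.carrier → Y} (hg : g ∈ X.Lip1 Y) (κ : ℝ) :
    partialDiam (X.μ.map g) κ ≤ X.obsDiam Y κ :=
  le_iSup₂ (f := fun (g : X.carrier → Y) (_ : g ∈ X.Lip1 Y) => partialDiam (X.μ.map g) κ) g hg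

theorem comp_mem_Lip1 {e : X.carrier → I} (he : Measurable e) {s : I → X.carrier}
    (hse : ∀ x, s (e x) = x) {g : I → Y} (hg : Measurable g)
    (hgr : ∀ᵐ p ∂((X.μ.map e).prod (X.μ.map e)),
      dist (g p.1) (g p.2) ≤ lowerEnd (X.dStar (s p.1, s p.2))) :
    g ∘ e ∈ X.Lip1 Y := by
  refine ⟨hg.comp he, ?_⟩
  rw [Measure.map_prod_map _ _ he he] at hgr
  filter_upwards [ae_of_ae_map (he.prodMap he).aemeasurable hgr] with p hp
  simpa only [Prod.map_fst, Prod.map_snd, hse, Function.comp_apply] using hp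

variable [CompactSpace Y] [BorelSpace Y]

theorem exists_mem_Lip1_of_coupling {e : X.carrier → I} (he : Measurable e) {s : I → X.carrier}
    (hse : ∀ x, s (e x) = x) {Θ : Measure (I × Y)} [IsProbabilityMeasure Θ]
    (hfst : Θ.fst = X.μ.map e)
    (hΘ : ∀ᵐ w ∂(Θ.prod Θ), X.excess (s w.1.1, s w.2.1) (w.1.2, w.2.2) = 0)
    (Φ : Finset C(Y, ℝ)) {ε : ℝ} (hε : 0 < ε) :
    ∃ g ∈ X.Lip1 Y, ∀ b ∈ Φ, |∫ y, b y ∂(X.μ.map g) - ∫ y, b y ∂Θ.snd| < ε := by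
  have : Nonempty Y := Θ.snd.nonempty_of_neZero
  have hdist : ∀ᵐ p ∂(Θ.fst.prod Θ.fst), ∀ᵐ q ∂((Θ.condKernel p.1).prod (Θ.condKernel p.2)),
      dist q.1 q.2 ≤ lowerEnd (X.dStar (s p.1, s p.2)) :=
    (ae_ae_prod_condKernel hΘ).mono fun p hp => hp.mono fun q hq =>
      X.dist_le_lowerEnd_of_excess_eq_zero hq
  obtain ⟨g, hg, hgr, hgΦ⟩ := exists_selection Θ.fst Θ.condKernel
    (r := fun p => lowerEnd (X.dStar (s p.1, s p.2)))
    (fun t => by rw [X.dStar_self, lowerEnd_dirac, Set.Icc.coe_zero]) hdist Φ hε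
  refine ⟨g ∘ e, X.comp_mem_Lip1 he hse hg (hfst ▸ hgr), fun b hb => ?_⟩
  have hpush : ∫ y, b y ∂(X.μ.map (g ∘ e)) = ∫ t, b (g t) ∂Θ.fst := by
    rw [hfst, ← Measure.map_map hg he,
      integral_map hg.aemeasurable b.continuous.aestronglyMeasurable]
  have hcond : ∫ t, ∫ y, b y ∂(Θ.condKernel t) ∂Θ.fst = ∫ y, b y ∂Θ.snd := by
    have hb2 : Continuous fun z : I × Y => b z.2 := by fun_prop
    rw [Measure.integral_condKernel (hb2.integrable_of_hasCompactSupport (.of_compactSpace _)),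
      Measure.snd, integral_map measurable_snd.aemeasurable b.continuous.aestronglyMeasurable]
  rw [hpush, ← hcond]
  exact hgΦ b hb

variable {X}

theorem mem_closure_map_Lip1_of_tendsto {ι : Type*} {L : Filter ι} [L.NeBot] {Z : ι → QMMSpace}
    {f : ∀ i, (Z i).carrier → Y} (hf : ∀ i, f i ∈ (Z i).Lip1 Y)
    (hZ : Tendsto (fun i => (Z i).sampling) L (𝓝 X.sampling)) {ν : ProbabilityMeasure Y}
    (hν : ∀ b : C(Y, ℝ),
      Tendsto (fun i => ∫ t, b t ∂((Z i).μ.map (f i))) L (𝓝 (∫ t, b t ∂(ν : Measure Y)))) :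
    ν ∈ closure {ν' : ProbabilityMeasure Y | ∃ g ∈ X.Lip1 Y, (ν' : Measure Y) = X.μ.map g} := by
  have : Nonempty X.carrier := X.μ.nonempty_of_neZero
  have hemb := measurableEmbedding_sigmoid_comp_embeddingReal X.carrier
  obtain ⟨Θ, hfst, hsnd, hΘ⟩ := X.exists_coupling (ν := (ν : Measure Y)) hemb.measurable
    hemb.measurable_invFun hemb.leftInverse_invFun
    fun Φ δ hδ N hN => measure_labelable_compl_le_of_tendsto hf hZ hν Φ hN hδ
  classical
  refine mem_closure_of_forall_finset fun Φ ε hε => ?_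
  obtain ⟨g, hg, hgΦ⟩ := X.exists_mem_Lip1_of_coupling hemb.measurable hemb.leftInverse_invFun
    hfst hΘ (Φ.image fun b => b.toContinuousMap) hε
  rw [hsnd] at hgΦ
  exact ⟨⟨X.μ.map g, Measure.isProbabilityMeasure_map hg.1.aemeasurable⟩, ⟨g, hg, rfl⟩,
    fun b hb => (hgΦ _ (Finset.mem_image_of_mem _ hb)).le⟩

theorem partialDiam_le_obsDiam_of_tendsto {ι : Type*} {L : Filter ι} [L.NeBot] {Z : ι → QMMSpace}
    {f : ∀ i, (Z i).carrier → Y} (hf : ∀ i, f i ∈ (Z i).Lip1 Y)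
    (hZ : Tendsto (fun i => (Z i).sampling) L (𝓝 X.sampling)) {ν : ProbabilityMeasure Y}
    (hν : ∀ b : C(Y, ℝ),
      Tendsto (fun i => ∫ t, b t ∂((Z i).μ.map (f i))) L (𝓝 (∫ t, b t ∂(ν : Measure Y))))
    (κ : ℝ) : partialDiam (ν : Measure Y) κ ≤ X.obsDiam Y κ := by
  refine closure_minimal ?_ ((lowerSemicontinuous_partialDiam κ).isClosed_preimage _)
    (mem_closure_map_Lip1_of_tendsto hf hZ hν)
  rintro ν' ⟨g, hg, hν'⟩
  simpa only [Set.mem_preimage, Set.mem_Iic, hν'] using X.le_obsDiam hg κ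

theorem obsDiam_le_of_sampling_eq {X' : QMMSpace} (h : X.sampling = X'.sampling) (κ : ℝ) :
    X.obsDiam Y κ ≤ X'.obsDiam Y κ := by
  refine iSup₂_le fun f hf => ?_
  have hsampling : Tendsto (fun _ : ℕ => X.sampling) atTop (𝓝 X'.sampling) :=
    h ▸ tendsto_const_nhds
  exact partialDiam_le_obsDiam_of_tendsto (fun _ => hf) hsampling
    (ν := ⟨X.μ.map f, Measure.isProbabilityMeasure_map hf.1.aemeasurable⟩)
    (fun b => tendsto_const_nhds) κ

theorem obsDiam_eq_of_sampling_eq {X' : QMMSpace} (h : X.sampling = X'.sampling) (κ : ℝ) :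
    X.obsDiam Y κ = X'.obsDiam Y κ :=
  (obsDiam_le_of_sampling_eq h κ).antisymm (obsDiam_le_of_sampling_eq h.symm κ)

theorem le_obsDiam_of_frequently {Z : ℕ → QMMSpace}
    (hZ : Tendsto (fun n => (Z n).sampling) atTop (𝓝 X.sampling)) {κ κ' : ℝ} (hκ : κ' < κ)
    (hκ1 : κ < 1) {c : ℝ≥0∞} (hc : ∃ᶠ n in atTop, c < (Z n).obsDiam Y κ) :
    c ≤ X.obsDiam Y κ' := by
  obtain ⟨φ, hφ, hφc⟩ := extraction_of_frequently_atTop hc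
  simp only [obsDiam, lt_iSup_iff] at hφc
  choose f hf hfc using hφc
  let law (n : ℕ) : ProbabilityMeasure Y :=
    ⟨(Z (φ n)).μ.map (f n), Measure.isProbabilityMeasure_map (hf n).1.aemeasurable⟩
  obtain ⟨ν, ψ, hψ, hν⟩ := CompactSpace.tendsto_subseq law
  have hlim : partialDiam (ν : Measure Y) κ' ≤ X.obsDiam Y κ' :=
    partialDiam_le_obsDiam_of_tendsto (fun n => hf (ψ n))
      (hZ.comp (hφ.tendsto_atTop.comp hψ.tendsto_atTop)) (fun b =>
        ProbabilityMeasure.tendsto_iff_forall_integral_tendsto.1 hν (.mkOfCompact b)) κ'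
  refine hlim.trans' (le_of_not_gt fun hlt => ?_)
  obtain ⟨n, hn⟩ := (eventually_partialDiam_lt hν hκ hκ1 hlt).exists
  exact lt_asymm hn (hfc (ψ n))

theorem limsup_obsDiam_le {Z : ℕ → QMMSpace}
    (hZ : Tendsto (fun n => (Z n).sampling) atTop (𝓝 X.sampling)) {κ κ' : ℝ} (hκ : κ' < κ)
    (hκ1 : κ < 1) : limsup (fun n => (Z n).obsDiam Y κ) atTop ≤ X.obsDiam Y κ' :=
  le_of_forall_lt fun _ hc =>
    let ⟨_, hcc', hc'⟩ := exists_between hc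
    hcc'.trans_le (le_obsDiam_of_frequently hZ hκ hκ1
      (frequently_lt_of_lt_limsup (by isBoundedDefault) hc'))

end QMMSpace

end

theorem mainTheorem3 (Y : Type*) [MetricSpace Y] [CompactSpace Y] [MeasurableSpace Y]
    [BorelSpace Y] :
    ∃ ObsDiam : ChiBar → ℝ → ℝ≥0∞,
      -- it extends the observational diameter of mm-spaces
      (∀ (X : MMSpace) (ζ : ChiBar), X.sampling = ζ →
        ∀ κ : ℝ, 0 < κ → κ < 1 → ObsDiam ζ κ = X.obsDiam Y κ) ∧
      -- qmm-spaces represent exactly the elements of the compactification, and the value at an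
      -- element is given by the `1`-Lipschitz maps on any qmm-space representing it
      (∀ ζ : ChiBar, ∃ X : QMMSpace, X.sampling = ζ) ∧
      (∀ X : QMMSpace, X.sampling ∈ ChiBar) ∧
      (∀ (X : QMMSpace) (ζ : ChiBar), X.sampling = ζ →
        ∀ κ : ℝ, 0 < κ → κ < 1 → ObsDiam ζ κ = X.obsDiam Y κ) ∧
      -- essential upper semicontinuity
      (∀ (ζ : ℕ → ChiBar) (ζ' : ChiBar), Tendsto ζ atTop (𝓝 ζ') →
        ∀ κ κ' : ℝ, 0 < κ' → κ' < κ → κ < 1 →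
          limsup (fun n => ObsDiam (ζ n) κ) atTop ≤ ObsDiam ζ' κ') := by
  have hrep : ∀ ζ : ChiBar, ∃ X : QMMSpace, X.sampling = ζ := fun ζ =>
    exists_qmmSpace_of_isSamplingLaw (isSamplingLaw_of_mem_chiBar ζ.2)
  choose R hR using hrep
  refine ⟨fun ζ κ => (R ζ).obsDiam Y κ, fun X ζ hX κ _ _ => ?_, fun ζ => ⟨R ζ, hR ζ⟩,
    fun X => mem_chiBar_of_isSamplingLaw X.isSamplingLaw_sampling, fun X ζ hX κ _ _ => ?_,
    fun ζ ζ' hζ κ κ' _ hκ hκ1 => ?_⟩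
  · rw [← X.toQMM_obsDiam Y κ]
    exact QMMSpace.obsDiam_eq_of_sampling_eq ((hR ζ).trans (hX.symm.trans X.toQMM_sampling.symm)) κ
  · exact QMMSpace.obsDiam_eq_of_sampling_eq ((hR ζ).trans hX.symm) κ
  · have hlim : Tendsto (fun n => (R (ζ n)).sampling) atTop (𝓝 (R ζ').sampling) := by
      simp only [hR]
      exact (continuous_subtype_val.tendsto ζ').comp hζ
    exact QMMSpace.limsup_obsDiam_le hlim hκ hκ1
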